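/- Let $M$ be a real analytic manifold (finite-dimensional, Hausdorff, countable at infinity) and $N\subset M$ a closed real analytic submanifold. Let $(p,s)\colon \mathrm{ND}_N M\to M\times\mathbb R$ be the normal deformation of $M$ along $N$: as a set it is $(M\times\mathbb R_{\neq0})\sqcup T_NM$, with the analytic coordinates $(v,y,s)$, $(p,s)(v,y,s)=((sv,y),s)$, for each chart $(x,y)$ of $M$ in which $N=\{x=0\}$. Put $X=M\times\mathbb{RP}$ with $\mathbb{RP}=\mathbb R\cup\{\infty\}$, $Y=N\times\{0\}\subset X$, and let $\pi\colon\mathrm{Bl}_YX\to X$ be the real projective blow-up of $X$ with center $Y$ (as a set $(X\setminus Y)\sqcup P_YX$, where $P_YX$ is the projectivized normal bundle). Let $j\colon \mathrm{ND}_NM\to \mathrm{Bl}_YX$ be the map over the inclusion $M\times\mathbb R\subset X$ given by $(x,t)\mapsto(x,t)$ on $M\times\mathbb R_{\neq0}$ and by $v\mapsto[v,1]\in P_YX$ on $T_NM$. A bordered space is a pair $(U,C)$ with $U$ an open subset of a good space $C$ (Hausdorff, locally compact, countable at infinity, of finite soft dimension; the last condition is automatic for finite-dimensional manifolds). A morphism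 $(U,C)\to(V,D)$ is a continuous map $f\colon U\to V$ such that the closure $\overline{\Gamma_f}$ of its graph in $C\times D$ is proper over $C$; it is semiproper if $\overline{\Gamma_f}$ is proper over $D$. A space $S$ is identified with $(S,S)$. A bordered compactification of a space $U$ over $S$, for $p\colon U\to S$ continuous, is a bordered space $(U,C)$ such that $p$ is a semiproper morphism $(U,C)\to S$. A bordered space $(U,C)$ is real analytic if $C$ is a real analytic manifold and $U$ is a subanalytic open subset of $C$; a morphism $f$ of such spaces is a morphism of bordered spaces such that $f$ is real analytic and $\overline{\Gamma_f}$ is subanalytic in $C\times D$. Then: 1. $\mathrm{ND}_NM$ and $\mathrm{Bl}_YX$ are real analytic manifolds, $j$ is an open embedding that is a real analytic isomorphism onto its image, $\pi\circ j=(p,s)$, and $(\mathrm{ND}_NM,\mathrm{Bl}_YX)$, formed with $j$, is a real analytic bordered space. 2. The map $p$ is a morphism of real analytic bordered spaces $(\mathrm{ND}_NM,\mathrm{Bl}_YX)\to M$, and it is semiproper. Hence $(\mathrm{ND}_NM,\mathrm{Bl}_YX)$ is a bordered compactification of $\mathrm{ND}_NM$ over $M$; it is the one, up to isomorphism: for every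 bordered compactification $(\mathrm{ND}_NM,C)$ of $\mathrm{ND}_NM$ over $M$, the identity of $\mathrm{ND}_NM$ is an isomorphism of bordered spaces $(\mathrm{ND}_NM,C)\simeq(\mathrm{ND}_NM,\mathrm{Bl}_YX)$. 3. The projection $\mathrm{Bl}_YX\to X\to M$ is proper. -/

import Mathlib

open scoped Manifold ContDiff

set_option linter.unusedSectionVars false

noncomputable section

namespace BorderedND

open Set Filter Topology
open scoped LinearAlgebra.Projectivization

section Submanifold

variable (E : Type*) [NormedAddCommGroup E] [NormedSpace ℝ E]
  (M : Type*) [TopologicalSpace M] [ChartedSpace E M]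

/-- A closed real analytic submanifold of a real analytic manifold `M` modelled on `E`: a closed
subset which near each of its points is, in a suitable analytic chart `φ`, the kernel of a linear
projection `P` of `E`. The rank of `P` (the codimension) may vary from point to point. -/
structure ClosedSubmanifold where
  carrier : Set M
  isClosed : IsClosed carrier
  exists_slice : ∀ x ∈ carrier, ∃ φ ∈ IsManifold.maximalAtlas 𝓘(ℝ, E) ω M, x ∈ φ.source ∧
    ∃ P : E →L[ℝ] E, (∀ e, P (P e) = P e) ∧ ∀ y ∈ φ.source, y ∈ carrier ↔ P (φ y) = 0

variable {E M}

/-- A slice chart of `N`: an analytic chart `φ` of `M` with a linear projection `P`, so that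
`E = range P ⊕ ker P` has the coordinates `(x, y)` and `N` is given by `x = 0`. -/
structure SliceChart (N : ClosedSubmanifold E M) where
  φ : OpenPartialHomeomorph M E
  mem : φ ∈ IsManifold.maximalAtlas 𝓘(ℝ, E) ω M
  P : E →L[ℝ] E
  P_P : ∀ e, P (P e) = P e
  mem_iff : ∀ y ∈ φ.source, y ∈ N.carrier ↔ P (φ y) = 0

/-- The tangent space `T_xN` inside `T_xM`: the vectors that annihilate all germs at `x` of real
analytic functions vanishing on `N`. -/
def tangentSub (N : ClosedSubmanifold E M) (x : M) : Submodule ℝ (TangentSpace 𝓘(ℝ, E) x) where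
  carrier := {v | ∀ f : M → ℝ, ContMDiffAt 𝓘(ℝ, E) 𝓘(ℝ, ℝ) ω f x →
    (∀ᶠ y in 𝓝 x, y ∈ N.carrier → f y = 0) →
    (mfderiv 𝓘(ℝ, E) 𝓘(ℝ, ℝ) f x v : ℝ) = 0}
  add_mem' := fun {a b} ha hb f hf h0 => by
    rw [map_add]
    have h1 := ha f hf h0
    have h2 := hb f hf h0
    erw [h1, h2]; exact add_zero (0 : ℝ)
  zero_mem' := fun f _ _ => map_zero _
  smul_mem' := fun c a ha f hf h0 => by
    rw [map_smul]
    have h1 := ha f hf h0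
    erw [h1]; exact smul_zero c

/-- The fibre `T_xM / T_xN` of the normal bundle `T_NM` at `x ∈ N`. -/
abbrev NormalSpace (N : ClosedSubmanifold E M) (x : M) : Type _ :=
  TangentSpace 𝓘(ℝ, E) x ⧸ tangentSub N x

namespace SliceChart

variable {N : ClosedSubmanifold E M}

/-- The derivative at `x` of the coordinates transversal to `N`. -/
def dP (c : SliceChart N) (x : M) (v : TangentSpace 𝓘(ℝ, E) x) : E :=
  c.P (mfderiv 𝓘(ℝ, E) 𝓘(ℝ, E) c.φ x v)

/-- The coordinates of a normal vector given by a slice chart (at points of `N` they do not depend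
on the chosen representative). -/
def normalCoord (c : SliceChart N) (x : M) (ξ : NormalSpace N x) : E :=
  c.dP x ξ.out

/-- `c.dil e s` is `(s v, y)` for `e = (v, y)`. -/
def dil (c : SliceChart N) (e : E) (s : ℝ) : E := e - c.P e + s • c.P e

/-- The tangent vector of `M` at the point with coordinates `e` given by a coordinate vector. -/
def vec (c : SliceChart N) (e : E) (v : E) : TangentSpace 𝓘(ℝ, E) (c.φ.symm e) :=
  mfderiv 𝓘(ℝ, E) 𝓘(ℝ, E) c.φ.symm e v

lemma P_dil (c : SliceChart N) (e : E) (s : ℝ) : c.P (c.dil e s) = s • c.P e := by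
  simp [dil, c.P_P]

lemma dil_dil (c : SliceChart N) (e : E) (s t : ℝ) : c.dil (c.dil e s) t = c.dil e (t * s) := by
  have h := c.P_dil e s
  unfold dil at h ⊢
  rw [h]
  module

lemma dil_one (c : SliceChart N) (e : E) : c.dil e 1 = e := by simp [dil]

lemma continuous_dil (c : SliceChart N) : Continuous (fun p : E × ℝ => c.dil p.1 p.2) := by
  unfold dil; fun_prop

lemma symm_mem_iff (c : SliceChart N) {e : E} (he : e ∈ c.φ.target) :
    c.φ.symm e ∈ N.carrier ↔ c.P e = 0 := by
  rw [c.mem_iff _ (c.φ.map_target he), c.φ.right_inv he]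

lemma mdiffAt (c : SliceChart N) {x : M} (hx : x ∈ c.φ.source) :
    MDifferentiableAt 𝓘(ℝ, E) 𝓘(ℝ, E) c.φ x :=
  (contMDiffAt_of_mem_maximalAtlas c.mem hx).mdifferentiableAt (by simp)

lemma mdiffAt_symm (c : SliceChart N) {e : E} (he : e ∈ c.φ.target) :
    MDifferentiableAt 𝓘(ℝ, E) 𝓘(ℝ, E) c.φ.symm e :=
  (contMDiffAt_symm_of_mem_maximalAtlas c.mem he).mdifferentiableAt (by simp)

/-- Coordinate changes between slice charts. -/
def trans (c d : SliceChart N) (e : E) : E := d.φ (c.φ.symm e)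

lemma contDiffAt_trans (c d : SliceChart N) {e : E} (he : e ∈ c.φ.target)
    (hd : c.φ.symm e ∈ d.φ.source) : ContDiffAt ℝ ω (c.trans d) e := by
  rw [← contMDiffAt_iff_contDiffAt]
  exact (contMDiffAt_of_mem_maximalAtlas d.mem hd).comp e
    (contMDiffAt_symm_of_mem_maximalAtlas c.mem he)

lemma dP_vec (c d : SliceChart N) {e : E} (he : e ∈ c.φ.target)
    (hd : c.φ.symm e ∈ d.φ.source) (v : E) :
    d.dP _ (c.vec e v) = d.P (fderiv ℝ (c.trans d) e v) := by
  have h := mfderiv_comp (I := 𝓘(ℝ, E)) (I' := 𝓘(ℝ, E)) (I'' := 𝓘(ℝ, E)) e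
    (d.mdiffAt hd) (c.mdiffAt_symm he)
  have h2 : mfderiv 𝓘(ℝ, E) 𝓘(ℝ, E) (c.trans d) e = fderiv ℝ (c.trans d) e := mfderiv_eq_fderiv
  have h3 : mfderiv 𝓘(ℝ, E) 𝓘(ℝ, E) (c.trans d) e = mfderiv 𝓘(ℝ, E) 𝓘(ℝ, E) (d.φ ∘ c.φ.symm) e :=
    rfl
  rw [← h2, h3, h]
  rfl

lemma dP_vec_self (c : SliceChart N) {e : E} (he : e ∈ c.φ.target) (v : E) :
    c.dP _ (c.vec e v) = c.P v := by
  rw [c.dP_vec c he (c.φ.map_target he)]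
  have : c.trans c =ᶠ[𝓝 e] id := by
    filter_upwards [c.φ.open_target.mem_nhds he] with y hy using c.φ.right_inv hy
  rw [this.fderiv_eq]; simp

lemma mem_tangentSub_iff (c : SliceChart N) {x : M} (hx : x ∈ c.φ.source)
    (hN : x ∈ N.carrier) (v : TangentSpace 𝓘(ℝ, E) x) :
    v ∈ tangentSub N x ↔ c.dP x v = 0 := by
  constructor
  · intro h
    refine SeparatingDual.eq_zero_of_forall_dual_eq_zero (R := ℝ) fun l => ?_
    have hd : ContMDiffAt 𝓘(ℝ, E) 𝓘(ℝ, ℝ) ω (fun y => l (c.P (c.φ y))) x :=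
      ((l.comp c.P).contMDiff.contMDiffAt).comp x (contMDiffAt_of_mem_maximalAtlas c.mem hx)
    have := h _ hd (by
      filter_upwards [c.φ.open_source.mem_nhds hx] with y hy hyN
      rw [(c.mem_iff y hy).1 hyN, map_zero])
    have h2 := mfderiv_comp (I := 𝓘(ℝ, E)) (I' := 𝓘(ℝ, E)) (I'' := 𝓘(ℝ, ℝ)) x
      ((l.comp c.P).differentiableAt).mdifferentiableAt (c.mdiffAt hx)
    have h3 : (fun y => l (c.P (c.φ y))) = (l.comp c.P) ∘ c.φ := rfl
    rw [h3, h2] at this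
    rw [mfderiv_eq_fderiv, ContinuousLinearMap.fderiv] at this
    exact this
  · intro h f hf h0
    set e := c.φ x with he
    have het : e ∈ c.φ.target := c.φ.map_source hx
    have hxe : c.φ.symm e = x := c.φ.left_inv hx
    -- the coordinate vector of v
    set u : E := mfderiv 𝓘(ℝ, E) 𝓘(ℝ, E) c.φ x v with hu
    have hPu : c.P u = 0 := h
    have hPe : c.P e = 0 := (c.mem_iff x hx).1 hN
    let g : E → ℝ := f ∘ c.φ.symm
    have hfx : ContMDiffAt 𝓘(ℝ, E) 𝓘(ℝ, ℝ) ω f (c.φ.symm e) := by rwa [hxe]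
    have hg : ContMDiffAt 𝓘(ℝ, E) 𝓘(ℝ, ℝ) ω g e :=
      ContMDiffAt.comp e hfx (contMDiffAt_symm_of_mem_maximalAtlas c.mem het)
    have hgd : DifferentiableAt ℝ g e := by
      rw [contMDiffAt_iff_contDiffAt] at hg
      exact hg.differentiableAt (by simp)
    have hfg : f =ᶠ[𝓝 x] g ∘ c.φ := by
      filter_upwards [c.φ.open_source.mem_nhds hx] with y hy
      simp [g, c.φ.left_inv hy]
    have hcomp := mfderiv_comp (I' := 𝓘(ℝ, E)) (I'' := 𝓘(ℝ, ℝ)) x hgd.mdifferentiableAt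
      (c.mdiffAt hx)
    have hval : (mfderiv 𝓘(ℝ, E) 𝓘(ℝ, ℝ) f x v : ℝ) = fderiv ℝ g e u := by
      rw [hfg.mfderiv_eq]
      change (mfderiv 𝓘(ℝ, E) 𝓘(ℝ, ℝ) (g ∘ c.φ) x : E →L[ℝ] ℝ) v = _
      rw [← mfderiv_eq_fderiv]
      exact congrArg (fun L : E →L[ℝ] ℝ => L v) hcomp
    rw [hval]
    -- g vanishes along the line e + t u
    have hline : HasDerivAt (fun t : ℝ => g (e + t • u)) (fderiv ℝ g e u) 0 := by
      have h1 : HasDerivAt (fun t : ℝ => e + t • u) u 0 := by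
        simpa using ((hasDerivAt_id (0 : ℝ)).smul_const u).const_add e
      have h2 : HasFDerivAt g (fderiv ℝ g e) (e + (0 : ℝ) • u) := by
        simpa using hgd.hasFDerivAt
      exact h2.comp_hasDerivAt 0 h1
    have hzero : (fun t : ℝ => g (e + t • u)) =ᶠ[𝓝 0] fun _ => 0 := by
      have hc : ContinuousAt (fun t : ℝ => e + t • u) 0 := by fun_prop
      have hT : ∀ᶠ t in 𝓝 (0 : ℝ), e + t • u ∈ c.φ.target :=
        hc.eventually (by simpa using c.φ.open_target.mem_nhds het)
      have hS : ∀ᶠ t in 𝓝 (0 : ℝ), (c.φ.symm (e + t • u) ∈ N.carrier → g (e + t • u) = 0) := by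
        have hc2 : ContinuousAt (fun t : ℝ => c.φ.symm (e + t • u)) 0 := by
          refine ContinuousAt.comp (g := c.φ.symm) ?_ hc
          simpa using c.φ.continuousAt_symm het
        have := hc2.eventually (p := fun y => y ∈ N.carrier → f y = 0) (by simpa [hxe] using h0)
        exact this
      filter_upwards [hT, hS] with t h1 h2
      exact h2 ((c.symm_mem_iff h1).2 (by simp [hPu, hPe]))
    have := hline.unique (((hasDerivAt_const (0 : ℝ) (0 : ℝ))).congr_of_eventuallyEq hzero)
    exact this

lemma P_normalCoord (c : SliceChart N) (x : M) (ξ : NormalSpace N x) :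
    c.P (c.normalCoord x ξ) = c.normalCoord x ξ := c.P_P _

lemma dP_sub (c : SliceChart N) (x : M) (v w : TangentSpace 𝓘(ℝ, E) x) :
    c.dP x (v - w) = c.dP x v - c.dP x w :=
  map_sub (c.P.comp (mfderiv 𝓘(ℝ, E) 𝓘(ℝ, E) c.φ x)) v w

lemma dP_smul (c : SliceChart N) (x : M) (t : ℝ) (v : TangentSpace 𝓘(ℝ, E) x) :
    c.dP x (t • v) = t • c.dP x v :=
  map_smul (c.P.comp (mfderiv 𝓘(ℝ, E) 𝓘(ℝ, E) c.φ x)) t v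

lemma normalCoord_mk (c : SliceChart N) {x : M} (hx : x ∈ c.φ.source)
    (hN : x ∈ N.carrier) (v : TangentSpace 𝓘(ℝ, E) x) :
    c.normalCoord x (Submodule.Quotient.mk v) = c.dP x v := by
  set w := (Submodule.Quotient.mk v : NormalSpace N x).out with hw
  have h : (Submodule.Quotient.mk w : NormalSpace N x) = Submodule.Quotient.mk v :=
    Quotient.out_eq _
  rw [Submodule.Quotient.eq, c.mem_tangentSub_iff hx hN] at h
  have h' : c.dP x w - c.dP x v = 0 := by rw [← h, dP_sub]
  exact sub_eq_zero.1 h'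

lemma mk_eq_mk (c : SliceChart N) {x : M} (hx : x ∈ c.φ.source) (hN : x ∈ N.carrier)
    {v w : TangentSpace 𝓘(ℝ, E) x} (h : c.dP x v = c.dP x w) :
    (Submodule.Quotient.mk v : NormalSpace N x) = Submodule.Quotient.mk w := by
  rw [Submodule.Quotient.eq, c.mem_tangentSub_iff hx hN]
  rw [dP_sub, h, sub_self]

open Classical in
/-- The transversal part of a coordinate change, divided by `s` and extended by the derivative
to `s = 0`. -/
def quot (c d : SliceChart N) (e : E) (s : ℝ) : E :=
  if s = 0 then d.P (fderiv ℝ (c.trans d) (c.dil e 0) (c.P e))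
  else s⁻¹ • d.P (c.trans d (c.dil e s))

lemma continuousAt_quot (c d : SliceChart N) {e : E} {s : ℝ} (he : c.dil e s ∈ c.φ.target)
    (hd : c.φ.symm (c.dil e s) ∈ d.φ.source) :
    ContinuousAt (fun p : E × ℝ => c.quot d p.1 p.2) (e, s) := by
  have hdil : ContinuousAt (fun p : E × ℝ => c.dil p.1 p.2) (e, s) := c.continuous_dil.continuousAt
  have hct : ContinuousAt (c.trans d) (c.dil e s) := (c.contDiffAt_trans d he hd).continuousAt
  by_cases hs : s = 0
  · subst hs
    set T := c.trans d with hT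
    set a := c.dil e 0 with ha
    have hsd : HasStrictFDerivAt T (fderiv ℝ T a) a :=
      (c.contDiffAt_trans d he hd).hasStrictFDerivAt (by simp)
    have hfd : ContinuousAt (fderiv ℝ T) a :=
      ((c.contDiffAt_trans d he hd).fderiv_right (m := 0) (by simp)).continuousAt
    have hdil0 : ContinuousAt (fun p : E × ℝ => c.dil p.1 0) (e, 0) :=
      (c.continuous_dil.comp (by fun_prop : Continuous fun p : E × ℝ => (p.1, (0 : ℝ)))).continuousAt
    have hval : c.quot d e 0 = d.P (fderiv ℝ T a (c.P e)) := by simp [quot, hT, ha]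
    -- the main estimate
    have hlit := hsd.isLittleO.comp_tendsto
      (show Tendsto (fun p : E × ℝ => (c.dil p.1 p.2, c.dil p.1 0)) (𝓝 (e, 0)) (𝓝 (a, a)) from
        (hdil.prodMk hdil0))
    have hA : ContinuousAt (fun p : E × ℝ => d.P (fderiv ℝ T a (c.P p.1))) (e, 0) := by fun_prop
    have hA0 : ContinuousAt (fun p : E × ℝ => d.P (fderiv ℝ T (c.dil p.1 0) (c.P p.1))) (e, 0) := by
      have h1 : ContinuousAt (fun p : E × ℝ => fderiv ℝ T (c.dil p.1 0)) (e, 0) :=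
        ContinuousAt.comp (g := fderiv ℝ T) (f := fun p : E × ℝ => c.dil p.1 0) hfd hdil0
      have h2 : ContinuousAt (fun p : E × ℝ => c.P p.1) (e, 0) := by fun_prop
      exact d.P.continuous.continuousAt.comp (h1.clm_apply h2)
    have hvan : ∀ᶠ p : E × ℝ in 𝓝 (e, 0), d.P (T (c.dil p.1 0)) = 0 := by
      have h1 := hdil0.eventually (c.φ.open_target.mem_nhds he)
      have h2 : ContinuousAt (fun p : E × ℝ => c.φ.symm (c.dil p.1 0)) (e, 0) :=
        ContinuousAt.comp (g := c.φ.symm) (f := fun p : E × ℝ => c.dil p.1 0)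
          (c.φ.continuousAt_symm he) hdil0
      have h3 := h2.eventually (d.φ.open_source.mem_nhds hd)
      filter_upwards [h1, h3] with p hp1 hp3
      refine (d.mem_iff _ hp3).1 ((c.symm_mem_iff hp1).2 ?_)
      rw [P_dil, zero_smul]
    rw [ContinuousAt, hval, Metric.tendsto_nhds]
    intro ε hε
    -- bound on P e near e
    set K := ‖c.P e‖ + 1 with hK
    have hKpos : 0 < K := by positivity
    have hPb : ∀ᶠ p : E × ℝ in 𝓝 (e, 0), ‖c.P p.1‖ < K := by
      have : ContinuousAt (fun p : E × ℝ => ‖c.P p.1‖) (e, 0) := by fun_prop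
      exact this.eventually (gt_mem_nhds (by simp [hK]))
    set L := ‖d.P‖ + 1 with hL
    have hLpos : 0 < L := by positivity
    have hb := (Asymptotics.isLittleO_iff.1 hlit) (show (0 : ℝ) < ε / (2 * K * L) by positivity)
    have hA' := Metric.tendsto_nhds.1 hA (ε / 2) (by positivity)
    have hA0' := Metric.tendsto_nhds.1 hA0 ε hε
    filter_upwards [hb, hA', hA0', hvan, hPb] with p hb hA hA0 hvan hPb
    by_cases hp : p.2 = 0
    · simpa [quot, hp] using hA0
    · have hq : c.quot d p.1 p.2 = p.2⁻¹ • d.P (T (c.dil p.1 p.2)) := by simp [quot, hp, hT]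
      have hsub : c.dil p.1 p.2 - c.dil p.1 0 = p.2 • c.P p.1 := by simp [dil]
      simp only [Function.comp] at hb
      rw [hsub] at hb
      have key : p.2⁻¹ • d.P (T (c.dil p.1 p.2)) - d.P (fderiv ℝ T a (c.P p.1))
          = p.2⁻¹ • d.P (T (c.dil p.1 p.2) - T (c.dil p.1 0) - fderiv ℝ T a (p.2 • c.P p.1)) := by
        simp only [map_sub, map_smul, hvan, sub_zero, smul_sub, smul_smul, inv_mul_cancel₀ hp,
          one_smul]
      have hn : ‖p.2⁻¹ • d.P (T (c.dil p.1 p.2)) - d.P (fderiv ℝ T a (c.P p.1))‖ < ε / 2 := by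
        rw [key, norm_smul, norm_inv]
        rw [norm_smul] at hb
        have h1 := d.P.le_opNorm
          (T (c.dil p.1 p.2) - T (c.dil p.1 0) - fderiv ℝ T a (p.2 • c.P p.1))
        have hpn : 0 < ‖p.2‖ := norm_pos_iff.2 hp
        have h2 : ‖d.P‖ < L := by simp [hL]
        calc _ ≤ ‖p.2‖⁻¹ * (‖d.P‖ * (ε / (2 * K * L) * (‖p.2‖ * ‖c.P p.1‖))) := by
              gcongr; exact h1.trans (by gcongr)
          _ = ‖d.P‖ / L * (‖c.P p.1‖ / K) * (ε / 2) := by field_simp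
          _ < 1 * (ε / 2) := by
              gcongr
              have a1 : ‖d.P‖ / L ≤ 1 := ((div_lt_one hLpos).2 h2).le
              have a2 : ‖c.P p.1‖ / K < 1 := (div_lt_one hKpos).2 hPb
              have a3 : 0 ≤ ‖c.P p.1‖ / K := by positivity
              nlinarith
          _ = ε / 2 := one_mul _
      rw [hq]
      calc _ ≤ dist (p.2⁻¹ • d.P (T (c.dil p.1 p.2))) (d.P (fderiv ℝ T a (c.P p.1)))
            + dist (d.P (fderiv ℝ T a (c.P p.1))) (d.P (fderiv ℝ T a (c.P e))) :=
              dist_triangle _ _ _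
        _ < ε / 2 + ε / 2 := by rw [dist_eq_norm]; gcongr
        _ = ε := by ring
  · have h1 : ∀ᶠ p : E × ℝ in 𝓝 (e, s), p.2 ≠ 0 :=
      continuousAt_snd.eventually_ne hs
    have h2 : ContinuousAt (fun p : E × ℝ => p.2⁻¹ • d.P (c.trans d (c.dil p.1 p.2))) (e, s) := by
      have h3 : ContinuousAt (fun p : E × ℝ => c.trans d (c.dil p.1 p.2)) (e, s) :=
        ContinuousAt.comp (g := c.trans d) (f := fun p : E × ℝ => c.dil p.1 p.2) hct hdil
      have h4 : ContinuousAt (fun p : E × ℝ => p.2⁻¹) (e, s) := continuousAt_snd.inv₀ hs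
      exact h4.smul (d.P.continuous.continuousAt.comp h3)
    refine h2.congr ?_
    filter_upwards [h1] with p hp
    simp [quot, hp]

end SliceChart

variable {N : ClosedSubmanifold E M}

/-- The domain of the coordinate change between two charts. -/
def overlap (φ ψ : OpenPartialHomeomorph M E) : Set E := φ.target ∩ φ.symm ⁻¹' ψ.source

lemma isOpen_overlap (φ ψ : OpenPartialHomeomorph M E) : IsOpen (overlap φ ψ) :=
  φ.continuousOn_symm.isOpen_inter_preimage φ.open_target ψ.open_source

lemma continuousOn_overlap (φ ψ : OpenPartialHomeomorph M E) :
    ContinuousOn (fun e => ψ (φ.symm e)) (overlap φ ψ) :=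
  ψ.continuousOn.comp (φ.continuousOn_symm.mono inter_subset_left) fun _ h => h.2

/-- The underlying set of the normal deformation: `M × ℝ_{≠0}` together with the normal
bundle `T_NM`. -/
inductive NormalDeformation (N : ClosedSubmanifold E M)
  | away (x : M) (t : ℝ) (ht : t ≠ 0)
  | normal (x : M) (hx : x ∈ N.carrier) (ξ : NormalSpace N x)

namespace NormalDeformation

/-- The projection to `M`. -/
def p : NormalDeformation N → M
  | away x _ _ => x
  | normal x _ _ => x

/-- The deformation parameter. -/
def s : NormalDeformation N → ℝ
  | away _ t _ => t
  | normal _ _ _ => 0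

lemma normal_eq_normal (c : SliceChart N) {x y : M} (hx : x ∈ N.carrier) (hy : y ∈ N.carrier)
    (hxc : x ∈ c.φ.source) (hxy : x = y) {v : TangentSpace 𝓘(ℝ, E) x}
    {w : TangentSpace 𝓘(ℝ, E) y} (h : c.dP x v = c.dP y w) :
    normal x hx (Submodule.Quotient.mk v) = normal y hy (Submodule.Quotient.mk w) := by
  subst hxy
  rw [c.mk_eq_mk hxc hx h]

open Classical in
/-- A chart `φ` of `M` gives the chart `(φ x, t)` on the open subset `s ≠ 0`, that is
`M × ℝ_{≠0}`. -/
def awayChart (N : ClosedSubmanifold E M) (φ : OpenPartialHomeomorph M E) :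
    PartialEquiv (NormalDeformation N) (E × ℝ) where
  toFun d := (φ d.p, d.s)
  invFun q := if h : q.2 ≠ 0 then away (φ.symm q.1) q.2 h else away (φ.symm q.1) 1 one_ne_zero
  source := {d | d.p ∈ φ.source ∧ d.s ≠ 0}
  target := {q | q.1 ∈ φ.target ∧ q.2 ≠ 0}
  map_source' := fun d hd => ⟨φ.map_source hd.1, hd.2⟩
  map_target' := fun q hq => by
    have h : q.2 ≠ 0 := hq.2
    simp only [h, ne_eq, not_false_eq_true, dite_true]
    exact ⟨φ.map_target hq.1, h⟩
  left_inv' := fun d hd => by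
    cases d with
    | away x t ht =>
      have h : φ.symm (φ x) = x := φ.left_inv hd.1
      simp [s, p, ht, h]
    | normal x hx ξ => exact absurd rfl hd.2
  right_inv' := fun q hq => by
    have h : q.2 ≠ 0 := hq.2
    simp [h, p, s, φ.right_inv hq.1]

/-- The coordinates `(v, y, s)` given by a slice chart: one has `p (v, y, s) = (s v, y)`, and
for `s = 0` they are the coordinates of `T_NM`. -/
def sliceCoord (c : SliceChart N) : NormalDeformation N → E × ℝ
  | away x t _ => (c.dil (c.φ x) t⁻¹, t)
  | normal x _ ξ => (c.φ x + c.normalCoord x ξ, 0)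

open Classical in
/-- The inverse of `sliceCoord c`. -/
def sliceParam (c : SliceChart N) (q : E × ℝ) : NormalDeformation N :=
  if h : q.2 ≠ 0 then away (c.φ.symm (c.dil q.1 q.2)) q.2 h
  else if hN : c.φ.symm (c.dil q.1 q.2) ∈ N.carrier then
    normal _ hN (Submodule.Quotient.mk (c.vec (c.dil q.1 q.2) (c.P q.1)))
  else away (c.φ.symm q.1) 1 one_ne_zero

lemma sliceParam_ne (c : SliceChart N) {q : E × ℝ} (h : q.2 ≠ 0) :
    sliceParam c q = away (c.φ.symm (c.dil q.1 q.2)) q.2 h := by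
  simp [sliceParam, h]

lemma mem_of_eq_zero (c : SliceChart N) {q : E × ℝ} (hq : c.dil q.1 q.2 ∈ c.φ.target)
    (h : q.2 = 0) : c.φ.symm (c.dil q.1 q.2) ∈ N.carrier := by
  rw [c.symm_mem_iff hq, c.P_dil, h, zero_smul]

lemma sliceParam_eq (c : SliceChart N) {q : E × ℝ} (hq : c.dil q.1 q.2 ∈ c.φ.target)
    (h : q.2 = 0) : sliceParam c q = normal _ (mem_of_eq_zero c hq h)
      (Submodule.Quotient.mk (c.vec (c.dil q.1 q.2) (c.P q.1))) := by
  have hN := mem_of_eq_zero c hq h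
  unfold sliceParam
  rw [dif_neg (by simpa using h), dif_pos hN]

lemma p_sliceParam (c : SliceChart N) {q : E × ℝ} (hq : c.dil q.1 q.2 ∈ c.φ.target) :
    (sliceParam c q).p = c.φ.symm (c.dil q.1 q.2) := by
  by_cases h : q.2 = 0
  · rw [sliceParam_eq c hq h]; rfl
  · rw [sliceParam_ne c h]; rfl

lemma s_sliceParam (c : SliceChart N) {q : E × ℝ} (hq : c.dil q.1 q.2 ∈ c.φ.target) :
    (sliceParam c q).s = q.2 := by
  by_cases h : q.2 = 0
  · rw [sliceParam_eq c hq h]; exact h.symm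
  · rw [sliceParam_ne c h]; rfl

/-- The coordinate change between two slice charts, by a formula that makes sense for all `s`. -/
lemma sliceCoord_sliceParam (c d : SliceChart N) {q : E × ℝ} (hq : c.dil q.1 q.2 ∈ c.φ.target)
    (hd : c.φ.symm (c.dil q.1 q.2) ∈ d.φ.source) :
    sliceCoord d (sliceParam c q) =
      (d.dil (c.trans d (c.dil q.1 q.2)) 0 + c.quot d q.1 q.2, q.2) := by
  by_cases h : q.2 = 0
  · have hN := mem_of_eq_zero c hq h
    rw [sliceParam_eq c hq h]
    simp only [sliceCoord]
    rw [d.normalCoord_mk hd hN, c.dP_vec d hq hd]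
    have h0 : d.P (c.trans d (c.dil q.1 q.2)) = 0 := (d.mem_iff _ hd).1 hN
    rw [h] at h0 ⊢
    simp only [SliceChart.quot, if_true, SliceChart.dil, h0] at *
    simp [SliceChart.trans]
  · rw [sliceParam_ne c h]
    simp only [sliceCoord, SliceChart.quot, h, if_false, SliceChart.trans]
    simp [SliceChart.dil]

/-- The chart `(v, y, s)` of the normal deformation given by a slice chart of `N`. -/
def sliceChart (c : SliceChart N) : PartialEquiv (NormalDeformation N) (E × ℝ) where
  toFun := sliceCoord c
  invFun := sliceParam c
  source := {d | d.p ∈ c.φ.source}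
  target := {q | c.dil q.1 q.2 ∈ c.φ.target}
  map_source' := fun d hd => by
    cases d with
    | away x t ht =>
      simp only [sliceCoord, mem_ofPred_eq, c.dil_dil, mul_inv_cancel₀ ht, c.dil_one]
      exact c.φ.map_source hd
    | normal x hx ξ =>
      have hx' : x ∈ c.φ.source := hd
      have h0 : c.P (c.φ x) = 0 := (c.mem_iff x hx').1 hx
      have h1 : c.dil (c.φ x + c.normalCoord x ξ) 0 = c.φ x := by
        simp [SliceChart.dil, h0, c.P_normalCoord]
      simp only [sliceCoord, mem_ofPred_eq, h1]
      exact c.φ.map_source hx'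
  map_target' := fun q hq => by
    rw [mem_ofPred_eq, p_sliceParam c hq]
    exact c.φ.map_target hq
  left_inv' := fun d hd => by
    cases d with
    | away x t ht =>
      rw [sliceParam_ne c (by simpa [sliceCoord] using ht)]
      have h : c.φ.symm (c.φ x) = x := c.φ.left_inv hd
      simp only [sliceCoord, c.dil_dil, mul_inv_cancel₀ ht, c.dil_one, h]
    | normal x hx ξ =>
      have hx' : x ∈ c.φ.source := hd
      have h0 : c.P (c.φ x) = 0 := (c.mem_iff x hx').1 hx
      have hP := c.P_normalCoord x ξ
      have h1 : c.dil (c.φ x + c.normalCoord x ξ) 0 = c.φ x := by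
        simp [SliceChart.dil, h0, hP]
      have ht : c.φ x ∈ c.φ.target := c.φ.map_source hx'
      induction ξ using Submodule.Quotient.induction_on with
      | _ v =>
      rw [sliceParam_eq c (by simp only [sliceCoord, h1]; exact ht) rfl]
      refine (normal_eq_normal c hx _ hx' ?_ ?_).symm
      · simp only [sliceCoord, h1]; exact (c.φ.left_inv hx').symm
      · rw [c.dP_vec_self (by simp only [sliceCoord, h1]; exact ht)]
        simp only [sliceCoord, map_add, h0, zero_add, hP]
        rw [c.normalCoord_mk hx' hx]
  right_inv' := fun q hq => by
    have hq' : c.dil q.1 q.2 ∈ c.φ.target := hq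
    rw [sliceCoord_sliceParam c c hq (c.φ.map_target hq)]
    have h1 : c.trans c =ᶠ[𝓝 (c.dil q.1 q.2)] id := by
      filter_upwards [c.φ.open_target.mem_nhds hq'] with y hy using c.φ.right_inv hy
    have h2 : c.trans c (c.dil q.1 q.2) = c.dil q.1 q.2 := h1.self_of_nhds
    have h3 : c.quot c q.1 q.2 = c.P q.1 := by
      by_cases h : q.2 = 0
      · rw [h] at h1
        simp [SliceChart.quot, h, h1.fderiv_eq, c.P_P]
      · simp [SliceChart.quot, h, h2, c.P_dil, smul_smul]
    rw [h2, h3, c.dil_dil]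
    simp [SliceChart.dil]

lemma source_away_away (φ ψ : OpenPartialHomeomorph M E) :
    ((awayChart N φ).symm.trans (awayChart N ψ)).source =
      {q | q.1 ∈ overlap φ ψ ∧ q.2 ≠ 0} := by
  ext q
  by_cases h : q.2 = 0
  · simp [PartialEquiv.trans_source, awayChart, h]
  · simp [PartialEquiv.trans_source, awayChart, h, p, s, overlap]

lemma source_away_slice (φ : OpenPartialHomeomorph M E) (d : SliceChart N) :
    ((awayChart N φ).symm.trans (sliceChart d)).source =
      {q | q.1 ∈ overlap φ d.φ ∧ q.2 ≠ 0} := by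
  ext q
  by_cases h : q.2 = 0
  · simp [PartialEquiv.trans_source, awayChart, h]
  · simp [PartialEquiv.trans_source, awayChart, sliceChart, h, p, overlap]

lemma source_slice_away (c : SliceChart N) (ψ : OpenPartialHomeomorph M E) :
    ((sliceChart c).symm.trans (awayChart N ψ)).source =
      {q | c.dil q.1 q.2 ∈ overlap c.φ ψ ∧ q.2 ≠ 0} := by
  ext q
  by_cases h : c.dil q.1 q.2 ∈ c.φ.target
  · have h1 : (sliceParam c q).p = _ := p_sliceParam c h
    have h2 : (sliceParam c q).s = _ := s_sliceParam c h
    simp [PartialEquiv.trans_source, awayChart, sliceChart, h, h1, h2, overlap]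
  · simp [PartialEquiv.trans_source, sliceChart, h, overlap]

lemma source_slice_slice (c d : SliceChart N) :
    ((sliceChart c).symm.trans (sliceChart d)).source =
      {q | c.dil q.1 q.2 ∈ overlap c.φ d.φ} := by
  ext q
  by_cases h : c.dil q.1 q.2 ∈ c.φ.target
  · have h1 : (sliceParam c q).p = _ := p_sliceParam c h
    simp [PartialEquiv.trans_source, sliceChart, h, h1, overlap]
  · simp [PartialEquiv.trans_source, sliceChart, h, overlap]

/-- The atlas of the normal deformation: all charts `(φ x, t)` on `M × ℝ_{≠0}` and all charts
`(v, y, s)` given by slice charts of `N`. -/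
def chartCore (N : ClosedSubmanifold E M) [IsManifold 𝓘(ℝ, E) ω M] :
    ChartedSpaceCore (E × ℝ) (NormalDeformation N) where
  atlas := {e | (∃ φ ∈ IsManifold.maximalAtlas 𝓘(ℝ, E) ω M, e = awayChart N φ) ∨
    ∃ c : SliceChart N, e = sliceChart c}
  chartAt
    | away x _ _ => awayChart N (chartAt E x)
    | normal x hx _ => sliceChart
      { φ := (N.exists_slice x hx).choose
        mem := (N.exists_slice x hx).choose_spec.1
        P := (N.exists_slice x hx).choose_spec.2.2.choose
        P_P := (N.exists_slice x hx).choose_spec.2.2.choose_spec.1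
        mem_iff := (N.exists_slice x hx).choose_spec.2.2.choose_spec.2 }
  mem_chart_source
    | away x _ ht => ⟨mem_chart_source E x, ht⟩
    | normal x hx _ => (N.exists_slice x hx).choose_spec.2.1
  chart_mem_atlas
    | away x _ _ => Or.inl ⟨_, IsManifold.chart_mem_maximalAtlas x, rfl⟩
    | normal x hx _ => Or.inr ⟨_, rfl⟩
  open_source := by
    rintro e e' (⟨φ, -, rfl⟩ | ⟨c, rfl⟩) (⟨ψ, -, rfl⟩ | ⟨d, rfl⟩)
    · rw [source_away_away]
      exact (isOpen_overlap φ ψ).preimage continuous_fst |>.inter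
        (isOpen_ne.preimage continuous_snd)
    · rw [source_away_slice]
      exact (isOpen_overlap φ d.φ).preimage continuous_fst |>.inter
        (isOpen_ne.preimage continuous_snd)
    · rw [source_slice_away]
      exact (isOpen_overlap c.φ ψ).preimage c.continuous_dil |>.inter
        (isOpen_ne.preimage continuous_snd)
    · rw [source_slice_slice]
      exact (isOpen_overlap c.φ d.φ).preimage c.continuous_dil
  continuousOn_toFun := by
    rintro e e' (⟨φ, -, rfl⟩ | ⟨c, rfl⟩) (⟨ψ, -, rfl⟩ | ⟨d, rfl⟩)
    · rw [source_away_away]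
      refine ContinuousOn.congr (f := fun q : E × ℝ => (ψ (φ.symm q.1), q.2)) ?_ ?_
      · exact ((continuousOn_overlap φ ψ).comp continuousOn_fst fun q hq => hq.1).prodMk
          continuousOn_snd
      · intro q hq
        have h : q.2 ≠ 0 := hq.2
        simp [awayChart, h, p, s]
    · rw [source_away_slice]
      refine ContinuousOn.congr
        (f := fun q : E × ℝ => (d.dil (d.φ (φ.symm q.1)) q.2⁻¹, q.2)) ?_ ?_
      · have h1 : ContinuousOn (fun q : E × ℝ => (d.φ (φ.symm q.1), q.2⁻¹))
            {q : E × ℝ | q.1 ∈ overlap φ d.φ ∧ q.2 ≠ 0} :=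
          ((continuousOn_overlap φ d.φ).comp continuousOn_fst fun q hq => hq.1).prodMk
            (continuousOn_snd.inv₀ fun q hq => hq.2)
        exact (d.continuous_dil.comp_continuousOn h1).prodMk continuousOn_snd
      · intro q hq
        have h : q.2 ≠ 0 := hq.2
        simp [awayChart, h, sliceChart, sliceCoord]
    · rw [source_slice_away]
      refine ContinuousOn.congr (f := fun q : E × ℝ => (ψ (c.φ.symm (c.dil q.1 q.2)), q.2)) ?_ ?_
      · exact ((continuousOn_overlap c.φ ψ).comp c.continuous_dil.continuousOn
          fun q hq => hq.1).prodMk continuousOn_snd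
      · intro q hq
        have h1 : (sliceParam c q).p = _ := p_sliceParam c hq.1.1
        have h2 : (sliceParam c q).s = _ := s_sliceParam c hq.1.1
        simp [awayChart, sliceChart, h1, h2]
    · rw [source_slice_slice]
      refine ContinuousOn.congr (f := fun q : E × ℝ =>
        (d.dil (c.trans d (c.dil q.1 q.2)) 0 + c.quot d q.1 q.2, q.2)) ?_ ?_
      · intro q hq
        have h1 : ContinuousAt (fun q : E × ℝ => c.trans d (c.dil q.1 q.2)) q :=
          ContinuousAt.comp (g := c.trans d) (f := fun q : E × ℝ => c.dil q.1 q.2)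
            (c.contDiffAt_trans d hq.1 hq.2).continuousAt c.continuous_dil.continuousAt
        have h2 : ContinuousAt (fun q : E × ℝ => d.dil (c.trans d (c.dil q.1 q.2)) 0) q :=
          ContinuousAt.comp (g := fun r : E × ℝ => d.dil r.1 r.2)
            (f := fun q : E × ℝ => (c.trans d (c.dil q.1 q.2), (0 : ℝ)))
            d.continuous_dil.continuousAt (h1.prodMk continuousAt_const)
        exact ((h2.add (c.continuousAt_quot d (e := q.1) (s := q.2) hq.1 hq.2)).prodMk
          continuousAt_snd).continuousWithinAt
      · intro q hq
        exact sliceCoord_sliceParam c d hq.1 hq.2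

instance [IsManifold 𝓘(ℝ, E) ω M] : TopologicalSpace (NormalDeformation N) :=
  (chartCore N).toTopologicalSpace

/-- The real analytic atlas of the normal deformation. -/
instance [IsManifold 𝓘(ℝ, E) ω M] : ChartedSpace (E × ℝ) (NormalDeformation N) :=
  (chartCore N).toChartedSpace

end NormalDeformation

/-- The underlying set of the real projective blow-up of `M` with center `N`: `M ∖ N` together
with the projective normal bundle `P_NM`. -/
inductive BlowUp (N : ClosedSubmanifold E M)
  | away (x : M) (hx : x ∉ N.carrier)
  | exc (x : M) (hx : x ∈ N.carrier) (L : ℙ ℝ (NormalSpace N x))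

/-- A slice chart of `N` with a linear form `ℓ` in the transversal coordinates and a transversal
vector `w` with `ℓ w = 1`. It selects the affine chart `ℓ ≠ 0` of the projective spaces of
normal directions. -/
structure AffineSliceChart (N : ClosedSubmanifold E M) extends SliceChart N where
  ℓ : E →L[ℝ] ℝ
  w : E
  ℓ_P : ∀ e, ℓ (P e) = ℓ e
  P_w : P w = w
  ℓ_w : ℓ w = 1

namespace BlowUp

/-- The projection of the blow-up to `M`. -/
def proj : BlowUp N → M
  | away x _ => x
  | exc x _ _ => x

open Classical in
/-- A chart of `M` whose domain does not meet `N` gives a chart of the blow-up (`b₀` is a junk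
value outside the target). -/
def awayChart (φ : OpenPartialHomeomorph M E) (hφ : ∀ x ∈ φ.source, x ∉ N.carrier)
    (b₀ : BlowUp N) : PartialEquiv (BlowUp N) E where
  toFun b := φ b.proj
  invFun e := if h : φ.symm e ∉ N.carrier then away _ h else b₀
  source := {b | b.proj ∈ φ.source}
  target := φ.target
  map_source' := fun b hb => φ.map_source hb
  map_target' := fun e he => by
    have h := hφ _ (φ.map_target he)
    simp only [h, not_false_eq_true, dite_true]
    exact φ.map_target he
  left_inv' := fun b hb => by
    have hb' : b.proj ∈ φ.source := hb
    cases b with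
    | away x hx =>
      have h : φ.symm (φ x) = x := φ.left_inv hb
      simp [proj, h, hx]
    | exc x hx L => exact absurd hx (hφ x hb')
  right_inv' := fun e he => by
    have h := hφ _ (φ.map_target he)
    simp [h, proj, φ.right_inv he]

/-- The homogeneous coordinates `[v, y, s]` of a point of the blow-up, normalized by `ℓ v = 1` and
encoded as the point `(v - w) + s w + y` of `E`. -/
def sliceCoord (c : AffineSliceChart N) : BlowUp N → E
  | away x _ => (c.ℓ (c.φ x))⁻¹ • c.P (c.φ x) - c.w + c.ℓ (c.φ x) • c.w + (c.φ x - c.P (c.φ x))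
  | exc x _ L => (c.ℓ (c.normalCoord x L.rep))⁻¹ • c.normalCoord x L.rep - c.w + c.φ x

/-- `v + y` for the point with the coordinate `e = (v - w) + s w + y`; moreover `s = ℓ e`. -/
def lift (c : AffineSliceChart N) (e : E) : E := e - c.ℓ e • c.w + c.w

/-- The coordinates `s v + y` of the image in `M`. -/
def down (c : AffineSliceChart N) (e : E) : E := c.dil (lift c e) (c.ℓ e)

/-- The linear form defining the domain of an affine chart. -/
def form (c : AffineSliceChart N) : BlowUp N → ℝ
  | away x _ => c.ℓ (c.φ x)
  | exc x _ L => c.ℓ (c.normalCoord x L.rep)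

open Classical in
/-- The point with homogeneous coordinates `[v, y, s]`: it lies over `s v + y`, and for `s = 0` it
is the normal direction `v` (`b₀` is a junk value outside the target). -/
def sliceParam (c : AffineSliceChart N) (b₀ : BlowUp N) (e : E) : BlowUp N :=
  if h : c.φ.symm (down c e) ∈ N.carrier then
    if h' : (Submodule.Quotient.mk (c.vec (down c e) (c.P (lift c e))) :
        NormalSpace N (c.φ.symm (down c e))) ≠ 0 then
      exc _ h (Projectivization.mk ℝ _ h')
    else b₀
  else away _ h

lemma P_lift (c : AffineSliceChart N) (e : E) :
    c.P (lift c e) = c.P e - c.ℓ e • c.w + c.w := by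
  simp [lift, c.P_w]

lemma ℓ_P_lift (c : AffineSliceChart N) (e : E) : c.ℓ (c.P (lift c e)) = 1 := by
  simp [P_lift, c.ℓ_P, c.ℓ_w]

lemma mem_iff_ℓ (c : AffineSliceChart N) {e : E} (he : down c e ∈ c.φ.target) :
    c.φ.symm (down c e) ∈ N.carrier ↔ c.ℓ e = 0 := by
  rw [c.symm_mem_iff he, down, c.P_dil]
  constructor
  · intro h
    have := congrArg c.ℓ h
    simpa [ℓ_P_lift] using this
  · intro h; rw [h, zero_smul]

lemma mk_ne_zero (c : AffineSliceChart N) {e : E} (he : down c e ∈ c.φ.target)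
    (h : c.φ.symm (down c e) ∈ N.carrier) :
    (Submodule.Quotient.mk (c.vec (down c e) (c.P (lift c e))) :
        NormalSpace N (c.φ.symm (down c e))) ≠ 0 := by
  intro h0
  rw [Submodule.Quotient.mk_eq_zero, c.mem_tangentSub_iff (c.φ.map_target he) h,
    c.dP_vec_self he, c.P_P] at h0
  have := ℓ_P_lift c e
  rw [h0, map_zero] at this
  exact zero_ne_one this

lemma sliceParam_ne (c : AffineSliceChart N) (b₀ : BlowUp N) {e : E}
    (h : c.φ.symm (down c e) ∉ N.carrier) : sliceParam c b₀ e = away _ h := by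
  unfold sliceParam; rw [dif_neg h]

lemma sliceParam_eq (c : AffineSliceChart N) (b₀ : BlowUp N) {e : E}
    (he : down c e ∈ c.φ.target) (h : c.φ.symm (down c e) ∈ N.carrier) :
    sliceParam c b₀ e = exc _ h (Projectivization.mk ℝ _ (mk_ne_zero c he h)) := by
  unfold sliceParam; rw [dif_pos h, dif_pos]

lemma proj_sliceParam (c : AffineSliceChart N) (b₀ : BlowUp N) {e : E}
    (he : down c e ∈ c.φ.target) : (sliceParam c b₀ e).proj = c.φ.symm (down c e) := by
  by_cases h : c.φ.symm (down c e) ∈ N.carrier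
  · rw [sliceParam_eq c b₀ he h]; rfl
  · rw [sliceParam_ne c b₀ h]; rfl

/-- The coordinates of a representative of a normal direction. -/
lemma exists_rep (d : SliceChart N) {x : M} (hx : x ∈ N.carrier) (hd : x ∈ d.φ.source)
    {v : TangentSpace 𝓘(ℝ, E) x} (hv : (Submodule.Quotient.mk v : NormalSpace N x) ≠ 0) :
    ∃ a : ℝ, a ≠ 0 ∧ d.normalCoord x (Projectivization.mk ℝ _ hv).rep = a • d.dP x v := by
  obtain ⟨a, ha⟩ := Projectivization.exists_smul_eq_mk_rep ℝ _ hv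
  refine ⟨a, a.ne_zero, ?_⟩
  rw [← ha, ← d.dP_smul, ← d.normalCoord_mk hd hx]
  rfl

lemma exc_eq_exc (c : SliceChart N) {x y : M} (hx : x ∈ N.carrier) (hy : y ∈ N.carrier)
    (hxc : x ∈ c.φ.source) (hxy : x = y) (L : ℙ ℝ (NormalSpace N x))
    {w : TangentSpace 𝓘(ℝ, E) y} (hw : (Submodule.Quotient.mk w : NormalSpace N y) ≠ 0)
    {a : ℝ} (ha : a ≠ 0) (h : c.dP y w = a • c.normalCoord x L.rep) :
    exc x hx L = exc y hy (Projectivization.mk ℝ _ hw) := by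
  subst hxy
  congr 1
  have h1 : (Submodule.Quotient.mk w : NormalSpace N x) = a • L.rep := by
    have h2 : L.rep = Submodule.Quotient.mk L.rep.out := (Quotient.out_eq _).symm
    rw [h2, ← Submodule.Quotient.mk_smul]
    exact c.mk_eq_mk hxc hx (by rw [h, c.dP_smul]; rfl)
  conv_lhs => rw [← L.mk_rep]
  exact ((Projectivization.mk_eq_mk_iff ℝ _ _ _ _).2 ⟨Units.mk0 a ha, h1.symm⟩).symm

/-- The coordinate change between two affine slice charts. -/
lemma form_sliceParam (c d : AffineSliceChart N) (b₀ : BlowUp N) {e : E}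
    (he : down c e ∈ c.φ.target) (hd : c.φ.symm (down c e) ∈ d.φ.source) :
    form d (sliceParam c b₀ e) ≠ 0 ↔ d.ℓ (c.quot d.toSliceChart (lift c e) (c.ℓ e)) ≠ 0 := by
  by_cases h : c.φ.symm (down c e) ∈ N.carrier
  · have h0 := (mem_iff_ℓ c he).1 h
    rw [sliceParam_eq c b₀ he h]
    obtain ⟨a, ha, hrep⟩ := exists_rep d.toSliceChart h hd (mk_ne_zero c he h)
    have hv := c.dP_vec d.toSliceChart he hd (c.P (lift c e))
    have hq : c.quot d.toSliceChart (lift c e) (c.ℓ e) =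
        d.P (fderiv ℝ (c.trans d.toSliceChart) (down c e) (c.P (lift c e))) := by
      simp [SliceChart.quot, h0, down]
    simp only [form, hrep, hv, ← hq, map_smul, smul_eq_mul]
    simp [ha]
  · have h0 : c.ℓ e ≠ 0 := fun h' => h ((mem_iff_ℓ c he).2 h')
    rw [sliceParam_ne c b₀ h]
    simp only [form, SliceChart.quot, h0, if_false, SliceChart.trans, map_smul, smul_eq_mul, down,
      d.ℓ_P]
    simp [h0]

lemma sliceCoord_sliceParam (c d : AffineSliceChart N) (b₀ : BlowUp N) {e : E}
    (he : down c e ∈ c.φ.target) (hd : c.φ.symm (down c e) ∈ d.φ.source) :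
    sliceCoord d (sliceParam c b₀ e) =
      (d.ℓ (c.quot d.toSliceChart (lift c e) (c.ℓ e)))⁻¹ •
        c.quot d.toSliceChart (lift c e) (c.ℓ e) - d.w
      + (c.ℓ e * d.ℓ (c.quot d.toSliceChart (lift c e) (c.ℓ e))) • d.w
      + d.dil (c.trans d.toSliceChart (down c e)) 0 := by
  by_cases h : c.φ.symm (down c e) ∈ N.carrier
  · have h0 := (mem_iff_ℓ c he).1 h
    rw [sliceParam_eq c b₀ he h]
    obtain ⟨a, ha, hrep⟩ := exists_rep d.toSliceChart h hd (mk_ne_zero c he h)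
    have hv := c.dP_vec d.toSliceChart he hd (c.P (lift c e))
    have hP : d.P (c.trans d.toSliceChart (down c e)) = 0 := (d.mem_iff _ hd).1 h
    have hq : c.quot d.toSliceChart (lift c e) (c.ℓ e) =
        d.P (fderiv ℝ (c.trans d.toSliceChart) (down c e) (c.P (lift c e))) := by
      simp [SliceChart.quot, h0, down]
    simp only [sliceCoord, hrep, hv, ← hq, h0, zero_mul, zero_smul, add_zero, SliceChart.dil, hP,
      sub_zero, smul_zero, map_smul, smul_eq_mul, mul_inv, smul_smul]
    have : a⁻¹ * (d.ℓ (c.quot d.toSliceChart (lift c e) 0))⁻¹ * a =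
        (d.ℓ (c.quot d.toSliceChart (lift c e) 0))⁻¹ := by field_simp
    simp [this, SliceChart.trans]
  · have h0 : c.ℓ e ≠ 0 := fun h' => h ((mem_iff_ℓ c he).2 h')
    rw [sliceParam_ne c b₀ h]
    have hq : c.quot d.toSliceChart (lift c e) (c.ℓ e) =
        (c.ℓ e)⁻¹ • d.P (d.φ (c.φ.symm (down c e))) := by
      simp [SliceChart.quot, h0, down, SliceChart.trans]
    simp only [sliceCoord, hq, map_smul, smul_eq_mul, d.ℓ_P, SliceChart.dil, SliceChart.trans,
      zero_smul, add_zero, mul_inv, inv_inv, smul_smul]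
    have h1 : c.ℓ e * (d.ℓ (d.φ (c.φ.symm (down c e))))⁻¹ * (c.ℓ e)⁻¹ =
      (d.ℓ (d.φ (c.φ.symm (down c e))))⁻¹ := by field_simp
    have h2 : c.ℓ e * ((c.ℓ e)⁻¹ * d.ℓ (d.φ (c.φ.symm (down c e)))) =
      d.ℓ (d.φ (c.φ.symm (down c e))) := by field_simp
    rw [h1, h2]

lemma quot_self (c : AffineSliceChart N) {e : E} (he : down c e ∈ c.φ.target) :
    c.quot c.toSliceChart (lift c e) (c.ℓ e) = c.P (lift c e) := by
  have h1 : c.trans c.toSliceChart =ᶠ[𝓝 (down c e)] id := by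
    filter_upwards [c.φ.open_target.mem_nhds he] with y hy using c.φ.right_inv hy
  by_cases h : c.ℓ e = 0
  · rw [down, h] at h1
    simp [SliceChart.quot, h, h1.fderiv_eq, c.P_P]
  · have h2 : c.trans c.toSliceChart (c.dil (lift c e) (c.ℓ e)) = _ := h1.self_of_nhds
    simp only [SliceChart.quot, h, if_false, h2, id]
    simp [down, c.P_dil, smul_smul, h]

lemma lift_sliceCoord_away (c : AffineSliceChart N) {x : M} (hx : x ∉ N.carrier)
    (hℓ : c.ℓ (c.φ x) ≠ 0) : c.ℓ (sliceCoord c (away x hx)) = c.ℓ (c.φ x) ∧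
      down c (sliceCoord c (away x hx)) = c.φ x := by
  have h1 : c.ℓ (sliceCoord c (away x hx)) = c.ℓ (c.φ x) := by
    simp [sliceCoord, c.ℓ_P, c.ℓ_w, hℓ]
  refine ⟨h1, ?_⟩
  have h2 : lift c (sliceCoord c (away x hx)) =
      (c.ℓ (c.φ x))⁻¹ • c.P (c.φ x) + (c.φ x - c.P (c.φ x)) := by
    rw [lift, h1]; simp only [sliceCoord]; abel
  simp only [down, h1, h2, SliceChart.dil, map_add, map_smul, map_sub, c.P_P, sub_self, add_zero,
    smul_smul, mul_inv_cancel₀ hℓ, one_smul]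
  abel

lemma lift_sliceCoord_exc (c : AffineSliceChart N) {x : M} (hx : x ∈ N.carrier)
    (hxc : x ∈ c.φ.source) (L : ℙ ℝ (NormalSpace N x)) (hℓ : c.ℓ (c.normalCoord x L.rep) ≠ 0) :
    c.ℓ (sliceCoord c (exc x hx L)) = 0 ∧ down c (sliceCoord c (exc x hx L)) = c.φ x ∧
      c.P (lift c (sliceCoord c (exc x hx L))) =
        (c.ℓ (c.normalCoord x L.rep))⁻¹ • c.normalCoord x L.rep := by
  have h0 : c.P (c.φ x) = 0 := (c.mem_iff x hxc).1 hx
  have h0' : c.ℓ (c.φ x) = 0 := by rw [← c.ℓ_P, h0, map_zero]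
  have h1 : c.ℓ (sliceCoord c (exc x hx L)) = 0 := by
    simp [sliceCoord, c.ℓ_w, hℓ, h0']
  have h2 : c.P (lift c (sliceCoord c (exc x hx L))) =
      (c.ℓ (c.normalCoord x L.rep))⁻¹ • c.normalCoord x L.rep := by
    rw [P_lift, h1]
    simp [sliceCoord, c.P_w, h0, c.P_normalCoord]
  refine ⟨h1, ?_, h2⟩
  rw [down, h1, SliceChart.dil, h2, lift, h1]
  simp only [sliceCoord, zero_smul]
  abel

/-- The chart of the blow-up given by homogeneous coordinates `[v, y, s]` with `ℓ v ≠ 0`. -/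
def sliceChart (c : AffineSliceChart N) (b₀ : BlowUp N) : PartialEquiv (BlowUp N) E where
  toFun := sliceCoord c
  invFun := sliceParam c b₀
  source := {b | b.proj ∈ c.φ.source ∧ form c b ≠ 0}
  target := {e | down c e ∈ c.φ.target}
  map_source' := fun b hb => by
    rw [mem_ofPred_eq]
    cases b with
    | away x hx =>
      rw [(lift_sliceCoord_away c hx hb.2).2]
      exact c.φ.map_source hb.1
    | exc x hx L =>
      have hx' : x ∈ c.φ.source := hb.1
      rw [(lift_sliceCoord_exc c hx hx' L hb.2).2.1]
      exact c.φ.map_source hx'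
  map_target' := fun e he => by
    have he' : down c e ∈ c.φ.target := he
    refine ⟨?_, ?_⟩
    · rw [proj_sliceParam c b₀ he']; exact c.φ.map_target he'
    · rw [form_sliceParam c c b₀ he' (c.φ.map_target he'), quot_self c he', ℓ_P_lift]
      exact one_ne_zero
  left_inv' := fun b hb => by
    cases b with
    | away x hx =>
      have hx' : x ∈ c.φ.source := hb.1
      have h := (lift_sliceCoord_away c hx hb.2).2
      have h1 : c.φ.symm (down c (sliceCoord c (away x hx))) = x := by
        rw [h]; exact c.φ.left_inv hx'
      rw [sliceParam_ne c b₀ (by rw [h1]; exact hx)]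
      simp only [h1]
    | exc x hx L =>
      have hx' : x ∈ c.φ.source := hb.1
      obtain ⟨-, h, hP⟩ := lift_sliceCoord_exc c hx hx' L hb.2
      have h1 : c.φ.symm (down c (sliceCoord c (exc x hx L))) = x := by
        rw [h]; exact c.φ.left_inv hx'
      have h2 : down c (sliceCoord c (exc x hx L)) ∈ c.φ.target := by
        rw [h]; exact c.φ.map_source hx'
      rw [sliceParam_eq c b₀ h2 (by rw [h1]; exact hx)]
      refine (exc_eq_exc c.toSliceChart hx _ hx' h1.symm L _ (inv_ne_zero hb.2) ?_).symm
      rw [c.dP_vec_self h2, c.P_P, hP]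
      rfl
  right_inv' := fun e he => by
    have he' : down c e ∈ c.φ.target := he
    have h2 : c.trans c.toSliceChart (down c e) = down c e := c.φ.right_inv he'
    rw [sliceCoord_sliceParam c c b₀ he' (c.φ.map_target he'), quot_self c he', ℓ_P_lift, h2]
    have h3 : c.dil (down c e) 0 = c.dil (lift c e) 0 := by rw [down, c.dil_dil, zero_mul]
    rw [h3]
    simp only [SliceChart.dil, inv_one, one_smul, mul_one, zero_smul, add_zero, lift]
    abel

lemma continuous_lift (c : AffineSliceChart N) : Continuous fun e => (lift c e, c.ℓ e) := by
  unfold lift; fun_prop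

lemma continuous_down (c : AffineSliceChart N) : Continuous (down c) :=
  c.continuous_dil.comp (continuous_lift c)

lemma continuousAt_quot (c d : AffineSliceChart N) {e : E} (he : down c e ∈ overlap c.φ d.φ) :
    ContinuousAt (fun e => c.quot d.toSliceChart (lift c e) (c.ℓ e)) e :=
  ContinuousAt.comp (g := fun q : E × ℝ => c.quot d.toSliceChart q.1 q.2)
    (f := fun e => (lift c e, c.ℓ e))
    (c.continuousAt_quot d.toSliceChart (e := lift c e) (s := c.ℓ e) he.1 he.2)
    (continuous_lift c).continuousAt

lemma source_away_away (φ ψ : OpenPartialHomeomorph M E) (hφ : ∀ x ∈ φ.source, x ∉ N.carrier)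
    (hψ : ∀ x ∈ ψ.source, x ∉ N.carrier) (b₀ b₁ : BlowUp N) :
    ((awayChart φ hφ b₀).symm.trans (awayChart ψ hψ b₁)).source = overlap φ ψ := by
  ext e
  by_cases h : e ∈ φ.target
  · have h1 := hφ _ (φ.map_target h)
    simp [PartialEquiv.trans_source, awayChart, h, h1, proj, overlap]
  · simp [PartialEquiv.trans_source, awayChart, h, overlap]

lemma source_away_slice (φ : OpenPartialHomeomorph M E) (hφ : ∀ x ∈ φ.source, x ∉ N.carrier)
    (d : AffineSliceChart N) (b₀ b₁ : BlowUp N) :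
    ((awayChart φ hφ b₀).symm.trans (sliceChart d b₁)).source =
      {e | e ∈ overlap φ d.φ ∧ d.ℓ (d.φ (φ.symm e)) ≠ 0} := by
  ext e
  by_cases h : e ∈ φ.target
  · have h1 := hφ _ (φ.map_target h)
    simp [PartialEquiv.trans_source, awayChart, sliceChart, form, h, h1, proj, overlap]
  · simp [PartialEquiv.trans_source, awayChart, h, overlap]

lemma source_slice_away (c : AffineSliceChart N) (ψ : OpenPartialHomeomorph M E)
    (hψ : ∀ x ∈ ψ.source, x ∉ N.carrier) (b₀ b₁ : BlowUp N) :
    ((sliceChart c b₀).symm.trans (awayChart ψ hψ b₁)).source =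
      {e | down c e ∈ overlap c.φ ψ} := by
  ext e
  by_cases h : down c e ∈ c.φ.target
  · simp [PartialEquiv.trans_source, awayChart, sliceChart, h, proj_sliceParam c b₀ h, overlap]
  · simp [PartialEquiv.trans_source, sliceChart, h, overlap]

lemma source_slice_slice (c d : AffineSliceChart N) (b₀ b₁ : BlowUp N) :
    ((sliceChart c b₀).symm.trans (sliceChart d b₁)).source =
      {e | down c e ∈ overlap c.φ d.φ ∧
        d.ℓ (c.quot d.toSliceChart (lift c e) (c.ℓ e)) ≠ 0} := by
  ext e
  by_cases h : down c e ∈ c.φ.target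
  · by_cases h' : c.φ.symm (down c e) ∈ d.φ.source
    · have := form_sliceParam c d b₀ h h'
      simp only [ne_eq] at this
      simp [PartialEquiv.trans_source, sliceChart, h, h', proj_sliceParam c b₀ h, overlap, this]
    · simp [PartialEquiv.trans_source, sliceChart, h, h', proj_sliceParam c b₀ h, overlap]
  · simp [PartialEquiv.trans_source, sliceChart, h, overlap]

lemma exists_awayChart {x : M} (hx : x ∉ N.carrier) [IsManifold 𝓘(ℝ, E) ω M] :
    ∃ φ ∈ IsManifold.maximalAtlas 𝓘(ℝ, E) ω M, x ∈ φ.source ∧ ∀ y ∈ φ.source, y ∉ N.carrier := by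
  refine ⟨(chartAt E x).restr N.carrierᶜ, ?_, ?_, ?_⟩
  · exact restr_mem_maximalAtlas _
      (IsManifold.chart_mem_maximalAtlas x) N.isClosed.isOpen_compl
  · rw [OpenPartialHomeomorph.restr_source' _ _ N.isClosed.isOpen_compl]
    exact ⟨mem_chart_source E x, hx⟩
  · intro y hy
    rw [OpenPartialHomeomorph.restr_source' _ _ N.isClosed.isOpen_compl] at hy
    exact hy.2

lemma exists_affineSliceChart {x : M} (hx : x ∈ N.carrier) (L : ℙ ℝ (NormalSpace N x)) :
    ∃ c : AffineSliceChart N, x ∈ c.φ.source ∧ c.ℓ (c.normalCoord x L.rep) ≠ 0 := by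
  obtain ⟨φ, hφ, hxφ, P, hP, hm⟩ := N.exists_slice x hx
  let c : SliceChart N := ⟨φ, hφ, P, hP, hm⟩
  have hne : c.normalCoord x L.rep ≠ 0 := by
    intro h
    apply L.rep_nonzero
    have h2 : L.rep = Submodule.Quotient.mk L.rep.out := (Quotient.out_eq _).symm
    rw [h2, Submodule.Quotient.mk_eq_zero, c.mem_tangentSub_iff hxφ hx]
    exact h
  obtain ⟨l, hl⟩ := SeparatingDual.exists_eq_one (R := ℝ) hne
  refine ⟨{ c with
    ℓ := l.comp P
    w := c.normalCoord x L.rep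
    ℓ_P := fun e => by simp [c, hP]
    P_w := c.P_normalCoord x L.rep
    ℓ_w := ?_ }, hxφ, ?_⟩
  · have : P (c.normalCoord x L.rep) = c.normalCoord x L.rep := c.P_normalCoord x L.rep
    simp [this, hl]
  · have : P (c.normalCoord x L.rep) = c.normalCoord x L.rep := c.P_normalCoord x L.rep
    change l (P (c.normalCoord x L.rep)) ≠ 0
    rw [this, hl]; exact one_ne_zero

/-- The atlas of the blow-up: all charts of `M ∖ N` and all charts given by homogeneous
coordinates. -/
def chartCore (N : ClosedSubmanifold E M) [IsManifold 𝓘(ℝ, E) ω M] :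
    ChartedSpaceCore E (BlowUp N) where
  atlas := {e | (∃ (φ : OpenPartialHomeomorph M E) (hφ : ∀ x ∈ φ.source, x ∉ N.carrier)
      (b₀ : BlowUp N), φ ∈ IsManifold.maximalAtlas 𝓘(ℝ, E) ω M ∧ e = awayChart φ hφ b₀) ∨
    ∃ (c : AffineSliceChart N) (b₀ : BlowUp N), e = sliceChart c b₀}
  chartAt
    | away x hx => awayChart (exists_awayChart hx).choose (exists_awayChart hx).choose_spec.2.2
        (away x hx)
    | exc x hx L => sliceChart (exists_affineSliceChart hx L).choose (exc x hx L)
  mem_chart_source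
    | away x hx => (exists_awayChart hx).choose_spec.2.1
    | exc x hx L => (exists_affineSliceChart hx L).choose_spec
  chart_mem_atlas
    | away x hx => Or.inl ⟨_, _, _, (exists_awayChart hx).choose_spec.1, rfl⟩
    | exc x hx L => Or.inr ⟨_, _, rfl⟩
  open_source := by
    rintro e e' (⟨φ, hφ, b₀, -, rfl⟩ | ⟨c, b₀, rfl⟩) (⟨ψ, hψ, b₁, -, rfl⟩ | ⟨d, b₁, rfl⟩)
    · rw [source_away_away]; exact isOpen_overlap φ ψ
    · rw [source_away_slice]
      exact (d.ℓ.continuous.comp_continuousOn (continuousOn_overlap φ d.φ)).isOpen_inter_preimage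
        (isOpen_overlap φ d.φ) isOpen_ne
    · rw [source_slice_away]; exact (isOpen_overlap c.φ ψ).preimage (continuous_down c)
    · rw [source_slice_slice]
      refine ContinuousOn.isOpen_inter_preimage
        (f := fun e => d.ℓ (c.quot d.toSliceChart (lift c e) (c.ℓ e))) ?_
        ((isOpen_overlap c.φ d.φ).preimage (continuous_down c)) isOpen_ne
      intro e he
      exact (d.ℓ.continuous.continuousAt.comp (continuousAt_quot c d he)).continuousWithinAt
  continuousOn_toFun := by
    rintro e e' (⟨φ, hφ, b₀, -, rfl⟩ | ⟨c, b₀, rfl⟩) (⟨ψ, hψ, b₁, -, rfl⟩ | ⟨d, b₁, rfl⟩)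
    · rw [source_away_away]
      refine (continuousOn_overlap φ ψ).congr fun e he => ?_
      have h1 := hφ _ (φ.map_target he.1)
      simp [awayChart, h1, proj]
    · rw [source_away_slice]
      have h0 : ContinuousOn (fun e => d.φ (φ.symm e))
          {e | e ∈ overlap φ d.φ ∧ d.ℓ (d.φ (φ.symm e)) ≠ 0} :=
        (continuousOn_overlap φ d.φ).mono fun e he => he.1
      have hl := d.ℓ.continuous.comp_continuousOn h0
      have hp := d.P.continuous.comp_continuousOn h0
      refine ((((hl.inv₀ fun e he => he.2).smul hp).sub (continuousOn_const (c := d.w))).add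
        (hl.smul (continuousOn_const (c := d.w))) |>.add (h0.sub hp)).congr fun e he => ?_
      have h1 := hφ _ (φ.map_target he.1.1)
      simp [awayChart, h1, sliceChart, sliceCoord]
    · rw [source_slice_away]
      refine ((continuousOn_overlap c.φ ψ).comp (continuous_down c).continuousOn
        fun e he => he).congr fun e he => ?_
      have h1 := proj_sliceParam c b₀ he.1
      simp [awayChart, sliceChart, h1]
    · rw [source_slice_slice]
      refine ContinuousOn.congr (f := fun e =>
        (d.ℓ (c.quot d.toSliceChart (lift c e) (c.ℓ e)))⁻¹ •
          c.quot d.toSliceChart (lift c e) (c.ℓ e) - d.w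
        + (c.ℓ e * d.ℓ (c.quot d.toSliceChart (lift c e) (c.ℓ e))) • d.w
        + d.dil (c.trans d.toSliceChart (down c e)) 0) ?_ ?_
      · intro e he
        have hq := continuousAt_quot c d he.1
        have hl : ContinuousAt (fun e => d.ℓ (c.quot d.toSliceChart (lift c e) (c.ℓ e))) e :=
          d.ℓ.continuous.continuousAt.comp hq
        have h1 : ContinuousAt (fun e => c.trans d.toSliceChart (down c e)) e :=
          ContinuousAt.comp (g := c.trans d.toSliceChart) (f := down c)
            (c.contDiffAt_trans d.toSliceChart he.1.1 he.1.2).continuousAt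
            (continuous_down c).continuousAt
        have h2 : ContinuousAt (fun e => d.dil (c.trans d.toSliceChart (down c e)) 0) e :=
          ContinuousAt.comp (g := fun r : E × ℝ => d.dil r.1 r.2)
            (f := fun e => (c.trans d.toSliceChart (down c e), (0 : ℝ)))
            d.continuous_dil.continuousAt (h1.prodMk continuousAt_const)
        exact (((((hl.inv₀ he.2).smul hq).sub continuousAt_const).add
          ((c.ℓ.continuous.continuousAt.mul hl).smul continuousAt_const)).add
          h2).continuousWithinAt
      · intro e he
        exact sliceCoord_sliceParam c d b₀ he.1.1 he.1.2

instance [IsManifold 𝓘(ℝ, E) ω M] : TopologicalSpace (BlowUp N) :=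
  (chartCore N).toTopologicalSpace

/-- The real analytic atlas of the real projective blow-up. -/
instance [IsManifold 𝓘(ℝ, E) ω M] : ChartedSpace E (BlowUp N) :=
  (chartCore N).toChartedSpace

end BlowUp

end Submanifold

section RealProjectiveLine

open OnePoint

/-- Inversion `t ↦ 1 / t` of the real projective line `ℝ ∪ {∞}`. -/
def rpInv : OnePoint ℝ → OnePoint ℝ
  | infty => ((0 : ℝ) : OnePoint ℝ)
  | (t : ℝ) => if t = 0 then infty else ((t⁻¹ : ℝ) : OnePoint ℝ)

lemma rpInv_infty : rpInv infty = ((0 : ℝ) : OnePoint ℝ) := rfl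

lemma rpInv_coe {t : ℝ} (ht : t ≠ 0) : rpInv (t : OnePoint ℝ) = ((t⁻¹ : ℝ) : OnePoint ℝ) :=
  if_neg ht

lemma rpInv_zero : rpInv ((0 : ℝ) : OnePoint ℝ) = infty := if_pos rfl

lemma rpInv_rpInv (z : OnePoint ℝ) : rpInv (rpInv z) = z := by
  induction z using OnePoint.rec with
  | infty => rw [rpInv_infty, rpInv_zero]
  | coe t =>
    by_cases ht : t = 0
    · subst ht; rw [rpInv_zero, rpInv_infty]
    · rw [rpInv_coe ht, rpInv_coe (inv_ne_zero ht), inv_inv]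

lemma continuous_rpInv : Continuous rpInv := by
  rw [continuous_iff_continuousAt]
  intro z
  induction z using OnePoint.rec with
  | infty =>
    rw [continuousAt_infty', coclosedCompact_eq_cocompact, ← Metric.cobounded_eq_cocompact,
      rpInv_infty]
    have h1 : Tendsto (fun t : ℝ => ((t⁻¹ : ℝ) : OnePoint ℝ)) (Bornology.cobounded ℝ)
        (𝓝 ((0 : ℝ) : OnePoint ℝ)) :=
      (continuous_coe.tendsto (0 : ℝ)).comp tendsto_inv₀_cobounded
    refine h1.congr' ?_
    filter_upwards [Bornology.eventually_ne_cobounded (0 : ℝ)] with t ht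
    exact (rpInv_coe ht).symm
  | coe t =>
    rw [continuousAt_coe]
    by_cases ht : t = 0
    · subst ht
      rw [continuousAt_iff_punctured_nhds]
      have h0 : (rpInv ∘ ((↑) : ℝ → OnePoint ℝ)) 0 = infty := rpInv_zero
      rw [h0]
      have h1 : Tendsto (fun t : ℝ => ((t⁻¹ : ℝ) : OnePoint ℝ)) (𝓝[≠] 0) (𝓝 infty) := by
        refine tendsto_coe_infty.comp ?_
        rw [coclosedCompact_eq_cocompact, ← Metric.cobounded_eq_cocompact]
        exact tendsto_inv₀_nhdsNE_zero
      refine h1.congr' ?_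
      filter_upwards [self_mem_nhdsWithin] with t ht
      exact (rpInv_coe ht).symm
    · have h1 : ContinuousAt (fun t : ℝ => ((t⁻¹ : ℝ) : OnePoint ℝ)) t :=
        continuous_coe.continuousAt.comp (continuousAt_inv₀ ht)
      refine h1.congr ?_
      filter_upwards [isOpen_ne.mem_nhds ht] with u hu
      exact (rpInv_coe hu).symm

/-- Inversion as a homeomorphism. -/
def rpInvHomeo : OnePoint ℝ ≃ₜ OnePoint ℝ where
  toFun := rpInv
  invFun := rpInv
  left_inv := rpInv_rpInv
  right_inv := rpInv_rpInv
  continuous_toFun := continuous_rpInv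
  continuous_invFun := continuous_rpInv

/-- The affine chart `ℝ ⊂ ℝ ∪ {∞}`. -/
def rpAffine : OpenPartialHomeomorph (OnePoint ℝ) ℝ :=
  (isOpenEmbedding_coe.toOpenPartialHomeomorph ((↑) : ℝ → OnePoint ℝ)).symm

/-- The chart `t ↦ 1 / t` at infinity. -/
def rpInfty : OpenPartialHomeomorph (OnePoint ℝ) ℝ :=
  rpInvHomeo.toOpenPartialHomeomorph.trans rpAffine

lemma rpAffine_coe (t : ℝ) : rpAffine (t : OnePoint ℝ) = t :=
  (isOpenEmbedding_coe.toOpenPartialHomeomorph ((↑) : ℝ → OnePoint ℝ)).left_inv (mem_univ t)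

lemma rpAffine_symm (t : ℝ) : rpAffine.symm t = (t : OnePoint ℝ) := rfl

lemma rpInfty_apply (z : OnePoint ℝ) : rpInfty z = rpAffine (rpInv z) := rfl

lemma rpInfty_symm (t : ℝ) : rpInfty.symm t = rpInv (t : OnePoint ℝ) := rfl

lemma coe_mem_rpAffine (t : ℝ) : (t : OnePoint ℝ) ∈ rpAffine.source := by
  simp [rpAffine]

lemma mem_rpAffine_iff (z : OnePoint ℝ) : z ∈ rpAffine.source ↔ z ≠ infty := by
  simp [rpAffine, OnePoint.ne_infty_iff_exists]

lemma mem_rpInfty_iff (z : OnePoint ℝ) : z ∈ rpInfty.source ↔ rpInv z ≠ infty := by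
  rw [← mem_rpAffine_iff]
  simp [rpInfty, rpInvHomeo]

/-- The real analytic structure of the real projective line. -/
instance : ChartedSpace ℝ (OnePoint ℝ) where
  atlas := {rpAffine, rpInfty}
  chartAt z := open Classical in if z = infty then rpInfty else rpAffine
  mem_chart_source z := by
    by_cases h : z = infty
    · rw [if_pos h, mem_rpInfty_iff, h, rpInv_infty]; exact coe_ne_infty _
    · rw [if_neg h, mem_rpAffine_iff]; exact h
  chart_mem_atlas z := by
    by_cases h : z = infty
    · rw [if_pos h]; exact Or.inr rfl
    · rw [if_neg h]; exact Or.inl rfl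

lemma contDiffOn_rp_self (e : OpenPartialHomeomorph (OnePoint ℝ) ℝ) :
    ContDiffOn ℝ ω (fun t => e (e.symm t)) (e.symm.trans e).source :=
  contDiffOn_id.congr fun _ ht => e.right_inv ht.1

instance : IsManifold 𝓘(ℝ, ℝ) ω (OnePoint ℝ) := by
  refine isManifold_of_contDiffOn _ _ _ fun e e' he he' => ?_
  simp only [modelWithCornersSelf_coe, modelWithCornersSelf_coe_symm, range_id, inter_univ,
    preimage_id, Function.comp_id, Function.id_comp]
  have hinv : ContDiffOn ℝ ω (fun t : ℝ => t⁻¹) {t | t ≠ 0} := contDiffOn_inv ℝ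
  rcases he with rfl | he <;> rcases he' with rfl | he'
  · exact contDiffOn_rp_self _
  · rw [mem_singleton_iff] at he'; subst he'
    have hne : ∀ t ∈ (rpAffine.symm.trans rpInfty).source, t ≠ 0 := by
      rintro t ht rfl
      have h2 : (((0 : ℝ) : OnePoint ℝ)) ∈ rpInfty.source := ht.2
      rw [mem_rpInfty_iff, rpInv_zero] at h2
      exact h2 rfl
    refine (hinv.mono hne).congr fun t ht => ?_
    change rpAffine (rpInv (t : OnePoint ℝ)) = _
    rw [rpInv_coe (hne t ht), rpAffine_coe]
  · rw [mem_singleton_iff] at he; subst he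
    have hne : ∀ t ∈ (rpInfty.symm.trans rpAffine).source, t ≠ 0 := by
      rintro t ht rfl
      have h2 : rpInv (((0 : ℝ) : OnePoint ℝ)) ∈ rpAffine.source := ht.2
      rw [mem_rpAffine_iff, rpInv_zero] at h2
      exact h2 rfl
    refine (hinv.mono hne).congr fun t ht => ?_
    change rpAffine (rpInv (t : OnePoint ℝ)) = _
    rw [rpInv_coe (hne t ht), rpAffine_coe]
  · rw [mem_singleton_iff] at he he'; subst he; subst he'
    exact contDiffOn_rp_self _

end RealProjectiveLine

section Deformation

variable {E : Type*} [NormedAddCommGroup E] [NormedSpace ℝ E]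
  {M : Type*} [TopologicalSpace M] [ChartedSpace E M]

/-- The product manifold structure of `X = M × ℝP`, modelled on `E × ℝ`. -/
instance : ChartedSpace (E × ℝ) (M × OnePoint ℝ) :=
  inferInstanceAs (ChartedSpace (ModelProd E ℝ) (M × OnePoint ℝ))

variable [IsManifold 𝓘(ℝ, E) ω M]

instance : IsManifold 𝓘(ℝ, E × ℝ) ω (M × OnePoint ℝ) := by
  have h : IsManifold (𝓘(ℝ, E).prod 𝓘(ℝ, ℝ)) ω (M × OnePoint ℝ) := inferInstance
  rw [modelWithCornersSelf_prod]
  exact h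

/-- The closed submanifold `Y = N × {0}` of `X = M × ℝP`. -/
def center (N : ClosedSubmanifold E M) : ClosedSubmanifold (E × ℝ) (M × OnePoint ℝ) where
  carrier := N.carrier ×ˢ {((0 : ℝ) : OnePoint ℝ)}
  isClosed := N.isClosed.prod isClosed_singleton
  exists_slice := by
    rintro ⟨x, z⟩ ⟨hx, hz⟩
    obtain ⟨φ, hφ, hxφ, P, hP, hm⟩ := N.exists_slice x hx
    have hz' : z = ((0 : ℝ) : OnePoint ℝ) := hz
    subst hz'
    have haff : rpAffine ∈ IsManifold.maximalAtlas 𝓘(ℝ, ℝ) ω (OnePoint ℝ) :=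
      IsManifold.subset_maximalAtlas (Or.inl rfl)
    refine ⟨φ.prod rpAffine, ?_, ⟨hxφ, coe_mem_rpAffine 0⟩,
      P.prodMap (ContinuousLinearMap.id ℝ ℝ), ?_, ?_⟩
    · have h := IsManifold.mem_maximalAtlas_prod hφ haff
      rw [modelWithCornersSelf_prod]
      exact h
    · rintro ⟨e, t⟩; simp [hP]
    · rintro ⟨y, z⟩ ⟨hy, hz⟩
      have hz2 : z ≠ OnePoint.infty := (mem_rpAffine_iff z).1 hz
      obtain ⟨t, rfl⟩ := OnePoint.ne_infty_iff_exists.1 hz2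
      have := hm y hy
      simp [this, rpAffine_coe, Prod.ext_iff]

/-- The tangent vector `(ξ, 1)` of `M × ℝP` at `(x, 0)`: the sum of the images of `ξ ∈ T_xM` and
of `d/dt ∈ T_0ℝ` under the inclusions `y ↦ (y, 0)` and `t ↦ (x, t)`. -/
def liftVec (x : M) (ξ : TangentSpace 𝓘(ℝ, E) x) :
    TangentSpace 𝓘(ℝ, E × ℝ) (x, ((0 : ℝ) : OnePoint ℝ)) :=
  (mfderiv 𝓘(ℝ, E) 𝓘(ℝ, E × ℝ) (fun y : M => (y, ((0 : ℝ) : OnePoint ℝ))) x ξ : E × ℝ) +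
  (mfderiv 𝓘(ℝ, ℝ) 𝓘(ℝ, E × ℝ) (fun t : ℝ => (x, (t : OnePoint ℝ))) 0 (1 : ℝ) : E × ℝ)

lemma contMDiff_coe : ContMDiff 𝓘(ℝ, ℝ) 𝓘(ℝ, ℝ) ω (fun t : ℝ => (t : OnePoint ℝ)) := by
  have haff : rpAffine ∈ IsManifold.maximalAtlas 𝓘(ℝ, ℝ) ω (OnePoint ℝ) :=
    IsManifold.subset_maximalAtlas (Or.inl rfl)
  intro t
  have ht := rpAffine.map_source (coe_mem_rpAffine t)
  rw [rpAffine_coe] at ht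
  exact contMDiffAt_symm_of_mem_maximalAtlas haff ht

lemma contMDiff_incl_left (z : OnePoint ℝ) :
    ContMDiff 𝓘(ℝ, E) 𝓘(ℝ, E × ℝ) ω (fun y : M => (y, z)) := by
  have h : ContMDiff 𝓘(ℝ, E) (𝓘(ℝ, E).prod 𝓘(ℝ, ℝ)) ω (fun y : M => (y, z)) :=
    contMDiff_id.prodMk contMDiff_const
  rw [modelWithCornersSelf_prod]
  exact h

lemma contMDiff_incl_right (x : M) :
    ContMDiff 𝓘(ℝ, ℝ) 𝓘(ℝ, E × ℝ) ω (fun t : ℝ => (x, (t : OnePoint ℝ))) := by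
  have h : ContMDiff 𝓘(ℝ, ℝ) (𝓘(ℝ, E).prod 𝓘(ℝ, ℝ)) ω (fun t : ℝ => (x, (t : OnePoint ℝ))) :=
    contMDiff_const.prodMk contMDiff_coe
  rw [modelWithCornersSelf_prod]
  exact h

lemma contMDiffAt_param (x : M) : ContMDiffAt 𝓘(ℝ, E × ℝ) 𝓘(ℝ, ℝ) ω
    (fun q : M × OnePoint ℝ => rpAffine q.2) (x, ((0 : ℝ) : OnePoint ℝ)) := by
  have haff : rpAffine ∈ IsManifold.maximalAtlas 𝓘(ℝ, ℝ) ω (OnePoint ℝ) :=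
    IsManifold.subset_maximalAtlas (Or.inl rfl)
  have h : ContMDiffAt (𝓘(ℝ, E).prod 𝓘(ℝ, ℝ)) 𝓘(ℝ, ℝ) ω
      (fun q : M × OnePoint ℝ => rpAffine q.2) (x, ((0 : ℝ) : OnePoint ℝ)) :=
    ContMDiffAt.comp (x, ((0 : ℝ) : OnePoint ℝ))
      (contMDiffAt_of_mem_maximalAtlas haff (coe_mem_rpAffine 0)) contMDiffAt_snd
  rw [modelWithCornersSelf_prod]
  exact h

lemma mk_liftVec_ne_zero (N : ClosedSubmanifold E M) (x : M) (ξ : TangentSpace 𝓘(ℝ, E) x) :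
    (Submodule.Quotient.mk (liftVec x ξ) :
      NormalSpace (center N) (x, ((0 : ℝ) : OnePoint ℝ))) ≠ 0 := by
  intro h0
  rw [Submodule.Quotient.mk_eq_zero] at h0
  have h1 := h0 _ (contMDiffAt_param x) (Eventually.of_forall fun q hq => by
    have hq2 : q.2 = ((0 : ℝ) : OnePoint ℝ) := hq.2
    rw [hq2, rpAffine_coe])
  set f : M × OnePoint ℝ → ℝ := fun q => rpAffine q.2 with hf
  have hfd : MDifferentiableAt 𝓘(ℝ, E × ℝ) 𝓘(ℝ, ℝ) f (x, ((0 : ℝ) : OnePoint ℝ)) :=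
    (contMDiffAt_param x).mdifferentiableAt (by simp)
  let L : E × ℝ →L[ℝ] ℝ := mfderiv 𝓘(ℝ, E × ℝ) 𝓘(ℝ, ℝ) f (x, ((0 : ℝ) : OnePoint ℝ))
  let A : E →L[ℝ] E × ℝ :=
    mfderiv 𝓘(ℝ, E) 𝓘(ℝ, E × ℝ) (fun y : M => (y, ((0 : ℝ) : OnePoint ℝ))) x
  let B : ℝ →L[ℝ] E × ℝ := mfderiv 𝓘(ℝ, ℝ) 𝓘(ℝ, E × ℝ) (fun t : ℝ => (x, (t : OnePoint ℝ))) 0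
  have hA : L.comp A = 0 := by
    have h := mfderiv_comp (I' := 𝓘(ℝ, E × ℝ)) x (g := f)
      (f := fun y : M => (y, ((0 : ℝ) : OnePoint ℝ))) hfd
      ((contMDiff_incl_left _).contMDiffAt.mdifferentiableAt (by simp))
    have h2 : f ∘ (fun y : M => (y, ((0 : ℝ) : OnePoint ℝ))) = fun _ => 0 := by
      funext y; simp [hf, rpAffine_coe]
    have h3 : mfderiv 𝓘(ℝ, E) 𝓘(ℝ, ℝ) (f ∘ (fun y : M => (y, ((0 : ℝ) : OnePoint ℝ)))) x
        = (0 : E →L[ℝ] ℝ) := by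
      rw [h2]; exact mfderiv_const
    exact h.symm.trans h3
  have hB : L.comp B = ContinuousLinearMap.id ℝ ℝ := by
    have h := mfderiv_comp (I' := 𝓘(ℝ, E × ℝ)) (0 : ℝ) (g := f)
      (f := fun t : ℝ => (x, (t : OnePoint ℝ))) hfd
      ((contMDiff_incl_right x).contMDiffAt.mdifferentiableAt (by simp))
    have h2 : f ∘ (fun t : ℝ => (x, (t : OnePoint ℝ))) = id := by
      funext t; simp [hf, rpAffine_coe]
    have h3 : mfderiv 𝓘(ℝ, ℝ) 𝓘(ℝ, ℝ) (f ∘ (fun t : ℝ => (x, (t : OnePoint ℝ)))) 0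
        = ContinuousLinearMap.id ℝ ℝ := by
      rw [h2]; exact mfderiv_id
    exact h.symm.trans h3
  have h2 : L (A ξ + B 1) = 0 := h1
  have hA' : L (A ξ) = 0 := DFunLike.congr_fun hA ξ
  have hB' : L (B 1) = 1 := DFunLike.congr_fun hB 1
  rw [map_add, hA', hB', zero_add] at h2
  exact one_ne_zero h2

/-- The embedding of the normal deformation in the blow-up of `M × ℝP` along `N × {0}`: it is
`(x, t) ↦ (x, t)` on `M × ℝ_{≠0}` and sends a normal vector `ξ ∈ T_xM / T_xN` to the normal
direction `[ξ, 1]`. -/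
def embed (N : ClosedSubmanifold E M) : NormalDeformation N → BlowUp (center N)
  | .away x t ht => .away (x, (t : OnePoint ℝ)) fun h => ht (OnePoint.coe_injective h.2)
  | .normal x hx ξ => .exc (x, ((0 : ℝ) : OnePoint ℝ)) ⟨hx, rfl⟩
      (Projectivization.mk ℝ _ (mk_liftVec_ne_zero N x ξ.out))

end Deformation

section Subanalytic

variable {F : Type*} [NormedAddCommGroup F] [NormedSpace ℝ F] {H : Type*} [TopologicalSpace H]
  (I : ModelWithCorners ℝ F H) {X : Type*} [TopologicalSpace X] [ChartedSpace H X]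

/-- Semianalytic subsets of a real analytic manifold: near each point of the manifold, finite
unions of sets given by one analytic equation `f = 0` and finitely many analytic strict
inequalities `g > 0`. -/
def IsSemianalytic (A : Set X) : Prop :=
  ∀ x : X, ∃ U : Set X, IsOpen U ∧ x ∈ U ∧
    ∃ (m n : ℕ) (f : Fin m → X → ℝ) (g : Fin m → Fin n → X → ℝ),
      (∀ i, ContMDiffOn I 𝓘(ℝ, ℝ) ω (f i) U) ∧ (∀ i j, ContMDiffOn I 𝓘(ℝ, ℝ) ω (g i j) U) ∧
      ∀ y ∈ U, y ∈ A ↔ ∃ i, f i y = 0 ∧ ∀ j, 0 < g i j y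

/-- Subanalytic subsets of a real analytic manifold `X`: near each point of `X`, projections of
relatively compact semianalytic subsets of some `X × ℝᵏ`. -/
def IsSubanalytic (Z : Set X) : Prop :=
  ∀ x : X, ∃ U : Set X, IsOpen U ∧ x ∈ U ∧
    ∃ (k : ℕ) (A : Set (X × EuclideanSpace ℝ (Fin k))),
      IsSemianalytic (I.prod 𝓘(ℝ, EuclideanSpace ℝ (Fin k))) A ∧
      IsCompact (closure A) ∧ Z ∩ U = Prod.fst '' A

end Subanalytic

section Bordered

variable {U C V D : Type*} [TopologicalSpace U] [TopologicalSpace C] [TopologicalSpace V]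
  [TopologicalSpace D]

/-- A bordered space `(U, C)`, where `U` is identified with an open subset of `C` by the open
embedding `i`. (Finite soft dimension of `C` is not required: it is automatic when `C` is a finite
dimensional manifold, and a universal property among all these pairs is stronger than among those
of finite soft dimension.) -/
structure IsBorderedSpace (i : U → C) : Prop where
  t2 : T2Space C
  locallyCompact : LocallyCompactSpace C
  sigmaCompact : SigmaCompactSpace C
  isOpenEmbedding : IsOpenEmbedding i

/-- The closure in `C × D` of the graph of `f : U → V`, for bordered spaces `(U, C)`, `(V, D)`. -/
def graphClosure (i : U → C) (k : V → D) (f : U → V) : Set (C × D) :=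
  closure (range fun u => (i u, k (f u)))

/-- `f` is a morphism of bordered spaces `(U, C) → (V, D)`: it is continuous and the closure of
its graph is proper over `C`. -/
structure IsBorderedMorphism (i : U → C) (k : V → D) (f : U → V) : Prop where
  continuous : Continuous f
  isProperMap : IsProperMap fun z : graphClosure i k f => z.1.1

/-- The morphism `f : (U, C) → (V, D)` is semiproper: the closure of its graph is proper
over `D`. -/
def IsSemiproper (i : U → C) (k : V → D) (f : U → V) : Prop :=
  IsProperMap fun z : graphClosure i k f => z.1.2

/-- `(U, C)` is a bordered compactification of `U` over `S = (S, S)`: the map `p : U → S` is a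
semiproper morphism of bordered spaces `(U, C) → (S, S)`. -/
structure IsBorderedCompactification (i : U → C) (p : U → V) : Prop where
  isBorderedSpace : IsBorderedSpace i
  isBorderedMorphism : IsBorderedMorphism i (id : V → V) p
  isSemiproper : IsSemiproper i (id : V → V) p

/-- `(U, C)` is a real analytic bordered space: a bordered space such that `C` is a real analytic
manifold (modelled on `F`) and `U` is a subanalytic open subset of `C`, with the induced analytic
structure. -/
structure IsRealAnalyticBorderedSpace (F : Type*) [NormedAddCommGroup F] [NormedSpace ℝ F]
    [ChartedSpace F U] [ChartedSpace F C] (i : U → C) : Prop where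
  isBorderedSpace : IsBorderedSpace i
  isManifold : IsManifold 𝓘(ℝ, F) ω C
  isLocalDiffeomorph : IsLocalDiffeomorph 𝓘(ℝ, F) 𝓘(ℝ, F) ω i
  isSubanalytic : IsSubanalytic 𝓘(ℝ, F) (range i)

/-- `f` is a morphism of real analytic bordered spaces `(U, C) → (V, D)`: a morphism of bordered
spaces which is a real analytic map and whose graph has a subanalytic closure in `C × D`. -/
structure IsRealAnalyticBorderedMorphism (F G : Type*) [NormedAddCommGroup F] [NormedSpace ℝ F]
    [NormedAddCommGroup G] [NormedSpace ℝ G] [ChartedSpace F U] [ChartedSpace F C]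
    [ChartedSpace G V] [ChartedSpace G D] (i : U → C) (k : V → D) (f : U → V) : Prop where
  isBorderedMorphism : IsBorderedMorphism i k f
  contMDiff : ContMDiff 𝓘(ℝ, F) 𝓘(ℝ, G) ω f
  isSubanalytic : IsSubanalytic (𝓘(ℝ, F).prod 𝓘(ℝ, G)) (graphClosure i k f)

end Bordered

end BorderedND

end

/-!
The coordinate changes of the normal deformation and of the blow-up are analytic because the
transversal part of a coordinate change vanishes for `s = 0` and an analytic function of `(x, s)`
that vanishes for `s = 0` is `s` times an analytic function. The latter holds for power series by
telescoping in each homogeneous component (`AnalyticAt.exists_eq_smul_of_eq_zero`,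
`SliceChart.contDiffAt_quot`).

A slice chart of `N` in `M` gives a slice chart of `N × {0}` in `M × ℝP` with the linear form `t`
in the transversal coordinates. In the coordinates of the normal deformation and of the affine
chart `t ≠ 0` of the blow-up the embedding is the identity (`sliceCoord_embed`). Hence it is an
open analytic embedding, and its image is locally given by one condition `f ≠ 0` with `f` analytic,
so it is semianalytic (`isSemianalytic_range_embed`) and dense (`denseRange_embed`).

The blow-up is proper over its base because the transversal directions form a compact space
(`BlowUp.isProperMap_proj`), and `ℝP` is compact. So `p` extends to a proper analytic map from the
blow-up to `M`, and the closure of the graph of `p` is the graph of this extension. This makes `p` a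
semiproper morphism. For any other bordered compactification `C` over `M`, the closure of the
graph of the identity in the product of `C` with the blow-up lies over the closure of the graph of
`p` in `C × M`; properness of the latter over `C` and over `M`, together with properness of the
blow-up over `M`, gives the two morphisms (`isBorderedMorphism_id_of_isProperMap`,
`isBorderedMorphism_id_of_isSemiproper`).
-/

noncomputable section

namespace BorderedND

open Set Filter Topology
open scoped LinearAlgebra.Projectivization

/-! ### Division of analytic functions by a coordinate -/

section Division

variable {E : Type*} [NormedAddCommGroup E] [NormedSpace ℝ E]
  {G : Type*} [NormedAddCommGroup G] [NormedSpace ℝ G]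

/-- The projection `(h, s) ↦ (h, 0)`. -/
def proj₀ (E : Type*) [NormedAddCommGroup E] [NormedSpace ℝ E] : E × ℝ →L[ℝ] E × ℝ :=
  (ContinuousLinearMap.inl ℝ E ℝ).comp (ContinuousLinearMap.fst ℝ E ℝ)

lemma proj₀_apply (z : E × ℝ) : proj₀ E z = (z.1, 0) := rfl

lemma norm_proj₀_le (z : E × ℝ) : ‖proj₀ E z‖ ≤ ‖z‖ := by
  simp [proj₀_apply, Prod.norm_def]

/-- The multilinear map with `s • divTerm m (z, …, z) = m (z, …, z) - m (πz, …, πz)` for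
`z = (h, s)` and `πz = (h, 0)`: the `k`-th summand of the telescoping sum has `πz` in the first `k`
places and `(0, 1)` in the `k`-th. -/
def divTerm {n : ℕ} (m : ContinuousMultilinearMap ℝ (fun _ : Fin (n + 1) => E × ℝ) G) :
    ContinuousMultilinearMap ℝ (fun _ : Fin n => E × ℝ) G :=
  ∑ k : Fin (n + 1), (m.curryMid k ((0, 1) : E × ℝ)).compContinuousLinearMap
    fun j => if k.succAbove j < k then proj₀ E else ContinuousLinearMap.id ℝ (E × ℝ)

lemma smul_divTerm {n : ℕ} (m : ContinuousMultilinearMap ℝ (fun _ : Fin (n + 1) => E × ℝ) G)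
    (z : E × ℝ) :
    z.2 • divTerm m (fun _ => z) = m (fun _ => z) - m (fun _ => proj₀ E z) := by
  classical
  have h := m.toMultilinearMap.map_piecewise_sub_map_piecewise
    (fun _ => proj₀ E z) (fun _ => z) (fun _ => z) Finset.univ
  simp only [Finset.piecewise_univ, Finset.mem_univ, if_true] at h
  have h' : m (fun _ => z) - m (fun _ => proj₀ E z) =
      -∑ k : Fin (n + 1), m (fun j => if j < k then proj₀ E z else
        if j = k then proj₀ E z - z else z) := by
    rw [← neg_sub]; exact congrArg Neg.neg h
  rw [h', divTerm, _root_.sum_apply, Finset.smul_sum, ← Finset.sum_neg_distrib]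
  refine Finset.sum_congr rfl fun k _ => ?_
  rw [ContinuousMultilinearMap.compContinuousLinearMap_apply,
    ContinuousMultilinearMap.curryMid_apply]
  -- in the `k`-th place stands `πz - z = -s • (0, 1)`
  have e1 : (fun j => if j < k then proj₀ E z else if j = k then proj₀ E z - z else z) =
      Function.update (k.insertNth ((0, 1) : E × ℝ) (fun j : Fin n =>
        (if k.succAbove j < k then proj₀ E else ContinuousLinearMap.id ℝ (E × ℝ)) z)) k
        ((-z.2) • ((0, 1) : E × ℝ)) := by
    funext j
    rcases Fin.eq_self_or_eq_succAbove k j with rfl | ⟨i, rfl⟩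
    · simp [proj₀_apply, Prod.ext_iff]
    · have hne : k.succAbove i ≠ k := Fin.succAbove_ne k i
      simp only [hne, if_false, Function.update_of_ne hne, Fin.insertNth_apply_succAbove]
      split_ifs <;> rfl
  rw [e1, ContinuousMultilinearMap.map_update_smul, neg_smul, neg_neg]
  congr 2
  rw [Function.eq_update_iff]
  simp

lemma norm_divTerm_le {n : ℕ}
    (m : ContinuousMultilinearMap ℝ (fun _ : Fin (n + 1) => E × ℝ) G) :
    ‖divTerm m‖ ≤ (n + 1) * ‖m‖ := by
  have hu : ‖((0, 1) : E × ℝ)‖ ≤ 1 := by simp [Prod.norm_def]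
  refine (norm_sum_le _ _).trans ?_
  refine (Finset.sum_le_sum (g := fun _ => ‖m‖) fun k _ => ?_).trans (by simp)
  refine ContinuousMultilinearMap.opNorm_le_bound (norm_nonneg _) fun v => ?_
  rw [ContinuousMultilinearMap.compContinuousLinearMap_apply]
  refine (ContinuousMultilinearMap.le_opNorm _ _).trans ?_
  gcongr with j
  · refine ((m.curryMid k).le_opNorm _).trans ?_
    rw [ContinuousMultilinearMap.norm_curryMid]
    exact mul_le_of_le_one_right (norm_nonneg _) hu
  · split_ifs
    · exact norm_proj₀_le _
    · rfl

/-- An analytic function `f (x, s)` that vanishes for `s = 0` is divisible by `s`. -/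
theorem _root_.AnalyticAt.exists_eq_smul_of_eq_zero [CompleteSpace G] {f : E × ℝ → G} {a : E}
    (hf : AnalyticAt ℝ f (a, 0)) (h0 : ∀ᶠ x in 𝓝 a, f (x, 0) = 0) :
    ∃ g : E × ℝ → G, AnalyticAt ℝ g (a, 0) ∧ ∀ᶠ z in 𝓝 (a, (0 : ℝ)), f z = z.2 • g z := by
  obtain ⟨p, r, hp⟩ := hf
  let q : FormalMultilinearSeries ℝ (E × ℝ) G := fun n => divTerm (p (n + 1))
  -- the radius of convergence of `q` is positive: halving the radius absorbs the factor `n + 1`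
  obtain ⟨R, hR0, hRr⟩ := ENNReal.lt_iff_exists_nnreal_btwn.1 hp.r_pos
  have hR0' : 0 < R := by exact_mod_cast hR0
  have hqpos : 0 < q.radius := by
    obtain ⟨C, hC, hpC⟩ := p.norm_mul_pow_le_of_lt_radius (hRr.trans_le hp.r_le)
    refine lt_of_lt_of_le ?_ (q.le_radius_of_bound (C / R) (r := R / 2) fun n => ?_)
    · exact_mod_cast half_pos hR0'
    · have hRpos : (0 : ℝ) < R := hR0'
      have h2 : ((n : ℝ) + 1) ≤ 2 ^ n := by exact_mod_cast Nat.succ_le_of_lt n.lt_two_pow_self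
      have h3 := hpC (n + 1)
      rw [le_div_iff₀ hRpos]
      calc ‖q n‖ * ((R / 2 : NNReal) : ℝ) ^ n * R
          ≤ (2 ^ n * ‖p (n + 1)‖) * ((R / 2 : NNReal) : ℝ) ^ n * R := by
            gcongr
            exact (norm_divTerm_le _).trans (by gcongr)
        _ = ‖p (n + 1)‖ * (R : ℝ) ^ (n + 1) := by
            push_cast; rw [div_pow, pow_succ]; field_simp
        _ ≤ C := h3
  have hq := q.hasFPowerSeriesOnBall hqpos
  refine ⟨fun z => q.sum (z - (a, 0)), ?_, ?_⟩
  · have h1 : AnalyticAt ℝ q.sum ((a, (0 : ℝ)) - (a, 0)) := by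
      rw [sub_self]; exact hq.analyticAt
    exact h1.comp_of_eq (f := fun z : E × ℝ => z - (a, 0)) (by fun_prop) rfl
  · have hb1 : ∀ᶠ z in 𝓝 (a, (0 : ℝ)), z - (a, 0) ∈ Metric.eball (0 : E × ℝ) r :=
      (show ContinuousAt (fun z : E × ℝ => z - (a, 0)) (a, 0) by fun_prop).eventually
        (by
          have : ∀ᶠ y in 𝓝 (0 : E × ℝ), y ∈ Metric.eball 0 r := Metric.eball_mem_nhds _ hp.r_pos
          simpa only [sub_self, map_zero] using this)
    have hb2 : ∀ᶠ z in 𝓝 (a, (0 : ℝ)), z - (a, 0) ∈ Metric.eball (0 : E × ℝ) q.radius :=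
      (show ContinuousAt (fun z : E × ℝ => z - (a, 0)) (a, 0) by fun_prop).eventually
        (by
          have : ∀ᶠ y in 𝓝 (0 : E × ℝ), y ∈ Metric.eball 0 q.radius := Metric.eball_mem_nhds _ hqpos
          simpa only [sub_self, map_zero] using this)
    have hb3 : ∀ᶠ z in 𝓝 (a, (0 : ℝ)), proj₀ E (z - (a, 0)) ∈ Metric.eball (0 : E × ℝ) r :=
      (show ContinuousAt (fun z : E × ℝ => proj₀ E (z - (a, 0))) (a, 0) by fun_prop).eventually
        (by
          have : ∀ᶠ y in 𝓝 (0 : E × ℝ), y ∈ Metric.eball 0 r := Metric.eball_mem_nhds _ hp.r_pos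
          simpa only [sub_self, map_zero] using this)
    have hb4 : ∀ᶠ z in 𝓝 (a, (0 : ℝ)), f (z.1, 0) = 0 :=
      (show ContinuousAt (fun z : E × ℝ => z.1) (a, 0) from continuousAt_fst).eventually h0
    filter_upwards [hb1, hb2, hb3, hb4] with z h1 h2 h3 h4
    have s1 := hp.hasSum h1
    have s2 := hp.hasSum h3
    have s3 := (hq.hasSum h2).const_smul z.2
    rw [add_sub_cancel] at s1
    have e2 : (a, (0 : ℝ)) + proj₀ E (z - (a, 0)) = (z.1, 0) := by
      simp [proj₀_apply]
    rw [e2, h4] at s2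
    have s4 := s1.sub s2
    rw [sub_zero, ← hasSum_nat_add_iff' 1] at s4
    have e3 : ∀ n, p (n + 1) (fun _ => z - (a, 0)) - p (n + 1) (fun _ => proj₀ E (z - (a, 0))) =
        z.2 • q n (fun _ => z - (a, 0)) := fun n => by
      have := smul_divTerm (p (n + 1)) (z - (a, 0))
      simpa using this.symm
    simp only [e3, Finset.range_one, Finset.sum_singleton] at s4
    have e4 : (p 0 fun _ => z - (a, 0)) = p 0 fun _ => proj₀ E (z - (a, 0)) :=
      congrArg (p 0) (Subsingleton.elim _ _)
    rw [e4, sub_self, sub_zero] at s4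
    have := s4.unique s3
    simpa using this

end Division

namespace SliceChart
variable {E : Type*} [NormedAddCommGroup E] [NormedSpace ℝ E] [CompleteSpace E]
  {M : Type*} [TopologicalSpace M] [ChartedSpace E M] {N : ClosedSubmanifold E M}

lemma contDiff_dil (c : SliceChart N) {n : ℕ∞ω} :
    ContDiff ℝ n (fun p : E × ℝ => c.dil p.1 p.2) := by
  unfold dil; fun_prop

/-- The transversal part of a coordinate change, divided by `s`, is analytic also at `s = 0`. -/
lemma contDiffAt_quot (c d : SliceChart N) {e : E} {s : ℝ} (he : c.dil e s ∈ c.φ.target)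
    (hd : c.φ.symm (c.dil e s) ∈ d.φ.source) :
    ContDiffAt ℝ ω (fun p : E × ℝ => c.quot d p.1 p.2) (e, s) := by
  have hF : ContDiffAt ℝ ω (fun p : E × ℝ => d.P (c.trans d (c.dil p.1 p.2))) (e, s) :=
    d.P.contDiff.contDiffAt.comp _ (ContDiffAt.comp (g := c.trans d)
      (f := fun p : E × ℝ => c.dil p.1 p.2) (e, s)
      (c.contDiffAt_trans d he hd) c.contDiff_dil.contDiffAt)
  by_cases hs : s = 0
  · subst hs
    have hU : IsOpen {p : E × ℝ | c.dil p.1 p.2 ∈ overlap c.φ d.φ} :=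
      (isOpen_overlap c.φ d.φ).preimage c.continuous_dil
    have hmem : ∀ᶠ p : E × ℝ in 𝓝 (e, 0), c.dil p.1 p.2 ∈ overlap c.φ d.φ :=
      hU.mem_nhds ⟨he, hd⟩
    have hx : ∀ᶠ x in 𝓝 e, d.P (c.trans d (c.dil x 0)) = 0 := by
      have h1 : Tendsto (fun x : E => (x, (0 : ℝ))) (𝓝 e) (𝓝 (e, 0)) :=
        (Continuous.prodMk_left (0 : ℝ)).tendsto e
      filter_upwards [h1.eventually hmem] with x hx
      refine (d.mem_iff _ hx.2).1 ((c.symm_mem_iff hx.1).2 ?_)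
      rw [P_dil, zero_smul]
    obtain ⟨g, hg, hfg⟩ := AnalyticAt.exists_eq_smul_of_eq_zero
      (hF.analyticAt) hx
    refine (hg.contDiffAt).congr_of_eventuallyEq ?_
    -- both sides are continuous near the point and agree for `s ≠ 0`
    have hgc : ∀ᶠ p in 𝓝 (e, (0 : ℝ)), ContinuousAt g p :=
      hg.eventually_analyticAt.mono fun p hp => hp.continuousAt
    filter_upwards [hmem, hgc, eventually_eventually_nhds.2 hfg] with p hp hgp hfp
    by_cases h : p.2 = 0
    · have hcq := c.continuousAt_quot d (e := p.1) (s := p.2) hp.1 hp.2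
      have hl : Tendsto (fun t : ℝ => (p.1, t)) (𝓝[≠] p.2) (𝓝 p) :=
        ((Continuous.prodMk_right p.1).tendsto p.2).mono_left nhdsWithin_le_nhds
      refine tendsto_nhds_unique_of_eventuallyEq (hcq.tendsto.comp hl) (hgp.tendsto.comp hl) ?_
      filter_upwards [hl.eventually hfp, self_mem_nhdsWithin] with t ht ht0
      have ht1 : t ≠ 0 := by rw [h] at ht0; exact ht0
      simp only [Function.comp, quot, ht1, if_false]
      rw [ht, smul_smul, inv_mul_cancel₀ ht1, one_smul]
    · have h2 := hfp.self_of_nhds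
      simp only [quot, h, if_false]
      rw [h2, smul_smul, inv_mul_cancel₀ h, one_smul]
  · refine ((contDiffAt_snd.inv hs).smul hF).congr_of_eventuallyEq ?_
    filter_upwards [continuousAt_snd.eventually_ne hs] with p hp
    simp [quot, hp]

end SliceChart

/-! ### The analytic structures -/

section Charts

variable {E : Type*} [NormedAddCommGroup E] [NormedSpace ℝ E]
  {M : Type*} [TopologicalSpace M] [ChartedSpace E M]

lemma contDiffAt_overlap {φ ψ : OpenPartialHomeomorph M E}
    (hφ : φ ∈ IsManifold.maximalAtlas 𝓘(ℝ, E) ω M) (hψ : ψ ∈ IsManifold.maximalAtlas 𝓘(ℝ, E) ω M)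
    {e : E} (he : e ∈ overlap φ ψ) : ContDiffAt ℝ ω (fun e => ψ (φ.symm e)) e := by
  rw [← contMDiffAt_iff_contDiffAt]
  exact (contMDiffAt_of_mem_maximalAtlas hψ he.2).comp e
    (contMDiffAt_symm_of_mem_maximalAtlas hφ he.1)

/-- A charted space glued from charts is an analytic manifold if the coordinate changes are
analytic. -/
lemma isManifold_toChartedSpace {X : Type*} (c : ChartedSpaceCore E X)
    (h : ∀ e ∈ c.atlas, ∀ e' ∈ c.atlas,
      ContDiffOn ℝ ω (e' ∘ e.symm) (e.symm.trans e').source) :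
    letI := c.toTopologicalSpace
    letI := c.toChartedSpace
    IsManifold 𝓘(ℝ, E) ω X := by
  let := c.toTopologicalSpace
  let := c.toChartedSpace
  refine isManifold_of_contDiffOn _ _ _ fun e e' he he' => ?_
  simp only [modelWithCornersSelf_coe, modelWithCornersSelf_coe_symm, range_id, inter_univ,
    preimage_id, Function.comp_id, Function.id_comp]
  have he2 : e ∈ ⋃ (e : PartialEquiv X E) (he : e ∈ c.atlas), {c.openPartialHomeomorph e he} := he
  have he2' : e' ∈ ⋃ (e : PartialEquiv X E) (he : e ∈ c.atlas),
    {c.openPartialHomeomorph e he} := he'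
  simp only [mem_iUnion, mem_singleton_iff] at he2 he2'
  obtain ⟨e₀, h₀, rfl⟩ := he2
  obtain ⟨e₁, h₁, rfl⟩ := he2'
  exact h e₀ h₀ e₁ h₁

namespace NormalDeformation

variable [CompleteSpace E] [IsManifold 𝓘(ℝ, E) ω M] {N : ClosedSubmanifold E M}

lemma contDiffOn_coordChange (e : PartialEquiv (NormalDeformation N) (E × ℝ))
    (he : e ∈ (chartCore N).atlas) (e' : PartialEquiv (NormalDeformation N) (E × ℝ))
    (he' : e' ∈ (chartCore N).atlas) :
    ContDiffOn ℝ ω (e' ∘ e.symm) (e.symm.trans e').source := by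
  rcases he with (⟨φ, hφ, rfl⟩ | ⟨c, rfl⟩) <;> rcases he' with (⟨ψ, hψ, rfl⟩ | ⟨d, rfl⟩)
  · rw [source_away_away]
    refine ContDiffOn.congr (f := fun q : E × ℝ => (ψ (φ.symm q.1), q.2)) ?_ ?_
    · intro q hq
      exact (ContDiffAt.prodMk (ContDiffAt.comp (g := fun e => ψ (φ.symm e)) q
        (contDiffAt_overlap hφ hψ hq.1) contDiffAt_fst) contDiffAt_snd).contDiffWithinAt
    · intro q hq
      have h : q.2 ≠ 0 := hq.2
      simp [awayChart, h, p, s]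
  · rw [source_away_slice]
    refine ContDiffOn.congr
      (f := fun q : E × ℝ => (d.dil (d.φ (φ.symm q.1)) q.2⁻¹, q.2)) ?_ ?_
    · intro q hq
      have h1 : ContDiffAt ℝ ω (fun q : E × ℝ => (d.φ (φ.symm q.1), q.2⁻¹)) q :=
        (ContDiffAt.comp (g := fun e => d.φ (φ.symm e)) q
          (contDiffAt_overlap hφ d.mem hq.1) contDiffAt_fst).prodMk (contDiffAt_snd.inv hq.2)
      exact (ContDiffAt.prodMk (ContDiffAt.comp (g := fun r : E × ℝ => d.dil r.1 r.2) q
        d.contDiff_dil.contDiffAt h1) contDiffAt_snd).contDiffWithinAt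
    · intro q hq
      have h : q.2 ≠ 0 := hq.2
      simp [awayChart, h, sliceChart, sliceCoord]
  · rw [source_slice_away]
    refine ContDiffOn.congr (f := fun q : E × ℝ => (ψ (c.φ.symm (c.dil q.1 q.2)), q.2)) ?_ ?_
    · intro q hq
      exact (ContDiffAt.prodMk (ContDiffAt.comp (g := fun e => ψ (c.φ.symm e))
        (f := fun q : E × ℝ => c.dil q.1 q.2) q (contDiffAt_overlap c.mem hψ hq.1)
        c.contDiff_dil.contDiffAt) contDiffAt_snd).contDiffWithinAt
    · intro q hq
      have h1 : (sliceParam c q).p = _ := p_sliceParam c hq.1.1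
      have h2 : (sliceParam c q).s = _ := s_sliceParam c hq.1.1
      simp [awayChart, sliceChart, h1, h2]
  · rw [source_slice_slice]
    refine ContDiffOn.congr (f := fun q : E × ℝ =>
      (d.dil (c.trans d (c.dil q.1 q.2)) 0 + c.quot d q.1 q.2, q.2)) ?_ ?_
    · intro q hq
      have h1 : ContDiffAt ℝ ω (fun q : E × ℝ => c.trans d (c.dil q.1 q.2)) q :=
        ContDiffAt.comp (g := c.trans d) (f := fun q : E × ℝ => c.dil q.1 q.2) q
          (c.contDiffAt_trans d hq.1 hq.2) c.contDiff_dil.contDiffAt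
      have h2 : ContDiffAt ℝ ω (fun q : E × ℝ => d.dil (c.trans d (c.dil q.1 q.2)) 0) q :=
        ContDiffAt.comp (g := fun r : E × ℝ => d.dil r.1 r.2)
          (f := fun q : E × ℝ => (c.trans d (c.dil q.1 q.2), (0 : ℝ))) q
          d.contDiff_dil.contDiffAt (h1.prodMk contDiffAt_const)
      exact ((h2.add (c.contDiffAt_quot d (e := q.1) (s := q.2) hq.1 hq.2)).prodMk
        contDiffAt_snd).contDiffWithinAt
    · intro q hq
      exact sliceCoord_sliceParam c d hq.1 hq.2

instance : IsManifold 𝓘(ℝ, E × ℝ) ω (NormalDeformation N) :=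
  isManifold_toChartedSpace (chartCore N) contDiffOn_coordChange

/-- The chart `(φ x, t)` of the normal deformation as an open partial homeomorphism. -/
def awayHomeo (N : ClosedSubmanifold E M) {φ : OpenPartialHomeomorph M E}
    (hφ : φ ∈ IsManifold.maximalAtlas 𝓘(ℝ, E) ω M) :
    OpenPartialHomeomorph (NormalDeformation N) (E × ℝ) :=
  (chartCore N).openPartialHomeomorph (awayChart N φ) (Or.inl ⟨φ, hφ, rfl⟩)

/-- The chart `(v, y, s)` of the normal deformation as an open partial homeomorphism. -/
def sliceHomeo (c : SliceChart N) : OpenPartialHomeomorph (NormalDeformation N) (E × ℝ) :=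
  (chartCore N).openPartialHomeomorph (sliceChart c) (Or.inr ⟨c, rfl⟩)

lemma openPartialHomeomorph_mem (e : PartialEquiv (NormalDeformation N) (E × ℝ))
    (he : e ∈ (chartCore N).atlas) : (chartCore N).openPartialHomeomorph e he ∈
      IsManifold.maximalAtlas 𝓘(ℝ, E × ℝ) ω (NormalDeformation N) := by
  refine IsManifold.subset_maximalAtlas ?_
  change _ ∈ ⋃ (e : PartialEquiv (NormalDeformation N) (E × ℝ)) (he : e ∈ (chartCore N).atlas),
    {(chartCore N).openPartialHomeomorph e he}
  simp only [mem_iUnion, mem_singleton_iff]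
  exact ⟨e, he, rfl⟩

lemma contMDiff_p : ContMDiff 𝓘(ℝ, E × ℝ) 𝓘(ℝ, E) ω (p : NormalDeformation N → M) := by
  intro d
  cases d with
  | away x t ht =>
    have hφ : chartAt E x ∈ IsManifold.maximalAtlas 𝓘(ℝ, E) ω M :=
      IsManifold.chart_mem_maximalAtlas x
    have hx : x ∈ (chartAt E x).source := mem_chart_source E x
    let e := awayHomeo N hφ
    have hd : away x t ht ∈ e.source := ⟨hx, ht⟩
    have he := contMDiffAt_of_mem_maximalAtlas (openPartialHomeomorph_mem _ _) hd
    have hs : ContMDiffAt 𝓘(ℝ, E × ℝ) 𝓘(ℝ, E) ω (fun q : E × ℝ => (chartAt E x).symm q.1)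
        (e (away x t ht)) :=
      ContMDiffAt.comp _ (contMDiffAt_symm_of_mem_maximalAtlas hφ ((chartAt E x).map_source hx))
        contDiffAt_fst.contMDiffAt
    refine (hs.comp _ he).congr_of_eventuallyEq ?_
    filter_upwards [e.open_source.mem_nhds hd] with d' hd'
    exact ((chartAt E x).left_inv hd'.1).symm
  | normal x hx ξ =>
    obtain ⟨φ, hφ, hxφ, P, hP, hm⟩ := N.exists_slice x hx
    let c : SliceChart N := ⟨φ, hφ, P, hP, hm⟩
    let e := sliceHomeo c
    have hd : normal x hx ξ ∈ e.source := hxφ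
    have he := contMDiffAt_of_mem_maximalAtlas (openPartialHomeomorph_mem _ _) hd
    have ht : e (normal x hx ξ) ∈ e.target := e.map_source hd
    have hs : ContMDiffAt 𝓘(ℝ, E × ℝ) 𝓘(ℝ, E) ω (fun q : E × ℝ => φ.symm (c.dil q.1 q.2))
        (e (normal x hx ξ)) :=
      ContMDiffAt.comp (g := φ.symm) (f := fun q : E × ℝ => c.dil q.1 q.2) _
        (contMDiffAt_symm_of_mem_maximalAtlas hφ ht) c.contDiff_dil.contDiffAt.contMDiffAt
    refine (hs.comp _ he).congr_of_eventuallyEq ?_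
    filter_upwards [e.open_source.mem_nhds hd] with d' hd'
    have h1 := p_sliceParam c (q := e d') (e.map_source hd')
    have h2 : sliceParam c (e d') = d' := e.left_inv hd'
    rw [h2] at h1
    exact h1

end NormalDeformation

namespace BlowUp

variable [CompleteSpace E] [IsManifold 𝓘(ℝ, E) ω M] {N : ClosedSubmanifold E M}

lemma contDiff_lift (c : AffineSliceChart N) {n : ℕ∞ω} :
    ContDiff ℝ n fun e => (lift c e, c.ℓ e) := by
  have : ContDiff ℝ n c.ℓ := c.ℓ.contDiff
  unfold lift; fun_prop

lemma contDiff_down (c : AffineSliceChart N) {n : ℕ∞ω} : ContDiff ℝ n (down c) :=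
  c.contDiff_dil.comp (contDiff_lift c)

lemma contDiffAt_quot (c d : AffineSliceChart N) {e : E} (he : down c e ∈ overlap c.φ d.φ) :
    ContDiffAt ℝ ω (fun e => c.quot d.toSliceChart (lift c e) (c.ℓ e)) e :=
  ContDiffAt.comp (g := fun q : E × ℝ => c.quot d.toSliceChart q.1 q.2)
    (f := fun e => (lift c e, c.ℓ e)) e
    (c.contDiffAt_quot d.toSliceChart (e := lift c e) (s := c.ℓ e) he.1 he.2)
    (contDiff_lift c).contDiffAt

lemma contDiffOn_coordChange (e : PartialEquiv (BlowUp N) E)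
    (he : e ∈ (chartCore N).atlas) (e' : PartialEquiv (BlowUp N) E)
    (he' : e' ∈ (chartCore N).atlas) :
    ContDiffOn ℝ ω (e' ∘ e.symm) (e.symm.trans e').source := by
  rcases he with (⟨φ, hφ, b₀, hφm, rfl⟩ | ⟨c, b₀, rfl⟩) <;>
    rcases he' with (⟨ψ, hψ, b₁, hψm, rfl⟩ | ⟨d, b₁, rfl⟩)
  · rw [source_away_away]
    refine ContDiffOn.congr (f := fun e => ψ (φ.symm e))
      (fun e he => (contDiffAt_overlap hφm hψm he).contDiffWithinAt) fun e he => ?_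
    have h1 := hφ _ (φ.map_target he.1)
    simp [awayChart, h1, proj]
  · rw [source_away_slice]
    have h0 : ContDiffOn ℝ ω (fun e => d.φ (φ.symm e))
        {e | e ∈ overlap φ d.φ ∧ d.ℓ (d.φ (φ.symm e)) ≠ 0} :=
      fun e he => (contDiffAt_overlap hφm d.mem he.1).contDiffWithinAt
    have hl := d.ℓ.contDiff.comp_contDiffOn h0
    have hp := d.P.contDiff.comp_contDiffOn h0
    refine ((((hl.inv fun e he => he.2).smul hp).sub (contDiffOn_const (c := d.w))).add
      (hl.smul (contDiffOn_const (c := d.w))) |>.add (h0.sub hp)).congr fun e he => ?_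
    have h1 := hφ _ (φ.map_target he.1.1)
    simp [awayChart, h1, sliceChart, sliceCoord]
  · rw [source_slice_away]
    refine ContDiffOn.congr (f := fun e => ψ (c.φ.symm (down c e))) (fun e he => ?_)
      fun e he => ?_
    · exact (ContDiffAt.comp (g := fun e => ψ (c.φ.symm e)) e
        (contDiffAt_overlap c.mem hψm he) (contDiff_down c).contDiffAt).contDiffWithinAt
    · have h1 := proj_sliceParam c b₀ he.1
      simp [awayChart, sliceChart, h1]
  · rw [source_slice_slice]
    refine ContDiffOn.congr (f := fun e =>
      (d.ℓ (c.quot d.toSliceChart (lift c e) (c.ℓ e)))⁻¹ •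
        c.quot d.toSliceChart (lift c e) (c.ℓ e) - d.w
      + (c.ℓ e * d.ℓ (c.quot d.toSliceChart (lift c e) (c.ℓ e))) • d.w
      + d.dil (c.trans d.toSliceChart (down c e)) 0) ?_ ?_
    · intro e he
      have hq := contDiffAt_quot c d he.1
      have hl : ContDiffAt ℝ ω (fun e => d.ℓ (c.quot d.toSliceChart (lift c e) (c.ℓ e))) e :=
        d.ℓ.contDiff.contDiffAt.comp e hq
      have h1 : ContDiffAt ℝ ω (fun e => c.trans d.toSliceChart (down c e)) e :=
        ContDiffAt.comp (g := c.trans d.toSliceChart) (f := down c) e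
          (c.contDiffAt_trans d.toSliceChart he.1.1 he.1.2) (contDiff_down c).contDiffAt
      have h2 : ContDiffAt ℝ ω (fun e => d.dil (c.trans d.toSliceChart (down c e)) 0) e :=
        ContDiffAt.comp (g := fun r : E × ℝ => d.dil r.1 r.2)
          (f := fun e => (c.trans d.toSliceChart (down c e), (0 : ℝ))) e
          d.contDiff_dil.contDiffAt (h1.prodMk contDiffAt_const)
      exact (((((hl.inv he.2).smul hq).sub contDiffAt_const).add
        ((c.ℓ.contDiff.contDiffAt.mul hl).smul contDiffAt_const)).add
        h2).contDiffWithinAt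
    · intro e he
      exact sliceCoord_sliceParam c d b₀ he.1.1 he.1.2

instance : IsManifold 𝓘(ℝ, E) ω (BlowUp N) :=
  isManifold_toChartedSpace (chartCore N) contDiffOn_coordChange

/-- A chart of `M` outside `N` as a chart of the blow-up. -/
def awayHomeo {φ : OpenPartialHomeomorph M E} (hφ : ∀ x ∈ φ.source, x ∉ N.carrier)
    (b₀ : BlowUp N) (hm : φ ∈ IsManifold.maximalAtlas 𝓘(ℝ, E) ω M) :
    OpenPartialHomeomorph (BlowUp N) E :=
  (chartCore N).openPartialHomeomorph (awayChart φ hφ b₀) (Or.inl ⟨φ, hφ, b₀, hm, rfl⟩)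

/-- The chart of the blow-up given by homogeneous coordinates as an open partial
homeomorphism. -/
def sliceHomeo (c : AffineSliceChart N) (b₀ : BlowUp N) : OpenPartialHomeomorph (BlowUp N) E :=
  (chartCore N).openPartialHomeomorph (sliceChart c b₀) (Or.inr ⟨c, b₀, rfl⟩)

lemma openPartialHomeomorph_mem (e : PartialEquiv (BlowUp N) E)
    (he : e ∈ (chartCore N).atlas) : (chartCore N).openPartialHomeomorph e he ∈
      IsManifold.maximalAtlas 𝓘(ℝ, E) ω (BlowUp N) := by
  refine IsManifold.subset_maximalAtlas ?_
  change _ ∈ ⋃ (e : PartialEquiv (BlowUp N) E) (he : e ∈ (chartCore N).atlas),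
    {(chartCore N).openPartialHomeomorph e he}
  simp only [mem_iUnion, mem_singleton_iff]
  exact ⟨e, he, rfl⟩

lemma contMDiff_proj : ContMDiff 𝓘(ℝ, E) 𝓘(ℝ, E) ω (proj : BlowUp N → M) := by
  intro b
  cases b with
  | away x hx =>
    obtain ⟨φ, hφ, hxφ, hφN⟩ := exists_awayChart hx
    let e := awayHomeo hφN (away x hx) hφ
    have hb : away x hx ∈ e.source := hxφ
    have he := contMDiffAt_of_mem_maximalAtlas (openPartialHomeomorph_mem _ _) hb
    have hs := contMDiffAt_symm_of_mem_maximalAtlas hφ (φ.map_source hxφ)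
    refine (ContMDiffAt.comp (g := φ.symm) (f := e) _ hs he).congr_of_eventuallyEq ?_
    filter_upwards [e.open_source.mem_nhds hb] with b' hb'
    exact (φ.left_inv hb').symm
  | exc x hx L =>
    obtain ⟨c, hxc, hL⟩ := exists_affineSliceChart hx L
    let e := sliceHomeo c (exc x hx L)
    have hb : exc x hx L ∈ e.source := ⟨hxc, hL⟩
    have he := contMDiffAt_of_mem_maximalAtlas (openPartialHomeomorph_mem _ _) hb
    have ht : e (exc x hx L) ∈ e.target := e.map_source hb
    have hs : ContMDiffAt 𝓘(ℝ, E) 𝓘(ℝ, E) ω (fun e => c.φ.symm (down c e)) (e (exc x hx L)) :=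
      ContMDiffAt.comp (g := c.φ.symm) (f := down c) _
        (contMDiffAt_symm_of_mem_maximalAtlas c.mem ht) (contDiff_down c).contDiffAt.contMDiffAt
    refine (hs.comp _ he).congr_of_eventuallyEq ?_
    filter_upwards [e.open_source.mem_nhds hb] with b' hb'
    have h1 := proj_sliceParam c (exc x hx L) (e := e b') (e.map_source hb')
    have h2 : sliceParam c (exc x hx L) (e b') = b' := e.left_inv hb'
    rw [h2] at h1
    exact h1

end BlowUp

end Charts

/-! ### The blow-up is proper and Hausdorff -/

section Proper

variable {E : Type*} [NormedAddCommGroup E] [NormedSpace ℝ E]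
  {M : Type*} [TopologicalSpace M] [ChartedSpace E M] {N : ClosedSubmanifold E M}

/-- The affine slice chart of a slice chart `c` in which the transversal vectors `v` are normalized
by `l v = 1`, for a linear form `l` that does not vanish on the transversal vector `u`. -/
def SliceChart.toAffine (c : SliceChart N) (l : E →L[ℝ] ℝ) (u : E) (hu : c.P u = u)
    (hl : l u ≠ 0) : AffineSliceChart N :=
  { c with
    ℓ := l.comp c.P
    w := (l u)⁻¹ • u
    ℓ_P := fun e => by simp [c.P_P]
    P_w := by rw [map_smul, hu]
    ℓ_w := by simp [hu, hl] }

namespace BlowUp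

/-- A representative, in the coordinates of a slice chart, of the transversal direction of a point
of the blow-up. -/
def dir (c : SliceChart N) : BlowUp N → E
  | away x _ => c.P (c.φ x)
  | exc x _ L => c.normalCoord x L.rep

lemma P_dir (c : SliceChart N) (b : BlowUp N) : c.P (dir c b) = dir c b := by
  cases b with
  | away x hx => exact c.P_P _
  | exc x hx L => exact c.P_normalCoord x _

lemma dir_ne_zero (c : SliceChart N) {b : BlowUp N} (hb : b.proj ∈ c.φ.source) :
    dir c b ≠ 0 := by
  cases b with
  | away x hx => exact fun h => hx ((c.mem_iff x hb).2 h)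
  | exc x hx L =>
    intro h
    have hx' : x ∈ c.φ.source := hb
    apply L.rep_nonzero
    have h2 : L.rep = Submodule.Quotient.mk L.rep.out := (Quotient.out_eq _).symm
    rw [h2, Submodule.Quotient.mk_eq_zero, c.mem_tangentSub_iff hx' hx]
    exact h

lemma form_eq (c : AffineSliceChart N) (b : BlowUp N) : form c b = c.ℓ (dir c.toSliceChart b) := by
  cases b with
  | away x hx => exact (c.ℓ_P _).symm
  | exc x hx L => rfl

/-- The affine coordinates in terms of the transversal direction, by a formula that holds on and off
the exceptional divisor. -/
lemma sliceCoord_eq (c : AffineSliceChart N) {b : BlowUp N} (hb : b.proj ∈ c.φ.source) :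
    sliceCoord c b = (c.ℓ (dir c.toSliceChart b))⁻¹ • dir c.toSliceChart b - c.w +
      c.ℓ (c.φ b.proj) • c.w + (c.φ b.proj - c.P (c.φ b.proj)) := by
  cases b with
  | away x hx => simp only [sliceCoord, dir, c.ℓ_P, proj]
  | exc x hx L =>
    have h0 : c.P (c.φ x) = 0 := (c.mem_iff x hb).1 hx
    have h1 : c.ℓ (c.φ x) = 0 := by rw [← c.ℓ_P, h0, map_zero]
    simp [sliceCoord, dir, proj, h0, h1]

variable [IsManifold 𝓘(ℝ, E) ω M]

lemma continuous_proj [CompleteSpace E] : Continuous (proj : BlowUp N → M) :=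
  contMDiff_proj.continuous

/-- The blow-up is proper over `M`. Near a point of the center, the transversal directions,
normalized to have norm one, converge along any ultrafilter, since the unit sphere is compact; in
the affine chart given by a linear form not vanishing on the limit, the coordinates converge. -/
theorem isProperMap_proj [FiniteDimensional ℝ E] : IsProperMap (proj : BlowUp N → M) := by
  have : CompleteSpace E := FiniteDimensional.complete ℝ E
  refine isProperMap_iff_ultrafilter.2 ⟨continuous_proj, fun 𝒰 x₀ h𝒰 => ?_⟩
  by_cases hx₀ : x₀ ∈ N.carrier
  · obtain ⟨φ, hφ, hxφ, P, hP, hm⟩ := N.exists_slice x₀ hx₀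
    let c : SliceChart N := ⟨φ, hφ, P, hP, hm⟩
    have hS : ∀ᶠ b in (𝒰 : Filter (BlowUp N)), b.proj ∈ φ.source :=
      h𝒰.eventually (φ.open_source.mem_nhds hxφ)
    let v : BlowUp N → E := fun b => ‖dir c b‖⁻¹ • dir c b
    obtain ⟨u, hu, hvu⟩ : ∃ u ∈ Metric.sphere (0 : E) 1, Tendsto v 𝒰 (𝓝 u) := by
      refine (isCompact_sphere (0 : E) 1).ultrafilter_le_nhds' (𝒰.map v) ?_
      refine Ultrafilter.mem_map.2
        (Ultrafilter.mem_coe.1 (Filter.mem_of_superset hS fun b hb => ?_))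
      have hb : b.proj ∈ c.φ.source := hb
      have : ‖dir c b‖ ≠ 0 := norm_ne_zero_iff.2 (dir_ne_zero c hb)
      simp [v, norm_smul, this]
    have hPu : P u = u := by
      refine tendsto_nhds_unique ((P.continuous.tendsto u).comp hvu) (hvu.congr fun b => ?_)
      exact ((map_smul P _ _).trans (congrArg _ (P_dir c b))).symm
    have hu0 : u ≠ 0 := fun h => by simp [h] at hu
    obtain ⟨l, hl⟩ := SeparatingDual.exists_ne_zero (R := ℝ) hu0
    let d : AffineSliceChart N := c.toAffine l u hPu hl
    have hdu : d.ℓ u = l u := by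
      change l (P u) = l u
      rw [hPu]
    have hℓv : Tendsto (fun b => d.ℓ (v b)) 𝒰 (𝓝 (l u)) :=
      hdu ▸ (d.ℓ.continuous.tendsto u).comp hvu
    have hφt : Tendsto (fun b : BlowUp N => φ b.proj) 𝒰 (𝓝 (φ x₀)) :=
      (φ.continuousAt hxφ).tendsto.comp h𝒰
    have hP0 : P (φ x₀) = 0 := (hm x₀ hxφ).1 hx₀
    have hℓ0 : d.ℓ (φ x₀) = 0 := by
      change l (P (φ x₀)) = 0
      rw [hP0, map_zero]
    -- the coordinates in the affine chart converge to the coordinates of `x₀`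
    have hlim : Tendsto (sliceCoord d) 𝒰 (𝓝 (φ x₀)) := by
      have h1 : Tendsto (fun b : BlowUp N => (d.ℓ (v b))⁻¹ • v b - d.w + d.ℓ (φ b.proj) • d.w +
          (φ b.proj - P (φ b.proj))) 𝒰
          (𝓝 ((l u)⁻¹ • u - d.w + d.ℓ (φ x₀) • d.w + (φ x₀ - P (φ x₀)))) :=
        ((((hℓv.inv₀ hl).smul hvu).sub_const d.w).add
          (((d.ℓ.continuous.tendsto _).comp hφt).smul_const d.w)).add
          (hφt.sub ((P.continuous.tendsto _).comp hφt))
      have h2 : (l u)⁻¹ • u - d.w + d.ℓ (φ x₀) • d.w + (φ x₀ - P (φ x₀)) = φ x₀ := by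
        have : d.w = (l u)⁻¹ • u := rfl
        rw [hℓ0, hP0, this]; simp
      rw [h2] at h1
      refine h1.congr' ?_
      filter_upwards [hS] with b hb
      rw [sliceCoord_eq d hb]
      have hn : ‖dir c b‖ ≠ 0 := norm_ne_zero_iff.2 (dir_ne_zero c hb)
      have h3 : (d.ℓ (v b))⁻¹ • v b = (d.ℓ (dir c b))⁻¹ • dir c b := by
        simp only [v, map_smul, smul_eq_mul, mul_inv, inv_inv, smul_smul]
        congr 1
        field_simp
      rw [h3]
      rfl
    have hdown : down d (φ x₀) = φ x₀ := by
      have hw : P d.w = d.w := d.P_w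
      change lift d (φ x₀) - P (lift d (φ x₀)) + d.ℓ (φ x₀) • P (lift d (φ x₀)) = φ x₀
      simp [lift, hℓ0, hP0, hw]
    have htarget : down d (φ x₀) ∈ φ.target := by
      rw [hdown]; exact φ.map_source hxφ
    obtain ⟨b₀⟩ : Nonempty (BlowUp N) := 𝒰.nonempty_of_mem univ_mem |>.to_type
    let e := sliceHomeo d b₀
    have hsource : ∀ᶠ b in (𝒰 : Filter (BlowUp N)), b ∈ e.source := by
      filter_upwards [hS, hℓv.eventually_ne hl] with b hb hb2
      refine ⟨hb, ?_⟩
      rw [form_eq]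
      intro h
      apply hb2
      have h' : d.ℓ (dir c b) = 0 := h
      simp [v, h']
    have hconv : Tendsto (fun b => e.symm (e b)) 𝒰 (𝓝 (e.symm (φ x₀))) :=
      (e.continuousAt_symm htarget).tendsto.comp hlim
    have hle : (𝒰 : Filter (BlowUp N)) ≤ 𝓝 (e.symm (φ x₀)) := by
      refine tendsto_id'.1 (hconv.congr' ?_)
      filter_upwards [hsource] with b hb using e.left_inv hb
    refine ⟨e.symm (φ x₀), ?_, hle⟩
    have h4 := proj_sliceParam d b₀ htarget
    rw [hdown] at h4
    exact h4.trans (φ.left_inv hxφ)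
  · obtain ⟨φ, hφ, hxφ, hφN⟩ := exists_awayChart hx₀
    let e := awayHomeo hφN (away x₀ hx₀) hφ
    have hb : away x₀ hx₀ ∈ e.source := hxφ
    refine ⟨away x₀ hx₀, rfl, ?_⟩
    have hconv : Tendsto (fun b => e.symm (e b)) 𝒰 (𝓝 (e.symm (e (away x₀ hx₀)))) :=
      (e.continuousAt_symm (e.map_source hb)).tendsto.comp
        ((φ.continuousAt hxφ).tendsto.comp h𝒰)
    rw [e.left_inv hb] at hconv
    refine tendsto_id'.1 (hconv.congr' ?_)
    filter_upwards [h𝒰.eventually (φ.open_source.mem_nhds hxφ)] with b hb using e.left_inv hb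

/-- The blow-up is Hausdorff: two points of an exceptional fibre lie in a common affine chart. -/
instance t2Space [CompleteSpace E] [T2Space M] : T2Space (BlowUp N) := by
  refine t2Space_iff_disjoint_nhds.2 fun b b' hbb => ?_
  by_cases hp : b.proj = b'.proj
  · cases b with
    | away x hx =>
      cases b' with
      | away x' hx' =>
        have hp' : x = x' := hp
        subst hp'; exact absurd rfl hbb
      | exc x' hx' L' => exact absurd ((show x = x' from hp) ▸ hx') hx
    | exc x hx L =>
      cases b' with
      | away x' hx' => exact absurd ((show x = x' from hp) ▸ hx) hx'
      | exc x' hx' L' =>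
        have hp' : x = x' := hp
        subst hp'
        obtain ⟨φ, hφ, hxφ, P, hP, hm⟩ := N.exists_slice x hx
        let c : SliceChart N := ⟨φ, hφ, P, hP, hm⟩
        have h1 : dir c (exc x hx L) ≠ 0 := dir_ne_zero c hxφ
        have h2 : dir c (exc x hx' L') ≠ 0 := dir_ne_zero c hxφ
        obtain ⟨l, hl1, hl2⟩ : ∃ l : E →L[ℝ] ℝ, l (dir c (exc x hx L)) ≠ 0 ∧
            l (dir c (exc x hx' L')) ≠ 0 := by
          obtain ⟨l₁, hl₁⟩ := SeparatingDual.exists_ne_zero (R := ℝ) h1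
          obtain ⟨l₂, hl₂⟩ := SeparatingDual.exists_ne_zero (R := ℝ) h2
          by_cases h3 : l₁ (dir c (exc x hx' L')) = 0
          · by_cases h4 : l₂ (dir c (exc x hx L)) = 0
            · exact ⟨l₁ + l₂, by simp [h4, hl₁], by simp [h3, hl₂]⟩
            · exact ⟨l₂, h4, hl₂⟩
          · exact ⟨l₁, hl₁, h3⟩
        let d : AffineSliceChart N := c.toAffine l _ (P_dir c _) hl1
        let e := sliceHomeo d (exc x hx L)
        have hs1 : exc x hx L ∈ e.source := by
          refine ⟨hxφ, ?_⟩
          rw [form_eq]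
          change l (c.P (dir c _)) ≠ 0
          rw [P_dir]; exact hl1
        have hs2 : exc x hx' L' ∈ e.source := by
          refine ⟨hxφ, ?_⟩
          rw [form_eq]
          change l (c.P (dir c _)) ≠ 0
          rw [P_dir]; exact hl2
        exact (e.continuousAt hs1).tendsto.disjoint
          (disjoint_nhds_nhds.2 fun h => hbb (e.injOn hs1 hs2 h)) (e.continuousAt hs2).tendsto
  · exact (continuous_proj.tendsto b).disjoint (disjoint_nhds_nhds.2 hp)
      (continuous_proj.tendsto b')

end BlowUp

lemma _root_.IsProperMap.sigmaCompactSpace {X Y : Type*} [TopologicalSpace X] [TopologicalSpace Y]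
    [SigmaCompactSpace Y] {f : X → Y} (hf : IsProperMap f) : SigmaCompactSpace X where
  isSigmaCompact_univ := ⟨fun n => f ⁻¹' compactCovering Y n,
    fun n => hf.isCompact_preimage (isCompact_compactCovering Y n), by
      rw [← preimage_iUnion, iUnion_compactCovering, preimage_univ]⟩

end Proper

/-! ### The embedding of the normal deformation -/

section Embedding

/-- A map that is the identity in suitable charts of the maximal atlases is a local
diffeomorphism. -/
lemma isLocalDiffeomorphAt_of_charts {F : Type*} [NormedAddCommGroup F] [NormedSpace ℝ F]
    {X Y : Type*} [TopologicalSpace X] [ChartedSpace F X] [TopologicalSpace Y] [ChartedSpace F Y]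
    [IsManifold 𝓘(ℝ, F) ω X] [IsManifold 𝓘(ℝ, F) ω Y] {f : X → Y} {x : X}
    {e : OpenPartialHomeomorph X F} (he : e ∈ IsManifold.maximalAtlas 𝓘(ℝ, F) ω X)
    {e' : OpenPartialHomeomorph Y F} (he' : e' ∈ IsManifold.maximalAtlas 𝓘(ℝ, F) ω Y)
    (hx : x ∈ e.source) (hmaps : ∀ y ∈ e.source, f y ∈ e'.source)
    (heq : ∀ y ∈ e.source, e' (f y) = e y) : IsLocalDiffeomorphAt 𝓘(ℝ, F) 𝓘(ℝ, F) ω f x := by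
  have hm : ∀ y ∈ e.source, e y ∈ e'.target := fun y hy => by
    rw [← heq y hy]; exact e'.map_source (hmaps y hy)
  let Ψ := e.trans e'.symm
  refine ⟨⟨Ψ.toPartialEquiv, Ψ.open_source, Ψ.open_target, ?_, ?_⟩, ⟨hx, hm x hx⟩,
    fun y hy => ?_⟩
  · exact (contMDiffOn_symm_of_mem_maximalAtlas he').comp
      ((contMDiffOn_of_mem_maximalAtlas he).mono inter_subset_left) fun y hy => hy.2
  · exact (contMDiffOn_symm_of_mem_maximalAtlas he).comp
      ((contMDiffOn_of_mem_maximalAtlas he').mono inter_subset_left) fun y hy => hy.2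
  · have hy' : y ∈ e.source := hy.1
    change f y = e'.symm (e y)
    rw [← heq y hy', e'.left_inv (hmaps y hy')]

variable {E : Type*} [NormedAddCommGroup E] [NormedSpace ℝ E]
  {M : Type*} [TopologicalSpace M] [ChartedSpace E M] {N : ClosedSubmanifold E M}

lemma rpAffine_mem_maximalAtlas :
    rpAffine ∈ IsManifold.maximalAtlas 𝓘(ℝ, ℝ) ω (OnePoint ℝ) :=
  IsManifold.subset_maximalAtlas (Or.inl rfl)

lemma rpInfty_mem_maximalAtlas :
    rpInfty ∈ IsManifold.maximalAtlas 𝓘(ℝ, ℝ) ω (OnePoint ℝ) :=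
  IsManifold.subset_maximalAtlas (Or.inr rfl)

lemma prod_mem_maximalAtlas [IsManifold 𝓘(ℝ, E) ω M] {φ : OpenPartialHomeomorph M E}
    (hφ : φ ∈ IsManifold.maximalAtlas 𝓘(ℝ, E) ω M) {ψ : OpenPartialHomeomorph (OnePoint ℝ) ℝ}
    (hψ : ψ ∈ IsManifold.maximalAtlas 𝓘(ℝ, ℝ) ω (OnePoint ℝ)) :
    (φ.prod ψ : OpenPartialHomeomorph (M × OnePoint ℝ) (E × ℝ)) ∈
      IsManifold.maximalAtlas 𝓘(ℝ, E × ℝ) ω (M × OnePoint ℝ) := by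
  have h := IsManifold.mem_maximalAtlas_prod hφ hψ
  rw [modelWithCornersSelf_prod]
  exact h

variable [IsManifold 𝓘(ℝ, E) ω M]

lemma proj_embed (a : NormalDeformation N) : (embed N a).proj = (a.p, (a.s : OnePoint ℝ)) := by
  cases a <;> rfl

/-- A slice chart `(x, y)` of `N` gives the slice chart `((x, t), y)` of `N × {0}` in `M × ℝP`.
The linear form `t` defines the affine chart that contains the normal deformation. -/
def embedChart (c : SliceChart N) : AffineSliceChart (center N) where
  φ := c.φ.prod rpAffine
  mem := prod_mem_maximalAtlas c.mem rpAffine_mem_maximalAtlas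
  P := c.P.prodMap (ContinuousLinearMap.id ℝ ℝ)
  P_P := by rintro ⟨e, t⟩; simp [c.P_P]
  mem_iff := by
    rintro ⟨y, z⟩ ⟨hy, hz⟩
    obtain ⟨t, rfl⟩ := OnePoint.ne_infty_iff_exists.1 ((mem_rpAffine_iff z).1 hz)
    have := c.mem_iff y hy
    simp [center, this, rpAffine_coe, Prod.ext_iff]
  ℓ := ContinuousLinearMap.snd ℝ E ℝ
  w := (0, 1)
  ℓ_P := by rintro ⟨e, t⟩; rfl
  P_w := by simp
  ℓ_w := rfl

lemma embedChart_dP_liftVec (c : SliceChart N) {x : M} (hx : x ∈ c.φ.source)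
    (v : TangentSpace 𝓘(ℝ, E) x) :
    (embedChart c).dP (x, ((0 : ℝ) : OnePoint ℝ)) (liftVec x v) = (c.dP x v, 1) := by
  set c' := embedChart c with hc'
  have hx' : (x, ((0 : ℝ) : OnePoint ℝ)) ∈ c'.φ.source := ⟨hx, coe_mem_rpAffine 0⟩
  let D : E × ℝ →L[ℝ] E × ℝ := mfderiv 𝓘(ℝ, E × ℝ) 𝓘(ℝ, E × ℝ) c'.φ (x, ((0 : ℝ) : OnePoint ℝ))
  let A : E →L[ℝ] E × ℝ :=
    mfderiv 𝓘(ℝ, E) 𝓘(ℝ, E × ℝ) (fun y : M => (y, ((0 : ℝ) : OnePoint ℝ))) x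
  let B : ℝ →L[ℝ] E × ℝ := mfderiv 𝓘(ℝ, ℝ) 𝓘(ℝ, E × ℝ) (fun t : ℝ => (x, (t : OnePoint ℝ))) 0
  let C : E →L[ℝ] E := mfderiv 𝓘(ℝ, E) 𝓘(ℝ, E) c.φ x
  have hA : D.comp A = (ContinuousLinearMap.inl ℝ E ℝ).comp C := by
    have h := mfderiv_comp (I' := 𝓘(ℝ, E × ℝ)) x (g := c'.φ)
      (f := fun y : M => (y, ((0 : ℝ) : OnePoint ℝ))) (c'.mdiffAt hx')
      ((contMDiff_incl_left _).contMDiffAt.mdifferentiableAt (by simp))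
    have h2 : c'.φ ∘ (fun y : M => (y, ((0 : ℝ) : OnePoint ℝ))) =
        (ContinuousLinearMap.inl ℝ E ℝ) ∘ c.φ := by
      funext y
      change (c.φ y, rpAffine _) = (c.φ y, (0 : ℝ))
      rw [rpAffine_coe]
    have h3 := mfderiv_comp (I := 𝓘(ℝ, E)) (I' := 𝓘(ℝ, E)) (I'' := 𝓘(ℝ, E × ℝ)) x
      ((ContinuousLinearMap.inl ℝ E ℝ).differentiableAt).mdifferentiableAt (c.mdiffAt hx)
    rw [mfderiv_eq_fderiv, ContinuousLinearMap.fderiv] at h3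
    rw [h2] at h
    exact h.symm.trans h3
  have hB : D.comp B = ContinuousLinearMap.inr ℝ E ℝ := by
    have h := mfderiv_comp (I' := 𝓘(ℝ, E × ℝ)) (0 : ℝ) (g := c'.φ)
      (f := fun t : ℝ => (x, (t : OnePoint ℝ))) (c'.mdiffAt hx')
      ((contMDiff_incl_right x).contMDiffAt.mdifferentiableAt (by simp))
    have h2 : c'.φ ∘ (fun t : ℝ => (x, (t : OnePoint ℝ))) =
        fun t : ℝ => (c.φ x, t) := by
      funext t
      change (c.φ x, rpAffine _) = (c.φ x, t)
      rw [rpAffine_coe]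
    rw [h2, mfderiv_eq_fderiv] at h
    exact h.symm.trans (hasFDerivAt_prodMk_right (c.φ x) 0).fderiv
  have hA' : D (A v) = (C v, 0) := DFunLike.congr_fun hA v
  have hB' : D (B 1) = (0, 1) := DFunLike.congr_fun hB 1
  change c'.P (D (A v + B 1)) = _
  rw [map_add, hA', hB']
  change (c.P (C v + 0), (0 : ℝ) + 1) = (c.P (C v), 1)
  simp

/-- In the coordinates of a slice chart of `N`, the embedding is the identity. -/
lemma sliceCoord_embed (c : SliceChart N) {a : NormalDeformation N} (ha : a.p ∈ c.φ.source) :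
    BlowUp.form (embedChart c) (embed N a) ≠ 0 ∧
      BlowUp.sliceCoord (embedChart c) (embed N a) = NormalDeformation.sliceCoord c a := by
  cases a with
  | away x t ht =>
    have h1 : (embedChart c).φ (x, (t : OnePoint ℝ)) = (c.φ x, t) := by
      change (c.φ x, rpAffine _) = _
      rw [rpAffine_coe]
    constructor
    · change (embedChart c).ℓ ((embedChart c).φ (x, (t : OnePoint ℝ))) ≠ 0
      rw [h1]; exact ht
    · simp only [embed, BlowUp.sliceCoord, h1, NormalDeformation.sliceCoord, SliceChart.dil]
      change t⁻¹ • (c.P (c.φ x), t) - (0, 1) + t • (0, 1) + ((c.φ x, t) - (c.P (c.φ x), t)) =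
        (c.φ x - c.P (c.φ x) + t⁻¹ • c.P (c.φ x), t)
      ext
      · simp; abel
      · simp [ht]
  | normal x hx ξ =>
    have hx' : x ∈ c.φ.source := ha
    have hxc : (x, ((0 : ℝ) : OnePoint ℝ)) ∈ (embedChart c).φ.source := ⟨hx', coe_mem_rpAffine 0⟩
    have h1 : (embedChart c).φ (x, ((0 : ℝ) : OnePoint ℝ)) = (c.φ x, 0) := by
      change (c.φ x, rpAffine _) = _
      rw [rpAffine_coe]
    obtain ⟨a, ha, hrep⟩ := BlowUp.exists_rep (embedChart c).toSliceChart
      (x := (x, ((0 : ℝ) : OnePoint ℝ))) ⟨hx, rfl⟩ hxc (mk_liftVec_ne_zero N x ξ.out)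
    rw [embedChart_dP_liftVec c hx'] at hrep
    have hℓ : (embedChart c).ℓ (a • ((c.dP x ξ.out, 1) : E × ℝ)) = a := by
      change a * 1 = a
      rw [mul_one]
    constructor
    · simp only [embed, BlowUp.form, hrep, hℓ]; exact ha
    · simp only [embed, BlowUp.sliceCoord, hrep, hℓ, h1, NormalDeformation.sliceCoord,
        smul_smul, inv_mul_cancel₀ ha, one_smul]
      change (c.dP x ξ.out, (1 : ℝ)) - (0, 1) + (c.φ x, 0) = (c.φ x + c.dP x ξ.out, 0)
      ext
      · simp; abel
      · simp

variable [CompleteSpace E]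

lemma isLocalDiffeomorph_embed :
    IsLocalDiffeomorph 𝓘(ℝ, E × ℝ) 𝓘(ℝ, E × ℝ) ω (embed N) := by
  intro a
  cases a with
  | away x t ht =>
    have hφ : chartAt E x ∈ IsManifold.maximalAtlas 𝓘(ℝ, E) ω M :=
      IsManifold.chart_mem_maximalAtlas x
    let ψ : OpenPartialHomeomorph (M × OnePoint ℝ) (E × ℝ) := (chartAt E x).prod rpAffine
    have hopen : IsOpen (center N).carrierᶜ := (center N).isClosed.isOpen_compl
    have hψ : ψ.restr (center N).carrierᶜ ∈
        IsManifold.maximalAtlas 𝓘(ℝ, E × ℝ) ω (M × OnePoint ℝ) :=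
      restr_mem_maximalAtlas _ (prod_mem_maximalAtlas hφ rpAffine_mem_maximalAtlas) hopen
    have hsrc : (ψ.restr (center N).carrierᶜ).source = ψ.source ∩ (center N).carrierᶜ :=
      OpenPartialHomeomorph.restr_source' _ _ hopen
    have hψN : ∀ q ∈ (ψ.restr (center N).carrierᶜ).source, q ∉ (center N).carrier := by
      intro q hq
      rw [hsrc] at hq
      exact hq.2
    let b₀ := embed N (.away x t ht)
    refine isLocalDiffeomorphAt_of_charts
      (NormalDeformation.openPartialHomeomorph_mem _ (Or.inl ⟨_, hφ, rfl⟩))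
      (BlowUp.openPartialHomeomorph_mem _ (Or.inl ⟨_, hψN, b₀, hψ, rfl⟩))
      (x := NormalDeformation.away x t ht) ⟨mem_chart_source E x, ht⟩ ?_ ?_
    · intro a ha
      change (embed N a).proj ∈ (ψ.restr (center N).carrierᶜ).source
      rw [hsrc, proj_embed]
      exact ⟨⟨ha.1, coe_mem_rpAffine _⟩, fun h => ha.2 (OnePoint.coe_injective h.2)⟩
    · intro a ha
      change ψ (embed N a).proj = (chartAt E x a.p, a.s)
      rw [proj_embed]
      change (chartAt E x a.p, rpAffine _) = _
      rw [rpAffine_coe]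
  | normal x hx ξ =>
    obtain ⟨φ, hφ, hxφ, P, hP, hm⟩ := N.exists_slice x hx
    let c : SliceChart N := ⟨φ, hφ, P, hP, hm⟩
    let b₀ := embed N (.normal x hx ξ)
    refine isLocalDiffeomorphAt_of_charts
      (NormalDeformation.openPartialHomeomorph_mem _ (Or.inr ⟨c, rfl⟩))
      (BlowUp.openPartialHomeomorph_mem _ (Or.inr ⟨embedChart c, b₀, rfl⟩))
      (x := NormalDeformation.normal x hx ξ) hxφ ?_ ?_
    · intro a ha
      refine ⟨?_, (sliceCoord_embed c ha).1⟩
      rw [proj_embed]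
      exact ⟨ha, coe_mem_rpAffine _⟩
    · intro a ha
      exact (sliceCoord_embed c ha).2

lemma embed_injective : Function.Injective (embed N) := by
  intro a b hab
  have hp : (a.p, (a.s : OnePoint ℝ)) = (b.p, (b.s : OnePoint ℝ)) := by
    rw [← proj_embed, ← proj_embed, hab]
  have hp1 : a.p = b.p := congrArg Prod.fst hp
  have hp2 : a.s = b.s := OnePoint.coe_injective (congrArg Prod.snd hp)
  have key : ∀ a b : NormalDeformation N, a.p = b.p → a.p ∈ N.carrier → embed N a = embed N b →
      a = b := by
    intro a b hp hN hab
    obtain ⟨φ, hφ, hxφ, P, hP, hm⟩ := N.exists_slice _ hN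
    let c : SliceChart N := ⟨φ, hφ, P, hP, hm⟩
    have hb : b.p ∈ c.φ.source := hp ▸ hxφ
    refine (NormalDeformation.sliceChart c).injOn hxφ hb ?_
    change NormalDeformation.sliceCoord c a = NormalDeformation.sliceCoord c b
    rw [← (sliceCoord_embed c hxφ).2, ← (sliceCoord_embed c hb).2, hab]
  cases a with
  | normal x hx ξ => exact key _ _ hp1 hx hab
  | away x t ht =>
    cases b with
    | normal y hy ξ => exact (key _ _ hp1.symm hy hab.symm).symm
    | away y u hu =>
      have h1 : x = y := hp1
      have h2 : t = u := hp2
      subst h1; subst h2; rfl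

lemma isOpenEmbedding_embed : IsOpenEmbedding (embed N) :=
  isLocalDiffeomorph_embed.isLocalHomeomorph.isOpenEmbedding_of_injective embed_injective

end Embedding

/-! ### Subanalyticity and density -/

section SemianalyticSets

variable {F : Type*} [NormedAddCommGroup F] [NormedSpace ℝ F] {H : Type*} [TopologicalSpace H]
  {I : ModelWithCorners ℝ F H} {X : Type*} [TopologicalSpace X] [ChartedSpace H X]

lemma isSemianalytic_of_locally_ne_zero {A : Set X}
    (h : ∀ x : X, ∃ U : Set X, IsOpen U ∧ x ∈ U ∧ ∃ f : X → ℝ, ContMDiffOn I 𝓘(ℝ, ℝ) ω f U ∧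
      ∀ y ∈ U, y ∈ A ↔ f y ≠ 0) : IsSemianalytic I A := by
  intro x
  obtain ⟨U, hU, hx, f, hf, hA⟩ := h x
  -- `f ≠ 0` is the inequality `0 < f * f`
  refine ⟨U, hU, hx, 1, 1, fun _ _ => 0, fun _ _ y => f y * f y,
    fun _ => contMDiffOn_const,
    fun _ _ => hf.mul hf, fun y hy => ?_⟩
  rw [hA y hy]
  simp

lemma isSemianalytic_of_locally_eq_zero {A : Set X}
    (h : ∀ x : X, ∃ U : Set X, IsOpen U ∧ x ∈ U ∧ ∃ f : X → ℝ, ContMDiffOn I 𝓘(ℝ, ℝ) ω f U ∧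
      ∀ y ∈ U, y ∈ A ↔ f y = 0) : IsSemianalytic I A := by
  intro x
  obtain ⟨U, hU, hx, f, hf, hA⟩ := h x
  refine ⟨U, hU, hx, 1, 0, fun _ => f, fun _ => Fin.elim0, fun _ => hf,
    fun _ j => j.elim0, fun y hy => ?_⟩
  rw [hA y hy]
  simp

/-- Small coordinate balls are relatively compact and given by one analytic inequality. -/
lemma exists_coordinate_ball [FiniteDimensional ℝ F] [I.Boundaryless] [IsManifold I ω X]
    (x : X) {V : Set X} (hV : IsOpen V) (hxV : x ∈ V) :
    ∃ W U K : Set X, IsOpen W ∧ W ⊆ V ∧ IsOpen U ∧ x ∈ U ∧ U ⊆ K ∧ IsCompact K ∧ K ⊆ W ∧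
      ∃ ρ : X → ℝ, ContMDiffOn I 𝓘(ℝ, ℝ) ω ρ W ∧ ∀ y ∈ W, y ∈ U ↔ 0 < ρ y := by
  have hWo : IsOpen ((extChartAt I x).source ∩ V) := (isOpen_extChartAt_source x).inter hV
  have hnhds : (extChartAt I x).target ∩ (extChartAt I x).symm ⁻¹' ((extChartAt I x).source ∩ V) ∈
      𝓝 (extChartAt I x x) := by
    refine inter_mem (extChartAt_target_mem_nhds x) ?_
    refine (continuousAt_extChartAt_symm x).preimage_mem_nhds ?_
    rw [extChartAt_to_inv]
    exact hWo.mem_nhds ⟨mem_extChartAt_source x, hxV⟩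
  obtain ⟨r, hr, hrS⟩ := Euclidean.nhds_basis_closedBall.mem_iff.1 hnhds
  have hU := (continuousOn_extChartAt (I := I) x).isOpen_inter_preimage
    (isOpen_extChartAt_source x) (Euclidean.isOpen_ball (x := extChartAt I x x) (r := r))
  have hK : IsCompact ((extChartAt I x).symm '' Euclidean.closedBall (extChartAt I x x) r) :=
    Euclidean.isCompact_closedBall.image_of_continuousOn
      ((continuousOn_extChartAt_symm x).mono fun v hv => (hrS hv).1)
  have hKW : (extChartAt I x).symm '' Euclidean.closedBall (extChartAt I x x) r ⊆
      (extChartAt I x).source ∩ V := by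
    rintro _ ⟨v, hv, rfl⟩
    exact (hrS hv).2
  have hUK : (extChartAt I x).source ∩ extChartAt I x ⁻¹' Euclidean.ball (extChartAt I x x) r ⊆
      (extChartAt I x).symm '' Euclidean.closedBall (extChartAt I x x) r := fun y hy =>
    ⟨_, Euclidean.ball_subset_closedBall hy.2, (extChartAt I x).left_inv hy.1⟩
  have hρ : ContMDiffOn I 𝓘(ℝ, ℝ) ω
      (fun y => r ^ 2 - ‖toEuclidean (extChartAt I x y) - toEuclidean (extChartAt I x x)‖ ^ 2)
      ((extChartAt I x).source ∩ V) := by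
    have h1 : ContDiff ℝ ω
        fun v : F => r ^ 2 - ‖toEuclidean v - toEuclidean (extChartAt I x x)‖ ^ 2 :=
      contDiff_const.sub ((contDiff_norm_sq ℝ).comp
        ((toEuclidean (E := F)).contDiff.sub contDiff_const))
    have h2 : ContMDiffOn I 𝓘(ℝ, F) ω (extChartAt I x) (extChartAt I x).source := by
      rw [extChartAt_source]; exact contMDiffOn_extChartAt
    exact h1.contMDiff.comp_contMDiffOn (h2.mono inter_subset_left)
  have hxU : x ∈ (extChartAt I x).source ∩
      extChartAt I x ⁻¹' Euclidean.ball (extChartAt I x x) r :=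
    ⟨mem_extChartAt_source x,
      mem_preimage.2 (Euclidean.mem_ball_self (x := extChartAt I x x) hr)⟩
  refine ⟨_, _, _, hWo, inter_subset_right, hU, hxU, hUK, hK, hKW, _, hρ, fun y hy => ?_⟩
  have h3 : y ∈ (extChartAt I x).source ∩
      extChartAt I x ⁻¹' Euclidean.ball (extChartAt I x x) r ↔
      Euclidean.dist (extChartAt I x y) (extChartAt I x x) < r :=
    ⟨fun h => h.2, fun h => ⟨hy.1, h⟩⟩
  rw [h3, sub_pos, sq_lt_sq₀ (norm_nonneg _) hr.le, ← dist_eq_norm, Euclidean.dist]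

/-- Semianalytic sets are subanalytic: no projection is needed, and a small coordinate ball cuts
out a relatively compact semianalytic piece. -/
theorem IsSemianalytic.isSubanalytic [FiniteDimensional ℝ F] [I.Boundaryless] [IsManifold I ω X]
    [T2Space X] {Z : Set X} (h : IsSemianalytic I Z) : IsSubanalytic I Z := by
  intro x
  obtain ⟨V, hV, hxV, m, n, f, g, hf, hg, hm⟩ := h x
  obtain ⟨W, U, K, hW, hWV, hU, hxU, hUK, hK, hKW, ρ, hρ, hρU⟩ :=
    exists_coordinate_ball (I := I) x hV hxV
  have hW1 : ∀ {q : X → ℝ}, ContMDiffOn I 𝓘(ℝ, ℝ) ω q W →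
      ContMDiffOn (I.prod 𝓘(ℝ, EuclideanSpace ℝ (Fin 0))) 𝓘(ℝ, ℝ) ω
        (fun z : X × EuclideanSpace ℝ (Fin 0) => q z.1) (W ×ˢ univ) :=
    fun hq => hq.comp contMDiffOn_fst fun z hz => hz.1
  refine ⟨U, hU, hxU, 0, (Z ∩ U) ×ˢ univ, ?_, ?_, (fst_image_prod _ univ_nonempty).symm⟩
  · rintro ⟨y, w⟩
    by_cases hy : y ∈ W
    · refine ⟨W ×ˢ univ, hW.prod isOpen_univ, ⟨hy, mem_univ _⟩, m, n + 1,
        fun i z => f i z.1, fun i => Fin.cons (fun z => ρ z.1) fun j z => g i j z.1,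
        fun i => hW1 ((hf i).mono hWV), fun i j => ?_, fun z hz => ?_⟩
      · refine Fin.cases ?_ (fun j => ?_) j
        · exact hW1 hρ
        · exact hW1 ((hg i j).mono hWV)
      · have h1 := hm z.1 (hWV hz.1)
        have h2 := hρU z.1 hz.1
        simp only [mem_prod, mem_inter_iff, mem_univ, and_true, h1, h2, Fin.forall_fin_succ,
          Fin.cons_zero, Fin.cons_succ]
        constructor
        · rintro ⟨⟨i, h3, h4⟩, h5⟩; exact ⟨i, h3, h5, h4⟩
        · rintro ⟨i, h3, h5, h4⟩; exact ⟨⟨i, h3, h4⟩, h5⟩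
    · refine ⟨Kᶜ ×ˢ univ, hK.isClosed.isOpen_compl.prod isOpen_univ,
        ⟨fun h => hy (hKW h), mem_univ _⟩, 0, 0, fun i => i.elim0, fun i => i.elim0,
        fun i => i.elim0, fun i => i.elim0, fun z hz => ?_⟩
      simp only [IsEmpty.exists_iff, iff_false]
      exact fun h => hz.1 (hUK h.1.2)
  · have hE : IsCompact (univ : Set (EuclideanSpace ℝ (Fin 0))) := (Set.toFinite univ).isCompact
    exact (hK.prod hE).closure_of_subset (prod_mono (inter_subset_right.trans hUK) Subset.rfl)

/-- The graph of an analytic map is semianalytic. -/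
lemma isSemianalytic_graph {G : Type*} [NormedAddCommGroup G] [NormedSpace ℝ G]
    [FiniteDimensional ℝ G] {Y : Type*} [TopologicalSpace Y] [ChartedSpace G Y] [T2Space Y]
    [IsManifold 𝓘(ℝ, G) ω Y] {f : X → Y} (hf : ContMDiff I 𝓘(ℝ, G) ω f) :
    IsSemianalytic (I.prod 𝓘(ℝ, G)) {z : X × Y | z.2 = f z.1} := by
  refine isSemianalytic_of_locally_eq_zero fun z => ?_
  have hf1 : ContMDiff (I.prod 𝓘(ℝ, G)) 𝓘(ℝ, G) ω fun z : X × Y => f z.1 :=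
    hf.comp contMDiff_fst
  by_cases hz : z.2 = f z.1
  · set φ := chartAt G z.2
    have hφ : ContMDiffOn 𝓘(ℝ, G) 𝓘(ℝ, G) ω φ φ.source := contMDiffOn_chart
    refine ⟨{z | z.2 ∈ φ.source ∧ f z.1 ∈ φ.source},
      (φ.open_source.preimage continuous_snd).inter (φ.open_source.preimage hf1.continuous),
      ⟨mem_chart_source G z.2, hz ▸ mem_chart_source G z.2⟩,
      fun z => ‖toEuclidean (φ z.2 - φ (f z.1))‖ ^ 2, ?_, fun y hy => ?_⟩
    · have h1 : ContDiff ℝ ω fun v : G => ‖toEuclidean v‖ ^ 2 :=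
        (contDiff_norm_sq ℝ).comp (toEuclidean (E := G)).contDiff
      refine h1.contMDiff.comp_contMDiffOn ?_
      exact (hφ.comp contMDiffOn_snd fun z hz => hz.1).sub
        (hφ.comp hf1.contMDiffOn fun z hz => hz.2)
    · simp only [mem_ofPred_eq, ne_eq, OfNat.ofNat_ne_zero, not_false_eq_true, pow_eq_zero_iff,
        norm_eq_zero, map_eq_zero_iff _ (toEuclidean (E := G)).injective, sub_eq_zero]
      exact (φ.injOn.eq_iff hy.1 hy.2).symm
  · refine ⟨{z | z.2 ≠ f z.1}, isOpen_ne_fun continuous_snd hf1.continuous, hz, fun _ => 1,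
      contMDiffOn_const, fun y hy => ?_⟩
    simpa using hy

end SemianalyticSets

section Range

variable {E : Type*} [NormedAddCommGroup E] [NormedSpace ℝ E]
  {M : Type*} [TopologicalSpace M] [ChartedSpace E M] [IsManifold 𝓘(ℝ, E) ω M]
  {N : ClosedSubmanifold E M}

lemma mem_range_embed_iff_of_notMem {b : BlowUp (center N)} (hb : b.proj ∉ (center N).carrier)
    {t : ℝ} (ht : b.proj.2 = t) : b ∈ range (embed N) ↔ t ≠ 0 := by
  constructor
  · rintro ⟨a, rfl⟩
    rw [proj_embed] at ht
    have ht' : a.s = t := OnePoint.coe_injective ht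
    rw [← ht']
    cases a with
    | away x u hu => exact hu
    | normal x hx ξ => exact absurd ⟨hx, rfl⟩ hb
  · intro h
    cases b with
    | away q hq =>
      obtain ⟨x, z⟩ := q
      have hz : z = t := ht
      subst hz
      exact ⟨.away x t h, rfl⟩
    | exc q hq L => exact absurd hq hb

/-- Over a slice chart of `N`, the normal deformation is the affine chart of the blow-up given by
the linear form `t`. -/
lemma mem_range_embed_iff_form (c : SliceChart N) {b : BlowUp (center N)}
    (hb : b.proj ∈ (embedChart c).φ.source) :
    b ∈ range (embed N) ↔ BlowUp.form (embedChart c) b ≠ 0 := by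
  constructor
  · rintro ⟨a, rfl⟩
    rw [proj_embed] at hb
    exact (sliceCoord_embed c hb.1).1
  · intro h
    let e := BlowUp.sliceChart (embedChart c) b
    have hbs : b ∈ e.source := ⟨hb, h⟩
    have ht : BlowUp.down (embedChart c) (e b) ∈ (embedChart c).φ.target := e.map_source hbs
    have hd : (BlowUp.down (embedChart c) (e b)).1 = c.dil (e b).1 (e b).2 := by
      obtain ⟨v, t⟩ := e b
      have hl : BlowUp.lift (embedChart c) (v, t) = (v, 1) := by
        change (v, t) - t • ((0 : E), (1 : ℝ)) + (0, 1) = (v, 1)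
        simp
      rw [BlowUp.down, hl]
      rfl
    have ht' : c.dil (e b).1 (e b).2 ∈ c.φ.target := hd ▸ ht.1
    let a := (NormalDeformation.sliceChart c).symm (e b)
    have ha : a ∈ (NormalDeformation.sliceChart c).source :=
      (NormalDeformation.sliceChart c).map_target ht'
    refine ⟨a, e.injOn ⟨?_, (sliceCoord_embed c ha).1⟩ hbs ?_⟩
    · rw [proj_embed]; exact ⟨ha, coe_mem_rpAffine _⟩
    · exact (sliceCoord_embed c ha).2.trans ((NormalDeformation.sliceChart c).right_inv ht')

lemma contMDiff_fst_X :
    ContMDiff 𝓘(ℝ, E × ℝ) 𝓘(ℝ, E) ω (Prod.fst : M × OnePoint ℝ → M) := by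
  have h : ContMDiff (𝓘(ℝ, E).prod 𝓘(ℝ, ℝ)) 𝓘(ℝ, E) ω (Prod.fst : M × OnePoint ℝ → M) :=
    contMDiff_fst
  rw [modelWithCornersSelf_prod]
  exact h

lemma contMDiff_snd_X :
    ContMDiff 𝓘(ℝ, E × ℝ) 𝓘(ℝ, ℝ) ω (Prod.snd : M × OnePoint ℝ → OnePoint ℝ) := by
  have h : ContMDiff (𝓘(ℝ, E).prod 𝓘(ℝ, ℝ)) 𝓘(ℝ, ℝ) ω
      (Prod.snd : M × OnePoint ℝ → OnePoint ℝ) := contMDiff_snd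
  rw [modelWithCornersSelf_prod]
  exact h

variable [CompleteSpace E]

/-- The complement of the normal deformation in the blow-up is locally the zero set of one analytic
function: of `1 / t` near `t = ∞`, of `t` outside the exceptional divisor, and of the normalized
coordinate `t` at the exceptional divisor. -/
lemma isSemianalytic_range_embed : IsSemianalytic 𝓘(ℝ, E × ℝ) (range (embed N)) := by
  have hproj : ContMDiff 𝓘(ℝ, E × ℝ) 𝓘(ℝ, E × ℝ) ω (BlowUp.proj : BlowUp (center N) → _) :=
    BlowUp.contMDiff_proj
  have hparam : ContMDiff 𝓘(ℝ, E × ℝ) 𝓘(ℝ, ℝ) ω (fun b : BlowUp (center N) => b.proj.2) :=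
    contMDiff_snd_X.comp hproj
  refine isSemianalytic_of_locally_ne_zero fun b => ?_
  cases b with
  | away q hq =>
    obtain ⟨x, z⟩ := q
    by_cases hz : z = OnePoint.infty
    · refine ⟨{b | b.proj.2 ∈ rpInfty.source}, rpInfty.open_source.preimage hparam.continuous, ?_,
        fun b => rpInfty b.proj.2, ?_, fun b hb => ?_⟩
      · change z ∈ rpInfty.source
        rw [mem_rpInfty_iff, hz, rpInv_infty]
        exact OnePoint.coe_ne_infty _
      · exact (contMDiffOn_of_mem_maximalAtlas rpInfty_mem_maximalAtlas).comp
          hparam.contMDiffOn fun b hb => hb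
      · have hb' : rpInv b.proj.2 ≠ OnePoint.infty := (mem_rpInfty_iff _).1 hb
        change b ∈ range (embed N) ↔ rpInfty b.proj.2 ≠ 0
        rw [rpInfty_apply]
        rcases OnePoint.ne_infty_iff_exists.1 hb' with ⟨t, ht⟩
        rw [← ht, rpAffine_coe]
        have hb2 : b.proj.2 = rpInv t := by rw [ht, rpInv_rpInv]
        by_cases ht0 : t = 0
        · subst ht0
          rw [rpInv_zero] at hb2
          simp only [ne_eq, not_true_eq_false, iff_false]
          rintro ⟨a, rfl⟩
          rw [proj_embed] at hb2
          exact OnePoint.coe_ne_infty _ hb2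
        · rw [rpInv_coe ht0] at hb2
          have hbN : b.proj ∉ (center N).carrier := by
            intro h
            have h2 : b.proj.2 = ((0 : ℝ) : OnePoint ℝ) := h.2
            rw [hb2] at h2
            exact inv_ne_zero ht0 (OnePoint.coe_injective h2)
          rw [mem_range_embed_iff_of_notMem hbN hb2]
          simp
    · refine ⟨{b | b.proj ∈ (center N).carrierᶜ ∧ b.proj.2 ∈ rpAffine.source},
        ((center N).isClosed.isOpen_compl.preimage hproj.continuous).inter
          (rpAffine.open_source.preimage hparam.continuous), ⟨hq, (mem_rpAffine_iff z).2 hz⟩,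
        fun b => rpAffine b.proj.2, ?_, fun b hb => ?_⟩
      · exact (contMDiffOn_of_mem_maximalAtlas rpAffine_mem_maximalAtlas).comp
          hparam.contMDiffOn fun b hb => hb.2
      · rcases OnePoint.ne_infty_iff_exists.1 ((mem_rpAffine_iff _).1 hb.2) with ⟨t, ht⟩
        change b ∈ range (embed N) ↔ rpAffine b.proj.2 ≠ 0
        rw [← ht, rpAffine_coe]
        exact mem_range_embed_iff_of_notMem hb.1 ht.symm
  | exc q hq L =>
    obtain ⟨x, z⟩ := q
    obtain ⟨φ, hφ, hxφ, P, hP, hm⟩ := N.exists_slice x hq.1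
    let c : SliceChart N := ⟨φ, hφ, P, hP, hm⟩
    have hqc : (x, z) ∈ (embedChart c).φ.source := by
      have hz : z = ((0 : ℝ) : OnePoint ℝ) := hq.2
      exact ⟨hxφ, hz ▸ coe_mem_rpAffine 0⟩
    set d := embedChart c with hd
    obtain ⟨a, hqa, hL⟩ := BlowUp.exists_affineSliceChart hq L
    let e := BlowUp.sliceHomeo a (.exc (x, z) hq L)
    have hbe : .exc (x, z) hq L ∈ e.source := ⟨hqa, hL⟩
    have hov : ∀ b ∈ e.source, b.proj ∈ d.φ.source →
        BlowUp.down a (e b) ∈ overlap a.φ d.φ := by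
      intro b hb hbd
      have h1 : BlowUp.down a (e b) ∈ a.φ.target := e.map_source hb
      have h2 := BlowUp.proj_sliceParam a (.exc (x, z) hq L) h1
      have h3 : BlowUp.sliceParam a (.exc (x, z) hq L) (e b) = b := e.left_inv hb
      rw [h3] at h2
      exact ⟨h1, by rw [mem_preimage, ← h2]; exact hbd⟩
    refine ⟨{b | b ∈ e.source ∧ b.proj ∈ d.φ.source},
      e.open_source.inter (d.φ.open_source.preimage hproj.continuous), ⟨hbe, hqc⟩,
      fun b => d.ℓ (a.quot d.toSliceChart (BlowUp.lift a (e b)) (a.ℓ (e b))), ?_, fun b hb => ?_⟩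
    · intro b hb
      have h1 : ContMDiffAt 𝓘(ℝ, E × ℝ) 𝓘(ℝ, E × ℝ) ω e b :=
        contMDiffAt_of_mem_maximalAtlas (BlowUp.openPartialHomeomorph_mem _ _) hb.1
      have h2 : ContDiffAt ℝ ω
          (fun v => d.ℓ (a.quot d.toSliceChart (BlowUp.lift a v) (a.ℓ v))) (e b) :=
        d.ℓ.contDiff.contDiffAt.comp (e b) (BlowUp.contDiffAt_quot a d (hov b hb.1 hb.2))
      exact (ContMDiffAt.comp (g := fun v =>
        d.ℓ (a.quot d.toSliceChart (BlowUp.lift a v) (a.ℓ v))) b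
        h2.contMDiffAt h1).contMDiffWithinAt
    · have h1 := hov b hb.1 hb.2
      have h3 : BlowUp.sliceParam a (.exc (x, z) hq L) (e b) = b := e.left_inv hb.1
      rw [mem_range_embed_iff_form c hb.2]
      have h4 := BlowUp.form_sliceParam a d (.exc (x, z) hq L) h1.1 h1.2
      rwa [h3] at h4

lemma BlowUp.eventually_away_mem {x : M} (hx : x ∉ N.carrier) {S : Set (BlowUp N)}
    (hS : S ∈ 𝓝 (BlowUp.away x hx)) : ∀ᶠ y in 𝓝 x, ∃ hy, BlowUp.away y hy ∈ S := by
  obtain ⟨φ, hφ, hxφ, hφN⟩ := BlowUp.exists_awayChart hx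
  let e := BlowUp.awayHomeo hφN (BlowUp.away x hx) hφ
  have hsymm : ∀ y (hy : y ∈ φ.source), e.symm (φ y) = BlowUp.away y (hφN y hy) :=
    fun y hy => e.left_inv (x := BlowUp.away y (hφN y hy)) hy
  have h1 : Tendsto (fun y => e.symm (φ y)) (𝓝 x) (𝓝 (BlowUp.away x hx)) := by
    rw [← hsymm x hxφ]
    exact (e.continuousAt_symm (x := φ x) (φ.map_source hxφ)).tendsto.comp
      (φ.continuousAt hxφ).tendsto
  filter_upwards [h1 hS, φ.open_source.mem_nhds hxφ] with y hy hyφ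
  exact ⟨hφN y hyφ, hsymm y hyφ ▸ hy⟩

/-- The exceptional divisor is nowhere dense. -/
lemma BlowUp.dense_away : Dense {b : BlowUp N | b.proj ∉ N.carrier} := by
  intro b
  cases b with
  | away x hx => exact subset_closure hx
  | exc x hx L =>
    obtain ⟨c, hxc, hL⟩ := BlowUp.exists_affineSliceChart hx L
    set b := BlowUp.exc x hx L
    let e := BlowUp.sliceHomeo c b
    have hb : b ∈ e.source := ⟨hxc, hL⟩
    -- the curve with the coordinate `s = r`
    have hcont : ContinuousAt (fun r : ℝ => e b + r • c.w) 0 := by fun_prop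
    have h0 : e b + (0 : ℝ) • c.w = e b := by simp
    have hlim : Tendsto (fun r : ℝ => e.symm (e b + r • c.w)) (𝓝[≠] 0) (𝓝 b) := by
      have h1 : ContinuousAt (fun r : ℝ => e.symm (e b + r • c.w)) 0 :=
        ContinuousAt.comp (g := e.symm) (by rw [h0]; exact e.continuousAt_symm (e.map_source hb))
          hcont
      have h2 := h1.tendsto
      rw [h0, e.left_inv hb] at h2
      exact h2.mono_left nhdsWithin_le_nhds
    have htarget : ∀ᶠ r in 𝓝[≠] (0 : ℝ), e b + r • c.w ∈ e.target :=
      nhdsWithin_le_nhds (hcont.preimage_mem_nhds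
        (by rw [h0]; exact e.open_target.mem_nhds (e.map_source hb)))
    refine mem_closure_of_tendsto hlim ?_
    filter_upwards [htarget, self_mem_nhdsWithin] with r hr hr0
    have hr' : BlowUp.down c (e b + r • c.w) ∈ c.φ.target := hr
    have h1 : c.ℓ (e b) = 0 := (BlowUp.lift_sliceCoord_exc c hx hxc L hL).1
    have h2 := BlowUp.proj_sliceParam c b hr'
    change (BlowUp.sliceParam c b (e b + r • c.w)).proj ∉ N.carrier
    rw [h2, BlowUp.mem_iff_ℓ c hr', map_add, map_smul, h1, c.ℓ_w]
    simpa using hr0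

lemma denseRange_embed : DenseRange (embed N) := by
  have h : {b : BlowUp (center N) | b.proj ∉ (center N).carrier} ⊆ closure (range (embed N)) := by
    intro b hb
    cases b with
    | exc q hq L => exact absurd hq hb
    | away q hq =>
      obtain ⟨x, z⟩ := q
      rw [mem_closure_iff_nhds]
      intro S hS
      have h1 : ∀ᶠ y in 𝓝 z, ∃ hy, BlowUp.away (N := center N) (x, y) hy ∈ S :=
        (Continuous.prodMk_right x).continuousAt.eventually (BlowUp.eventually_away_mem hq hS)
      have h2 : Dense ({OnePoint.infty}ᶜ ∩ {((0 : ℝ) : OnePoint ℝ)}ᶜ) :=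
        (dense_compl_singleton _).inter_of_isOpen_left (dense_compl_singleton _)
          isOpen_compl_singleton
      obtain ⟨y, ⟨hy1, hy2⟩, hyN, hyS⟩ := (h2.inter_nhds_nonempty h1)
      obtain ⟨t, rfl⟩ := OnePoint.ne_infty_iff_exists.1 hy1
      refine ⟨_, hyS, (mem_range_embed_iff_of_notMem hyN rfl).2 ?_⟩
      rintro rfl
      exact hy2 rfl
  exact fun b => closure_minimal h isClosed_closure (BlowUp.dense_away b)

end Range

/-! ### Bordered compactifications -/

section BorderedMaps

variable {U B S C : Type*} [TopologicalSpace U] [TopologicalSpace B] [TopologicalSpace S]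
  [TopologicalSpace C]

/-- If `p : U → S` extends to a continuous map `f` on a space `B` in which `U` is dense, the closure
of its graph is the graph of `f`. -/
lemma graphClosure_eq_graph [T2Space S] {j : U → B} (hj : DenseRange j) {f : B → S}
    (hf : Continuous f) {p : U → S} (hp : ∀ u, f (j u) = p u) :
    graphClosure j (id : S → S) p = {z | z.2 = f z.1} := by
  refine Subset.antisymm (closure_minimal ?_ (isClosed_eq continuous_snd (by fun_prop))) ?_
  · rintro _ ⟨u, rfl⟩
    exact (hp u).symm
  · rintro ⟨b, s⟩ h
    have hs : s = f b := h
    subst hs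
    refine map_mem_closure (f := fun b => (b, f b)) (by fun_prop) (hj b) ?_
    rintro _ ⟨u, rfl⟩
    exact ⟨u, by simp [hp u]⟩

lemma isProperMap_graph_fst {f : B → S} (hf : Continuous f) {Z : Set (B × S)}
    (hZ : Z = {z | z.2 = f z.1}) : IsProperMap fun z : Z => z.1.1 := by
  subst hZ
  refine isProperMap_iff_ultrafilter.2 ⟨by fun_prop, fun 𝒰 b h => ⟨⟨(b, f b), rfl⟩, rfl, ?_⟩⟩
  have h2 : Tendsto (fun z : {z : B × S | z.2 = f z.1} => z.1) 𝒰 (𝓝 (b, f b)) := by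
    rw [nhds_prod_eq]
    refine h.prodMk (((hf.tendsto b).comp h).congr fun z => ?_)
    exact z.2.symm
  rw [nhds_subtype_eq_comap]
  exact tendsto_iff_comap.1 h2

/-- If `p` extends to a proper map `f` on a bordered space in which `U` is dense, this is a bordered
compactification of `U`. -/
lemma isBorderedCompactification_of_isProperMap [T2Space S] {j : U → B} (hB : IsBorderedSpace j)
    (hj : DenseRange j) {f : B → S} (hf : IsProperMap f) {p : U → S} (hp : ∀ u, f (j u) = p u) :
    IsBorderedCompactification j p := by
  have hG := graphClosure_eq_graph hj hf.continuous hp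
  have h1 := isProperMap_graph_fst hf.continuous hG
  refine ⟨hB, ⟨?_, h1⟩, ?_⟩
  · rw [← funext hp]
    exact hf.continuous.comp hB.isOpenEmbedding.continuous
  · have h2 : (fun z : graphClosure j (id : S → S) p => z.1.2) = f ∘ fun z => z.1.1 := by
      funext z
      have hz : z.1 ∈ {z : B × S | z.2 = f z.1} := hG ▸ z.2
      exact hz
    unfold IsSemiproper
    rw [h2]
    exact hf.comp h1

/-- The closure of the graph of the identity of `U` lies over the closure of the graph of `p`, by
the extension `f` of `p` to `B`. -/
lemma graphClosure_id_subset {i : U → C} {j : U → B} {f : B → S} (hf : Continuous f) {p : U → S}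
    (hp : ∀ u, f (j u) = p u) {z : C × B} (hz : z ∈ graphClosure i j id) :
    (z.1, f z.2) ∈ graphClosure i (id : S → S) p := by
  refine map_mem_closure (f := fun z : C × B => (z.1, f z.2)) (by fun_prop) hz ?_
  rintro _ ⟨u, rfl⟩
  exact ⟨u, by simp [hp u]⟩

lemma ultrafilter_le_nhds_prod_subtype {X Y : Type*} [TopologicalSpace X] [TopologicalSpace Y]
    {Z : Set (X × Y)} (hZ : IsClosed Z) {𝒰 : Ultrafilter Z} {x : X} {y : Y}
    (hx : Tendsto (fun z : Z => z.1.1) 𝒰 (𝓝 x)) (hy : Tendsto (fun z : Z => z.1.2) 𝒰 (𝓝 y)) :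
    ∃ h : (x, y) ∈ Z, (𝒰 : Filter Z) ≤ 𝓝 ⟨(x, y), h⟩ := by
  have h2 : Tendsto (fun z : Z => z.1) 𝒰 (𝓝 (x, y)) := hx.prodMk_nhds hy
  refine ⟨hZ.mem_of_tendsto h2 (Eventually.of_forall fun z => z.2), ?_⟩
  rw [nhds_subtype_eq_comap]
  exact tendsto_iff_comap.1 h2

/-- For a bordered compactification `(U, C)` of `U` over `S` and a space `B` proper over `S`, the
identity of `U` is a morphism `(U, C) → (U, B)`. -/
lemma isBorderedMorphism_id_of_isProperMap {i : U → C} {j : U → B} {p : U → S}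
    (hC : IsBorderedMorphism i (id : S → S) p) {f : B → S} (hf : IsProperMap f)
    (hp : ∀ u, f (j u) = p u) : IsBorderedMorphism i j id := by
  refine ⟨continuous_id, isProperMap_iff_ultrafilter.2 ⟨by fun_prop, fun 𝒰 c hc => ?_⟩⟩
  let q : graphClosure i j id → graphClosure i (id : S → S) p :=
    fun z => ⟨(z.1.1, f z.1.2), graphClosure_id_subset hf.continuous hp z.2⟩
  -- the limit over `C` gives a limit in the closure of the graph of `p`, hence over `S`
  obtain ⟨w, -, hw⟩ := hC.isProperMap.ultrafilter_le_nhds_of_tendsto (𝒰 := 𝒰.map q) (y := c) hc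
  have hS : Tendsto (fun z : graphClosure i j id => f z.1.2) 𝒰 (𝓝 w.1.2) :=
    ((show Continuous fun w : graphClosure i (id : S → S) p => w.1.2 by fun_prop).tendsto w).comp hw
  obtain ⟨b, -, hb⟩ := hf.ultrafilter_le_nhds_of_tendsto
    (𝒰 := 𝒰.map fun z : graphClosure i j id => z.1.2) hS
  obtain ⟨h, hle⟩ := ultrafilter_le_nhds_prod_subtype isClosed_closure hc hb
  exact ⟨_, rfl, hle⟩

/-- For a bordered compactification `(U, C)` of `U` over `S` and a space `B` over `S`, the identity
of `U` is a morphism `(U, B) → (U, C)`. -/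
lemma isBorderedMorphism_id_of_isSemiproper {i : U → C} {j : U → B} {p : U → S}
    (hC : IsSemiproper i (id : S → S) p) {f : B → S} (hf : Continuous f)
    (hp : ∀ u, f (j u) = p u) : IsBorderedMorphism j i id := by
  have hmem : ∀ z ∈ graphClosure j i id, (z.2, f z.1) ∈ graphClosure i (id : S → S) p := by
    intro z hz
    refine map_mem_closure (f := fun z : B × C => (z.2, f z.1)) (by fun_prop) hz ?_
    rintro _ ⟨u, rfl⟩
    exact ⟨u, by simp [hp u]⟩
  refine ⟨continuous_id, isProperMap_iff_ultrafilter.2 ⟨by fun_prop, fun 𝒰 b hb => ?_⟩⟩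
  let q : graphClosure j i id → graphClosure i (id : S → S) p :=
    fun z => ⟨(z.1.2, f z.1.1), hmem _ z.2⟩
  have hS : Tendsto (fun z : graphClosure j i id => f z.1.1) 𝒰 (𝓝 (f b)) :=
    (hf.tendsto b).comp hb
  obtain ⟨w, -, hw⟩ := IsProperMap.ultrafilter_le_nhds_of_tendsto hC (𝒰 := 𝒰.map q) hS
  have hc : Tendsto (fun z : graphClosure j i id => z.1.2) 𝒰 (𝓝 w.1.1) :=
    ((show Continuous fun w : graphClosure i (id : S → S) p => w.1.1 by fun_prop).tendsto w).comp hw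
  obtain ⟨h, hle⟩ := ultrafilter_le_nhds_prod_subtype isClosed_closure hb hc
  exact ⟨_, rfl, hle⟩

end BorderedMaps

section Compactification

variable {E : Type*} [NormedAddCommGroup E] [NormedSpace ℝ E] [FiniteDimensional ℝ E]
  {M : Type*} [TopologicalSpace M] [ChartedSpace E M] [IsManifold 𝓘(ℝ, E) ω M]
  {N : ClosedSubmanifold E M}

/-- The blow-up of `M × ℝP` is proper over `M`, since `ℝP` is compact. -/
lemma isProperMap_proj_fst :
    IsProperMap fun b : BlowUp (center N) => b.proj.1 :=
  isProperMap_fst_of_compactSpace.comp BlowUp.isProperMap_proj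

lemma isBorderedSpace_embed [T2Space M] [SigmaCompactSpace M] : IsBorderedSpace (embed N) := by
  have : CompleteSpace E := FiniteDimensional.complete ℝ E
  exact ⟨inferInstance, ChartedSpace.locallyCompactSpace (E × ℝ) _,
    isProperMap_proj_fst.sigmaCompactSpace, isOpenEmbedding_embed⟩

end Compactification

end BorderedND

end

theorem mainTheorem5 {E : Type*} [NormedAddCommGroup E] [NormedSpace ℝ E] [FiniteDimensional ℝ E]
    {M : Type*} [TopologicalSpace M] [ChartedSpace E M] [IsManifold 𝓘(ℝ, E) ω M]
    [T2Space M] [SigmaCompactSpace M] (N : BorderedND.ClosedSubmanifold E M) :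
    -- the normal deformation is a real analytic manifold
    IsManifold 𝓘(ℝ, E × ℝ) ω (BorderedND.NormalDeformation N) ∧
    -- the embedding lies over the inclusion of `M × ℝ` in `M × ℝP`
    (∀ d : BorderedND.NormalDeformation N,
      (BorderedND.embed N d).proj = (d.p, (d.s : OnePoint ℝ))) ∧
    -- with this open embedding, the pair is a real analytic bordered space over `M`
    BorderedND.IsRealAnalyticBorderedSpace (E × ℝ) (BorderedND.embed N) ∧
    BorderedND.IsRealAnalyticBorderedMorphism (E × ℝ) E (BorderedND.embed N) (id : M → M)
      BorderedND.NormalDeformation.p ∧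
    -- it is the bordered compactification of the normal deformation over `M`
    BorderedND.IsBorderedCompactification (BorderedND.embed N)
      (BorderedND.NormalDeformation.p : BorderedND.NormalDeformation N → M) ∧
    -- and any other one is isomorphic to it by the identity of the normal deformation
    (∀ (C : Type*) [TopologicalSpace C] (i : BorderedND.NormalDeformation N → C),
      BorderedND.IsBorderedCompactification i
        (BorderedND.NormalDeformation.p : BorderedND.NormalDeformation N → M) →
      BorderedND.IsBorderedMorphism i (BorderedND.embed N) id ∧
      BorderedND.IsBorderedMorphism (BorderedND.embed N) i id) ∧
    -- the projection of the blow-up to `M` is proper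
    IsProperMap (fun b : BorderedND.BlowUp (BorderedND.center N) => b.proj.1) := by
  have : CompleteSpace E := FiniteDimensional.complete ℝ E
  have hp : ∀ d : BorderedND.NormalDeformation N, (BorderedND.embed N d).proj.1 = d.p := fun d => by
    rw [BorderedND.proj_embed]
  have hB : BorderedND.IsBorderedSpace (BorderedND.embed N) := BorderedND.isBorderedSpace_embed
  have hproper := BorderedND.isProperMap_proj_fst (N := N)
  have hcomp := BorderedND.isBorderedCompactification_of_isProperMap hB
    BorderedND.denseRange_embed hproper hp
  have hsub : BorderedND.IsSubanalytic (𝓘(ℝ, E × ℝ).prod 𝓘(ℝ, E))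
      (BorderedND.graphClosure (BorderedND.embed N) (id : M → M)
        BorderedND.NormalDeformation.p) := by
    rw [BorderedND.graphClosure_eq_graph BorderedND.denseRange_embed hproper.continuous hp]
    exact (BorderedND.isSemianalytic_graph
      (BorderedND.contMDiff_fst_X.comp BorderedND.BlowUp.contMDiff_proj)).isSubanalytic
  exact ⟨inferInstance, BorderedND.proj_embed,
    ⟨hB, inferInstance, BorderedND.isLocalDiffeomorph_embed,
      BorderedND.isSemianalytic_range_embed.isSubanalytic⟩,
    ⟨hcomp.isBorderedMorphism, BorderedND.NormalDeformation.contMDiff_p, hsub⟩, hcomp,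
    fun C _ i hi =>
      ⟨BorderedND.isBorderedMorphism_id_of_isProperMap hi.isBorderedMorphism hproper hp,
        BorderedND.isBorderedMorphism_id_of_isSemiproper hi.isSemiproper hproper.continuous hp⟩,
    hproper⟩
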